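/- **Theorem (spacetime Penrose inequality in spherical symmetry).** Let $n\ge 3$. An initial data set is a triple $(M^n,g,k)$ with $M=\{x\in\mathbb R^n : |x|\ge r_0\}$ for some $r_0\ge 0$ (so $M=\mathbb R^n$ if $r_0=0$), $g$ a Riemannian metric and $k$ a symmetric 2-tensor on $M$, both smooth up to the boundary. Its energy and momentum densities are defined by $16\pi\mu=R_g+(\mathrm{Tr}_gk)^2-|k|_g^2$ and $8\pi J=\mathrm{div}_g(k-(\mathrm{Tr}_gk)g)$, and the dominant energy condition is $\mu\ge|J|_g$ on $M$. The data are *spherically symmetric* if $$g=g_{11}(r)\,dr^2+\rho(r)^2g_{S^{n-1}},\qquad k_{ij}=n_in_jk_n(r)+(g_{ij}-n_in_j)k_t(r),\qquad r=|x|,\quad n=g_{11}^{-1/2}\partial_r ,$$ with $g_{11},\rho>0$ for $r>0$, and *asymptotically flat* if for some constant $C$ and all large $|x|$, in the Cartesian coordinates $x$, $$|\partial^{\beta}(g_{ij}-\delta_{ij})|\le \frac{C}{|x|^{n-2+|\beta|}}\ (|\beta|\le 2),\quad |\partial^{\beta}k_{ij}|\le\frac{C}{|x|^{n-1+|\beta|}}\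 (|\beta|\le1),\quad |R_g|\le\frac{C}{|x|^{n+1}},\quad |\mathrm{Tr}_gk|\le\frac{C}{|x|^n}.$$ The ADM mass is $m=\sqrt{E^2-|P|^2}$, where, with $\omega_{n-1}$ the volume of the unit sphere $S^{n-1}$ and $\nu$ the outer unit normal of the coordinate sphere $S_r$, $$E=\lim_{r\to\infty}\frac{1}{2(n-1)\omega_{n-1}}\int_{S_r}(g_{ij,i}-g_{ii,j})\nu^j,\qquad P_i=\lim_{r\to\infty}\frac{1}{2(n-1)\omega_{n-1}}\int_{S_r}(k_{ij}-(\mathrm{Tr}_gk)g_{ij})\nu^j .$$ An *apparent horizon* is a smooth closed embedded hypersurface $\Sigma\subset M$ of $\mathbb R^n$, bounding a compact region with connected complement, on which $\theta_+=0$ or on which $\theta_-=0$, where $\theta_\pm=H_\Sigma\pm\mathrm{Tr}_\Sigma k$ and $H_\Sigma$ is the mean curvature with respect to the unit normal pointing towards infinity. It is *outermost* if no other apparent horizon encloses it. Let $(M^n,g,k)$ be asymptotically flat, spherically symmetric, and satisfy the dominant energy condition, and let $\mathcal A_0$ be the area, with respect to $g$, of an outermost apparent horizon $\Sigma$. Then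 the limits $E$, $P$ exist and $$m\ \ge\ \frac12\left(\frac{\mathcal A_0}{\omega_{n-1}}\right)^{\frac{n-2}{n-1}} .$$ Equality holds if and only if the initial data strictly outside $\Sigma$ arise from an embedding into the exterior region of a Schwarzschild spacetime of some mass $m'>0$, $$-F\,dt^2+F^{-1}dr^2+r^2g_{S^{n-1}},\qquad F=1-\frac{2m'}{r^{n-2}}>0,$$ that is, $g$ is the induced metric and $k$ the second fundamental form with respect to the future unit normal; in the case of equality one can take $m'=m$. In particular, if $(M_j,g_j,k_j)$ is a sequence of such initial data of dimension $n$, with outermost apparent horizons of area $\mathcal A_j$ and ADM masses $m_j\to0$, then $\mathcal A_j\to0$. -/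

import Mathlib

open MeasureTheory Filter Topology Set
open scoped ContDiff

noncomputable section

namespace SpacetimePenrose

/-! ### Tensor calculus in a global Cartesian chart

A metric on an open piece of coordinate space is a matrix-valued function of the point; all
tensors are given by their components.  Signature plays no role in this part. -/

section Chart

variable {ι : Type*} [Fintype ι] [DecidableEq ι]

/-- The partial derivative `∂ᵢ f` at `x`. -/
def pd (i : ι) (f : EuclideanSpace ℝ ι → ℝ) (x : EuclideanSpace ℝ ι) : ℝ :=
  fderiv ℝ f x (EuclideanSpace.single i 1)

/-- Christoffel symbols `Γᶜ_{ab} = ½ g^{cd} (∂ₐ g_{bd} + ∂_b g_{ad} - ∂_d g_{ab})`. -/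
def christoffel (g : EuclideanSpace ℝ ι → Matrix ι ι ℝ) (c a b : ι)
    (x : EuclideanSpace ℝ ι) : ℝ :=
  (1 / 2) * ∑ d, (g x)⁻¹ c d *
    (pd a (fun y => g y b d) x + pd b (fun y => g y a d) x - pd d (fun y => g y a b) x)

/-- Ricci curvature
`R_{ab} = ∂_c Γᶜ_{ab} - ∂_b Γᶜ_{ac} + Γᶜ_{cd} Γᵈ_{ab} - Γᶜ_{bd} Γᵈ_{ac}`. -/
def ricci (g : EuclideanSpace ℝ ι → Matrix ι ι ℝ) (a b : ι) (x : EuclideanSpace ℝ ι) : ℝ :=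
  ∑ c, (pd c (christoffel g c a b) x - pd b (christoffel g c a c) x
    + ∑ d, (christoffel g c c d x * christoffel g d a b x
      - christoffel g c b d x * christoffel g d a c x))

/-- Scalar curvature `R_g = g^{ab} R_{ab}`. -/
def scalarCurvature (g : EuclideanSpace ℝ ι → Matrix ι ι ℝ) (x : EuclideanSpace ℝ ι) : ℝ :=
  ∑ a, ∑ b, (g x)⁻¹ a b * ricci g a b x

/-- The trace `Tr_g T = g^{ab} T_{ab}`. -/
def trace (g T : EuclideanSpace ℝ ι → Matrix ι ι ℝ) (x : EuclideanSpace ℝ ι) : ℝ :=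
  ∑ a, ∑ b, (g x)⁻¹ a b * T x a b

/-- The squared norm `|T|²_g = g^{ac} g^{bd} T_{ab} T_{cd}`. -/
def normSq (g T : EuclideanSpace ℝ ι → Matrix ι ι ℝ) (x : EuclideanSpace ℝ ι) : ℝ :=
  ∑ a, ∑ b, ∑ c, ∑ d, (g x)⁻¹ a c * (g x)⁻¹ b d * T x a b * T x c d

/-- The covariant derivative `∇ₐ T_{bc}`. -/
def covDeriv (g T : EuclideanSpace ℝ ι → Matrix ι ι ℝ) (a b c : ι)
    (x : EuclideanSpace ℝ ι) : ℝ :=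
  pd a (fun y => T y b c) x
    - ∑ d, (christoffel g d a b x * T x d c + christoffel g d a c x * T x b d)

/-- The divergence `(div_g T)_c = g^{ab} ∇ₐ T_{bc}`. -/
def divergence (g T : EuclideanSpace ℝ ι → Matrix ι ι ℝ) (c : ι)
    (x : EuclideanSpace ℝ ι) : ℝ :=
  ∑ a, ∑ b, (g x)⁻¹ a b * covDeriv g T a b c x

/-- The Hessian `∇ₐ ∇_b u = ∂ₐ ∂_b u - Γᶜ_{ab} ∂_c u`. -/
def hessian (g : EuclideanSpace ℝ ι → Matrix ι ι ℝ) (u : EuclideanSpace ℝ ι → ℝ) (a b : ι)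
    (x : EuclideanSpace ℝ ι) : ℝ :=
  pd a (pd b u) x - ∑ c, christoffel g c a b x * pd c u x

/-- The norm `|du|_g`. -/
def gradNorm (g : EuclideanSpace ℝ ι → Matrix ι ι ℝ) (u : EuclideanSpace ℝ ι → ℝ)
    (x : EuclideanSpace ℝ ι) : ℝ :=
  Real.sqrt (∑ a, ∑ b, (g x)⁻¹ a b * pd a u x * pd b u x)

/-- The `g`-unit normal `νᵃ = g^{ab} ∂_b u / |du|_g` of the level sets of `u`, pointing in the
direction in which `u` increases. -/
def unitNormal (g : EuclideanSpace ℝ ι → Matrix ι ι ℝ) (u : EuclideanSpace ℝ ι → ℝ) (a : ι)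
    (x : EuclideanSpace ℝ ι) : ℝ :=
  (∑ b, (g x)⁻¹ a b * pd b u x) / gradNorm g u x

/-- Mean curvature of the level set of `u` through `x` with respect to `unitNormal`:
`H = (g^{ab} - νᵃ νᵇ) ∇ₐ ∇_b u / |du|_g`, which is the divergence of `ν`. -/
def meanCurvature (g : EuclideanSpace ℝ ι → Matrix ι ι ℝ) (u : EuclideanSpace ℝ ι → ℝ)
    (x : EuclideanSpace ℝ ι) : ℝ :=
  (∑ a, ∑ b, ((g x)⁻¹ a b - unitNormal g u a x * unitNormal g u b x) * hessian g u a b x)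
    / gradNorm g u x

/-- Trace of `T` over the tangent space of the level set of `u` through `x`. -/
def tangentialTrace (g T : EuclideanSpace ℝ ι → Matrix ι ι ℝ) (u : EuclideanSpace ℝ ι → ℝ)
    (x : EuclideanSpace ℝ ι) : ℝ :=
  ∑ a, ∑ b, ((g x)⁻¹ a b - unitNormal g u a x * unitNormal g u b x) * T x a b

end Chart

/-! ### Closed hypersurfaces -/

/-- A smooth closed embedded hypersurface of `ℝⁿ` that bounds a compact region with connected
complement, presented by a defining function `u`: the hypersurface is `{u = 0}`, the enclosed
region is `{u ≤ 0}`, and the unit normal in the direction of increasing `u` points towards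
infinity. -/
structure ClosedHypersurface (n : ℕ) where
  u : EuclideanSpace ℝ (Fin n) → ℝ
  smooth : ContDiff ℝ ∞ u
  regular : ∀ x, u x = 0 → fderiv ℝ u x ≠ 0
  nonempty : ∃ x, u x = 0
  isCompact_enclosed : IsCompact {x | u x ≤ 0}
  isConnected_outside : IsConnected {x | 0 < u x}

/-- The points of the hypersurface. -/
def ClosedHypersurface.carrier {n : ℕ} (S : ClosedHypersurface n) :
    Set (EuclideanSpace ℝ (Fin n)) := {x | S.u x = 0}

/-- The region enclosed by the hypersurface (including the hypersurface). -/
def ClosedHypersurface.enclosed {n : ℕ} (S : ClosedHypersurface n) :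
    Set (EuclideanSpace ℝ (Fin n)) := {x | S.u x ≤ 0}

/-- The region strictly outside the hypersurface. -/
def ClosedHypersurface.outside {n : ℕ} (S : ClosedHypersurface n) :
    Set (EuclideanSpace ℝ (Fin n)) := {x | 0 < S.u x}

/-- The `(n-1)`-dimensional volume of the round unit sphere `S^{n-1}`. -/
def sphereVolume (n : ℕ) : ℝ :=
  (μHE[n - 1] (Metric.sphere (0 : EuclideanSpace ℝ (Fin n)) 1)).toReal

/-! ### Initial data sets -/

/-- The set `{x ∈ ℝⁿ | r₀ ≤ |x|}`: all of `ℝⁿ` for `r₀ = 0`, and the complement of an open ball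
for `r₀ > 0`. -/
def exteriorDomain (n : ℕ) (r₀ : ℝ) : Set (EuclideanSpace ℝ (Fin n)) := {x | r₀ ≤ ‖x‖}

/-- An initial data set `(M, g, k)` on `M = {x ∈ ℝⁿ | r₀ ≤ |x|}`, with a Riemannian metric `g`
and a symmetric 2-tensor `k` that are smooth up to the boundary; the values of `g` and `k` off `M`
only serve to express the latter and are otherwise irrelevant. -/
structure InitialDataSet (n : ℕ) where
  r₀ : ℝ
  r₀_nonneg : 0 ≤ r₀
  g : EuclideanSpace ℝ (Fin n) → Matrix (Fin n) (Fin n) ℝ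
  k : EuclideanSpace ℝ (Fin n) → Matrix (Fin n) (Fin n) ℝ
  smooth_g : ∀ i j, ∀ x ∈ exteriorDomain n r₀, ContDiffAt ℝ ∞ (fun y => g y i j) x
  smooth_k : ∀ i j, ∀ x ∈ exteriorDomain n r₀, ContDiffAt ℝ ∞ (fun y => k y i j) x
  posDef_g : ∀ x ∈ exteriorDomain n r₀, (g x).PosDef
  symm_k : ∀ x ∈ exteriorDomain n r₀, (k x).IsSymm

namespace InitialDataSet

variable {n : ℕ} (D : InitialDataSet n)

/-- The underlying manifold (with boundary if `r₀ > 0`). -/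
def M : Set (EuclideanSpace ℝ (Fin n)) := exteriorDomain n D.r₀

/-- The energy density: `16 π μ = R_g + (Tr_g k)² - |k|²_g`. -/
def energyDensity (x : EuclideanSpace ℝ (Fin n)) : ℝ :=
  (scalarCurvature D.g x + trace D.g D.k x ^ 2 - normSq D.g D.k x) / (16 * Real.pi)

/-- The momentum density: `8 π J = div_g (k - (Tr_g k) g)`. -/
def momentumDensity (i : Fin n) (x : EuclideanSpace ℝ (Fin n)) : ℝ :=
  divergence D.g (fun y => D.k y - trace D.g D.k y • D.g y) i x / (8 * Real.pi)

/-- The dominant energy condition `μ ≥ |J|_g`. -/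
def DominantEnergyCondition : Prop :=
  ∀ x ∈ D.M, Real.sqrt (∑ i, ∑ j, (D.g x)⁻¹ i j * D.momentumDensity i x * D.momentumDensity j x)
    ≤ D.energyDensity x

/-- Asymptotic flatness, in the standard coordinates of `ℝⁿ`. -/
def IsAsymptoticallyFlat : Prop :=
  ∃ ρ₀ C : ℝ, 0 < ρ₀ ∧ D.r₀ ≤ ρ₀ ∧ ∀ x : EuclideanSpace ℝ (Fin n), ρ₀ < ‖x‖ →
    (∀ i j, |D.g x i j - (1 : Matrix (Fin n) (Fin n) ℝ) i j| ≤ C / ‖x‖ ^ (n - 2)) ∧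
    (∀ i j a, |pd a (fun y => D.g y i j) x| ≤ C / ‖x‖ ^ (n - 1)) ∧
    (∀ i j a b, |pd a (pd b (fun y => D.g y i j)) x| ≤ C / ‖x‖ ^ n) ∧
    (∀ i j, |D.k x i j| ≤ C / ‖x‖ ^ (n - 1)) ∧
    (∀ i j a, |pd a (fun y => D.k y i j) x| ≤ C / ‖x‖ ^ n) ∧
    |scalarCurvature D.g x| ≤ C / ‖x‖ ^ (n + 1) ∧
    |trace D.g D.k x| ≤ C / ‖x‖ ^ n

/-- Spherical symmetry: with `r = |x|`,
`g = g₁₁(r) dr² + ρ(r)² g_{S^{n-1}}` and `k_{ij} = nᵢ nⱼ kₙ(r) + (g_{ij} - nᵢ nⱼ) kₜ(r)`, where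
`n = g₁₁^{-1/2} ∂_r`.  In Cartesian coordinates `dr = xᵢ dxᵢ / r`, the round metric is
`g_{S^{n-1}} = r⁻² (δ_{ij} - xᵢ xⱼ / r²) dxᵢ dxⱼ`, and the covector of `n` is `√g₁₁ dr`. -/
def IsSphericallySymmetric : Prop :=
  ∃ g₁₁ ρ kₙ kₜ : ℝ → ℝ, ∀ x ∈ D.M, x ≠ 0 →
    0 < g₁₁ ‖x‖ ∧ 0 < ρ ‖x‖ ∧
    (∀ i j, D.g x i j = g₁₁ ‖x‖ * (x i * x j / ‖x‖ ^ 2)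
      + ρ ‖x‖ ^ 2 / ‖x‖ ^ 2 * ((1 : Matrix (Fin n) (Fin n) ℝ) i j - x i * x j / ‖x‖ ^ 2)) ∧
    (∀ i j, D.k x i j = (Real.sqrt (g₁₁ ‖x‖) * x i / ‖x‖) * (Real.sqrt (g₁₁ ‖x‖) * x j / ‖x‖)
        * kₙ ‖x‖
      + (D.g x i j - (Real.sqrt (g₁₁ ‖x‖) * x i / ‖x‖) * (Real.sqrt (g₁₁ ‖x‖) * x j / ‖x‖))
        * kₜ ‖x‖)

/-! #### ADM mass -/

/-- `(2 (n-1) ω_{n-1})⁻¹ ∫_{S_r} (g_{ij,i} - g_{ii,j}) νʲ`. -/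
def energyFlux (r : ℝ) : ℝ :=
  1 / (2 * ((n : ℝ) - 1) * sphereVolume n) *
    ∫ x in Metric.sphere (0 : EuclideanSpace ℝ (Fin n)) r,
      (∑ i, ∑ j, (pd i (fun y => D.g y i j) x - pd j (fun y => D.g y i i) x) * (x j / ‖x‖))
      ∂μHE[n - 1]

/-- `(2 (n-1) ω_{n-1})⁻¹ ∫_{S_r} (k_{ij} - (Tr_g k) g_{ij}) νʲ`. -/
def momentumFlux (i : Fin n) (r : ℝ) : ℝ :=
  1 / (2 * ((n : ℝ) - 1) * sphereVolume n) *
    ∫ x in Metric.sphere (0 : EuclideanSpace ℝ (Fin n)) r,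
      (∑ j, (D.k x i j - trace D.g D.k x * D.g x i j) * (x j / ‖x‖)) ∂μHE[n - 1]

/-- `m` is the ADM mass: the limits that define the ADM energy `E` and the ADM linear momentum `P`
exist, and `m = √(E² - |P|²)`. -/
def HasADMMass (m : ℝ) : Prop :=
  ∃ (E : ℝ) (P : Fin n → ℝ), Tendsto D.energyFlux atTop (𝓝 E) ∧
    (∀ i, Tendsto (D.momentumFlux i) atTop (𝓝 (P i))) ∧
    m = Real.sqrt (E ^ 2 - ∑ i, P i ^ 2)

/-! #### Apparent horizons -/

/-- The future null expansion `θ₊ = H + Tr_S k`. -/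
def thetaPlus (S : ClosedHypersurface n) (x : EuclideanSpace ℝ (Fin n)) : ℝ :=
  meanCurvature D.g S.u x + tangentialTrace D.g D.k S.u x

/-- The past null expansion `θ₋ = H - Tr_S k`. -/
def thetaMinus (S : ClosedHypersurface n) (x : EuclideanSpace ℝ (Fin n)) : ℝ :=
  meanCurvature D.g S.u x - tangentialTrace D.g D.k S.u x

/-- `S` is a (future or past) apparent horizon in `M`. -/
def IsApparentHorizon (S : ClosedHypersurface n) : Prop :=
  S.carrier ⊆ D.M ∧
    ((∀ x ∈ S.carrier, D.thetaPlus S x = 0) ∨ (∀ x ∈ S.carrier, D.thetaMinus S x = 0))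

/-- `S` is an apparent horizon that is not enclosed by any other apparent horizon. -/
def IsOutermostApparentHorizon (S : ClosedHypersurface n) : Prop :=
  D.IsApparentHorizon S ∧
    ∀ S' : ClosedHypersurface n, D.IsApparentHorizon S' → S.carrier ⊆ S'.enclosed →
      S'.carrier = S.carrier

/-- The area of `S` in `(M, g)`.  In terms of the Euclidean unit normal `e` and the Euclidean area
measure, the area element of `g` is `√(det g · g^{ab} eₐ e_b)`. -/
def area (S : ClosedHypersurface n) : ℝ :=
  ∫ x in S.carrier,
    Real.sqrt ((D.g x).det * ((∑ a, ∑ b, (D.g x)⁻¹ a b * pd a S.u x * pd b S.u x)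
      / ∑ a, pd a S.u x ^ 2)) ∂μHE[n - 1]

end InitialDataSet

/-! ### Embeddings into the Schwarzschild spacetime -/

/-- The spatial part `y` of a point `(t, y)` of `ℝ × ℝⁿ`; the time coordinate has index
`Sum.inl ()`. -/
def spatial {n : ℕ} (z : EuclideanSpace ℝ (Unit ⊕ Fin n)) : EuclideanSpace ℝ (Fin n) :=
  WithLp.toLp 2 (fun i => z (Sum.inr i))

/-- `1 - 2 m / r^{n-2}`. -/
def schwarzschildFactor (n : ℕ) (m r : ℝ) : ℝ := 1 - 2 * m / r ^ (n - 2)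

/-- The exterior region `{(t, y) | y ≠ 0, 1 - 2 m / |y|^{n-2} > 0}` of the Schwarzschild spacetime
of mass `m`. -/
def schwarzschildExterior (n : ℕ) (m : ℝ) : Set (EuclideanSpace ℝ (Unit ⊕ Fin n)) :=
  {z | 0 < ‖spatial z‖ ∧ 0 < schwarzschildFactor n m ‖spatial z‖}

/-- The `(n+1)`-dimensional Schwarzschild metric of mass `m`,
`-F dt² + F⁻¹ dr² + r² g_{S^{n-1}}` with `F = 1 - 2 m / r^{n-2}` and `r = |y|`, in the coordinates
`(t, y)`. -/
def schwarzschildMetric (n : ℕ) (m : ℝ) (z : EuclideanSpace ℝ (Unit ⊕ Fin n)) :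
    Matrix (Unit ⊕ Fin n) (Unit ⊕ Fin n) ℝ :=
  Matrix.fromBlocks
    (Matrix.of fun _ _ => -schwarzschildFactor n m ‖spatial z‖) 0 0
    (Matrix.of fun i j => (1 : Matrix (Fin n) (Fin n) ℝ) i j
      + ((schwarzschildFactor n m ‖spatial z‖)⁻¹ - 1)
        * (spatial z i * spatial z j / ‖spatial z‖ ^ 2))

/-- The components `dΦ(∂ᵢ)^A = ∂ᵢ Φ^A`. -/
def tangent {n : ℕ} (Φ : EuclideanSpace ℝ (Fin n) → EuclideanSpace ℝ (Unit ⊕ Fin n)) (i : Fin n)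
    (A : Unit ⊕ Fin n) (x : EuclideanSpace ℝ (Fin n)) : ℝ :=
  pd i (fun y => Φ y A) x

/-- The components of the ambient covariant derivative of `dΦ(∂ⱼ)` along `dΦ(∂ᵢ)`:
`∂ᵢ ∂ⱼ Φ^A + Γ^A_{BC} ∂ᵢ Φ^B ∂ⱼ Φ^C`, for the ambient metric `G`. -/
def accel {n : ℕ} (G : EuclideanSpace ℝ (Unit ⊕ Fin n) → Matrix (Unit ⊕ Fin n) (Unit ⊕ Fin n) ℝ)
    (Φ : EuclideanSpace ℝ (Fin n) → EuclideanSpace ℝ (Unit ⊕ Fin n)) (i j : Fin n)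
    (A : Unit ⊕ Fin n) (x : EuclideanSpace ℝ (Fin n)) : ℝ :=
  pd i (tangent Φ j A) x
    + ∑ B, ∑ C, christoffel G A B C (Φ x) * tangent Φ i B x * tangent Φ j C x

/-- The restriction of the initial data to the region `U` arises from an embedding `Φ` into (the
exterior region of) the Schwarzschild spacetime of mass `m`: the induced metric is `g`, and the
second fundamental form with respect to the future-directed unit normal `N` is `k`, with the
convention `k(X, Y) = G(∇_X N, Y) = -G(N, ∇_X Y)`. -/
def InitialDataSet.EmbedsInSchwarzschild {n : ℕ} (D : InitialDataSet n)
    (U : Set (EuclideanSpace ℝ (Fin n))) (m : ℝ) : Prop :=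
  ∃ Φ N : EuclideanSpace ℝ (Fin n) → EuclideanSpace ℝ (Unit ⊕ Fin n),
    IsEmbedding (U.domRestrict Φ) ∧
    ∀ x ∈ U,
      ContDiffAt ℝ ∞ Φ x ∧ ContDiffAt ℝ ∞ N x ∧
      Φ x ∈ schwarzschildExterior n m ∧
      (∀ i j, ∑ A, ∑ B, schwarzschildMetric n m (Φ x) A B * tangent Φ i A x * tangent Φ j B x
        = D.g x i j) ∧
      (∀ i, ∑ A, ∑ B, schwarzschildMetric n m (Φ x) A B * N x A * tangent Φ i B x = 0) ∧
      ∑ A, ∑ B, schwarzschildMetric n m (Φ x) A B * N x A * N x B = -1 ∧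
      0 < N x (Sum.inl ()) ∧
      (∀ i j, -∑ A, ∑ B, schwarzschildMetric n m (Φ x) A B * N x A
          * accel (schwarzschildMetric n m) Φ i j B x = D.k x i j)

end SpacetimePenrose

end

set_option linter.unusedSectionVars false
set_option linter.unusedSimpArgs false

noncomputable section
namespace SpacetimePenrose

/-! ### Partial derivatives -/

section PartialDerivatives

variable {ι : Type*} [Fintype ι] [DecidableEq ι]

/-! Put s = |x|², let A and K be the radial and b and c the tangential components of g and k, and
let Y = b + s b'. The coordinate sphere has area radius ρ = √(s b). The spacetime gradient of ρ has
squared norm F = (Y² - c² s A) / (A b) (`profileF`), and the two factors Y ± c √(s A) of the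
numerator are positive multiples of the null expansions θ± of the sphere. The proof follows the
Hawking mass ½ ρ^{n-2} (1 - F) of the spheres; `hawking` is twice this quantity.

Inequality. By the constraint equations, the s-derivative of `hawking` is a positive multiple of 8πμ
Y - s c j, where 8πJᵢ = j xᵢ (`hasDerivAt_hawking`). Where both θ± are positive one has |c| √(s A) <
Y, and the dominant energy condition reads |j| √(s/A) ≤ 8πμ. Multiplying the two bounds shows that
the derivative is nonnegative, and that it vanishes only if μ = 0 and J = 0 (`mass_density_nonneg`).
On the horizon F = 0, so `hawking` starts at ρ^{n-2}, which is the area term. At infinity it is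
asymptotic to twice the energy flux, so monotonicity makes the limit E exist. The momentum flux
vanishes by oddness, hence P = 0 and m = E.

The horizon. The outermost horizon is not assumed to be symmetric. At its point p farthest from the
origin the coordinate sphere touches it from outside, so the mean curvature of the sphere is at most
that of the horizon, while the tangential traces of k agree (`touching`, `theta_eq`). Thus one
expansion of that sphere is nonpositive. The expansions are positive near infinity, so a sphere of
radius at least |p| is an apparent horizon, and outermostness forces the two to coincide. No further
zero can occur outside, which gives θ± > 0 there (`outermost`).

Equality. If m equals the area term, `hawking` is constant. Then F is the Schwarzschild factor 1 -
2m/ρ^{n-2}, and j = 0. The map x ↦ (T(s), √b x), for a suitable primitive T, induces g; its second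
fundamental form has tangential part c by the choice of T and radial part K because j = 0
(`embedsInSchwarzschild`). Conversely, Schwarzschild is Ricci flat (`ricci_staticMetric`), so the
twice contracted Gauss equation gives μ = 0 for any embedded data (`hamiltonian_constraint`). Then J
= 0 by the energy condition and `hawking` is constant. The mass m' of the ambient spacetime plays no
role in this direction. -/

/-- `f` is differentiable at `x` with partial derivatives `v`. -/
def HasGrad (f : EuclideanSpace ℝ ι → ℝ) (v : ι → ℝ) (x : EuclideanSpace ℝ ι) : Prop :=
  DifferentiableAt ℝ f x ∧ ∀ i, pd i f x = v i

theorem _root_.DifferentiableAt.hasGrad {f : EuclideanSpace ℝ ι → ℝ} {x : EuclideanSpace ℝ ι}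
    (h : DifferentiableAt ℝ f x) : HasGrad f (fun i => pd i f x) x := ⟨h, fun _ => rfl⟩

theorem _root_.ContDiffAt.hasGrad {f : EuclideanSpace ℝ ι → ℝ} {x : EuclideanSpace ℝ ι}
    (h : ContDiffAt ℝ ∞ f x) : HasGrad f (fun i => pd i f x) x :=
  (h.differentiableAt (by simp)).hasGrad

namespace HasGrad

variable {f g : EuclideanSpace ℝ ι → ℝ} {u v : ι → ℝ} {x : EuclideanSpace ℝ ι}

theorem const (c : ℝ) : HasGrad (fun _ => c) (fun _ : ι => 0) x :=
  ⟨differentiableAt_const c, fun i => by simp [pd]⟩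

theorem add (hf : HasGrad f u x) (hg : HasGrad g v x) :
    HasGrad (fun y => f y + g y) (fun i => u i + v i) x :=
  ⟨hf.1.add hg.1, fun i => by
    dsimp only; rw [← hf.2, ← hg.2, pd, fderiv_fun_add hf.1 hg.1]; rfl⟩

theorem sub (hf : HasGrad f u x) (hg : HasGrad g v x) :
    HasGrad (fun y => f y - g y) (fun i => u i - v i) x :=
  ⟨hf.1.sub hg.1, fun i => by
    dsimp only; rw [← hf.2, ← hg.2, pd, fderiv_fun_sub hf.1 hg.1]; rfl⟩

theorem neg (hf : HasGrad f u x) : HasGrad (fun y => -f y) (fun i => -u i) x :=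
  ⟨hf.1.neg, fun i => by dsimp only; rw [← hf.2, pd, fderiv_fun_neg]; rfl⟩

theorem mul (hf : HasGrad f u x) (hg : HasGrad g v x) :
    HasGrad (fun y => f y * g y) (fun i => u i * g x + f x * v i) x :=
  ⟨hf.1.mul hg.1, fun i => by
    dsimp only; rw [← hf.2, ← hg.2, pd, fderiv_fun_mul hf.1 hg.1]
    simp [pd]; ring⟩

theorem const_mul (c : ℝ) (hf : HasGrad f u x) :
    HasGrad (fun y => c * f y) (fun i => c * u i) x := by
  have h := (const (x := x) c).mul hf
  exact ⟨h.1, fun i => by rw [h.2]; ring⟩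

theorem sum {κ : Type*} {s : Finset κ} {F : κ → EuclideanSpace ℝ ι → ℝ} {U : κ → ι → ℝ}
    (h : ∀ k ∈ s, HasGrad (F k) (U k) x) :
    HasGrad (fun y => ∑ k ∈ s, F k y) (fun i => ∑ k ∈ s, U k i) x :=
  ⟨DifferentiableAt.fun_sum fun k hk => (h k hk).1, fun i => by
    rw [pd, fderiv_fun_sum fun k hk => (h k hk).1]
    simp only [FunLike.coe_sum, Finset.sum_apply]
    exact Finset.sum_congr rfl fun k hk => (h k hk).2 i⟩

theorem congr_eventuallyEq (h : HasGrad f u x) (he : g =ᶠ[𝓝 x] f) : HasGrad g u x :=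
  ⟨h.1.congr_of_eventuallyEq he, fun i => by rw [← h.2, pd, pd, he.fderiv_eq]⟩

theorem congr_grad (h : HasGrad f u x) (he : ∀ i, u i = v i) : HasGrad f v x :=
  ⟨h.1, fun i => (h.2 i).trans (he i)⟩

theorem coord (b : ι) :
    HasGrad (fun y : EuclideanSpace ℝ ι => y b) (fun a => (1 : Matrix ι ι ℝ) a b) x := by
  have h : HasFDerivAt (fun y : EuclideanSpace ℝ ι => y b)
      (EuclideanSpace.proj b : EuclideanSpace ℝ ι →L[ℝ] ℝ) x :=
    (EuclideanSpace.proj b : EuclideanSpace ℝ ι →L[ℝ] ℝ).hasFDerivAt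
  refine ⟨h.differentiableAt, fun a => ?_⟩
  rw [pd, h.fderiv]
  simp [Matrix.one_apply, PiLp.single_apply, eq_comm]

theorem comp_hasDerivAt {φ : ℝ → ℝ} {φ' : ℝ} (hφ : HasDerivAt φ φ' (f x)) (hf : HasGrad f u x) :
    HasGrad (fun y => φ (f y)) (fun i => φ' * u i) x := by
  have h := hφ.comp_hasFDerivAt x hf.1.hasFDerivAt
  refine ⟨h.differentiableAt, fun i => ?_⟩
  dsimp only
  rw [← hf.2, pd]
  have := h.fderiv
  simp only [Function.comp_def] at this
  rw [this]; simp [pd]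

theorem normSq : HasGrad (fun y : EuclideanSpace ℝ ι => ‖y‖ ^ 2) (fun a => 2 * x a) x := by
  have h : HasGrad (fun y : EuclideanSpace ℝ ι => ∑ b, y b * y b)
      (fun a => ∑ b, ((1 : Matrix ι ι ℝ) a b * x b + x b * (1 : Matrix ι ι ℝ) a b)) x :=
    HasGrad.sum fun b _ => (coord b).mul (coord b)
  have h2 : (fun y : EuclideanSpace ℝ ι => ‖y‖ ^ 2) = fun y => ∑ b, y b * y b := by
    funext y
    rw [EuclideanSpace.norm_sq_eq]
    exact Finset.sum_congr rfl fun b _ => by rw [Real.norm_eq_abs, sq_abs, sq]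
  rw [h2]
  refine h.congr_grad fun a => ?_
  simp [Matrix.one_apply, Finset.sum_add_distrib, two_mul]

theorem radial {φ : ℝ → ℝ} {φ' : ℝ} (hφ : HasDerivAt φ φ' (‖x‖ ^ 2)) :
    HasGrad (fun y : EuclideanSpace ℝ ι => φ (‖y‖ ^ 2)) (fun a => 2 * φ' * x a) x :=
  (comp_hasDerivAt (f := fun y : EuclideanSpace ℝ ι => ‖y‖ ^ 2) hφ normSq).congr_grad
    fun i => by ring

end HasGrad

theorem sum_mul_self (x : EuclideanSpace ℝ ι) : ∑ a, x a * x a = ‖x‖ ^ 2 := by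
  rw [EuclideanSpace.norm_sq_eq]
  exact Finset.sum_congr rfl fun b _ => by rw [Real.norm_eq_abs, sq_abs, sq]

theorem pd_congr {f g : EuclideanSpace ℝ ι → ℝ} {x : EuclideanSpace ℝ ι} (h : f =ᶠ[𝓝 x] g)
    (i : ι) : pd i f x = pd i g x := by rw [pd, pd, h.fderiv_eq]

theorem fderiv_apply_eq_sum (f : EuclideanSpace ℝ ι → ℝ) (x v : EuclideanSpace ℝ ι) :
    fderiv ℝ f x v = ∑ i, pd i f x * v i := by
  have hv : v = ∑ i, v i • EuclideanSpace.single i (1 : ℝ) := by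
    ext j
    simp [Pi.single_apply]
  conv_lhs => rw [hv]
  rw [map_sum]
  exact Finset.sum_congr rfl fun i _ => by rw [map_smul, smul_eq_mul, pd]; ring

theorem _root_.ContDiffAt.pd {f : EuclideanSpace ℝ ι → ℝ} {x : EuclideanSpace ℝ ι}
    (h : ContDiffAt ℝ ∞ f x) (i : ι) : ContDiffAt ℝ ∞ (pd i f) x := by
  have h1 : ContDiffAt ℝ ∞ (fderiv ℝ f) x := h.fderiv_right (m := ∞) (by simp)
  exact h1.clm_apply contDiffAt_const

theorem pd_comm {f : EuclideanSpace ℝ ι → ℝ} {x : EuclideanSpace ℝ ι}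
    (h : ContDiffAt ℝ ∞ f x) (i j : ι) : pd i (pd j f) x = pd j (pd i f) x := by
  have hs : IsSymmSndFDerivAt ℝ f x := h.isSymmSndFDerivAt (by
    simp only [minSmoothness_of_isRCLikeNormedField]
    exact WithTop.coe_le_coe.2 (le_top : (2 : ℕ∞) ≤ ⊤))
  have h1 : DifferentiableAt ℝ (fderiv ℝ f) x :=
    (h.fderiv_right (m := ∞) (by simp)).differentiableAt (by simp)
  have key : ∀ i j : ι, pd i (pd j f) x
      = fderiv ℝ (fderiv ℝ f) x (EuclideanSpace.single i 1) (EuclideanSpace.single j 1) := by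
    intro i j
    rw [pd]
    have := fderiv_clm_apply h1 (differentiableAt_const (EuclideanSpace.single j (1 : ℝ)))
    unfold pd
    rw [this]
    simp
  rw [key, key, hs]

theorem _root_.ContDiffAt.eventually_top {E F : Type*} [NormedAddCommGroup E] [NormedSpace ℝ E]
    [NormedAddCommGroup F] [NormedSpace ℝ F] {f : E → F} {x : E}
    (h : ContDiffAt ℝ ∞ f x) (n : ℕ) : ∀ᶠ y in 𝓝 x, ContDiffAt ℝ n f y :=
  (h.of_le (by exact_mod_cast le_top)).eventually (by simp)

theorem pd_comp {κ : Type*} [Fintype κ] [DecidableEq κ] {h : EuclideanSpace ℝ κ → ℝ}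
    {Φ : EuclideanSpace ℝ ι → EuclideanSpace ℝ κ} {x : EuclideanSpace ℝ ι}
    (hh : DifferentiableAt ℝ h (Φ x)) (hΦ : DifferentiableAt ℝ Φ x) :
    HasGrad (fun y => h (Φ y)) (fun i => ∑ D, pd D h (Φ x) * pd i (fun y => Φ y D) x) x := by
  refine ⟨hh.comp x hΦ, fun i => ?_⟩
  have hc := (hh.hasFDerivAt.comp x hΦ.hasFDerivAt).fderiv
  simp only [Function.comp_def] at hc
  rw [pd, hc]
  simp only [ContinuousLinearMap.comp_apply]
  rw [fderiv_apply_eq_sum]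
  refine Finset.sum_congr rfl fun D _ => ?_
  congr 1
  have h2 := ((EuclideanSpace.proj D : EuclideanSpace ℝ κ →L[ℝ] ℝ).hasFDerivAt.comp x
    hΦ.hasFDerivAt).fderiv
  have h3 : (fun y => Φ y D) = (EuclideanSpace.proj D : EuclideanSpace ℝ κ →L[ℝ] ℝ) ∘ Φ := rfl
  rw [pd, h3, h2]; rfl

end PartialDerivatives

end SpacetimePenrose
end

noncomputable section
namespace SpacetimePenrose

/-! ### Radial metrics -/

section Radial

variable {ι : Type*} [Fintype ι] [DecidableEq ι]

/-- The components `p δ_{ij} + q xᵢ xⱼ` of a rotationally symmetric 2-tensor at `x`. -/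
def radialTensor (p q : ℝ) (x : EuclideanSpace ℝ ι) : Matrix ι ι ℝ :=
  Matrix.of fun i j => p * (1 : Matrix ι ι ℝ) i j + q * (x i * x j)

theorem radialTensor_apply (p q : ℝ) (x : EuclideanSpace ℝ ι) (i j : ι) :
    radialTensor p q x i j = p * (1 : Matrix ι ι ℝ) i j + q * (x i * x j) := rfl

theorem sum_one_mul (a : ι) (f : ι → ℝ) : ∑ c, (1 : Matrix ι ι ℝ) a c * f c = f a := by
  simp [Matrix.one_apply]

theorem sum_one_mul' (a : ι) (f : ι → ℝ) : ∑ c, (1 : Matrix ι ι ℝ) c a * f c = f a := by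
  simp [Matrix.one_apply]

theorem sum_one_apply_self : ∑ c : ι, (1 : Matrix ι ι ℝ) c c = Fintype.card ι := by
  simp [Matrix.one_apply]

theorem one_comm_apply (a b : ι) : (1 : Matrix ι ι ℝ) a b = (1 : Matrix ι ι ℝ) b a := by
  simp [Matrix.one_apply, eq_comm]

theorem sum_radialTensor_mul (p q : ℝ) (x : EuclideanSpace ℝ ι) (a : ι) (f : ι → ℝ) :
    ∑ c, radialTensor p q x a c * f c = p * f a + q * x a * ∑ c, x c * f c := by
  simp only [radialTensor_apply, add_mul, Finset.sum_add_distrib, mul_assoc, ← Finset.mul_sum,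
    sum_one_mul]

theorem sum_radialTensor_mul_self (p q : ℝ) (x : EuclideanSpace ℝ ι) (a : ι) :
    ∑ c, radialTensor p q x a c * x c = (p + ‖x‖ ^ 2 * q) * x a := by
  rw [sum_radialTensor_mul, sum_mul_self]; ring

theorem radialTensor_mul (p q p' q' : ℝ) (x : EuclideanSpace ℝ ι) :
    radialTensor p q x * radialTensor p' q' x
      = radialTensor (p * p') (p * q' + q * p' + ‖x‖ ^ 2 * (q * q')) x := by
  ext a b
  rw [Matrix.mul_apply, sum_radialTensor_mul]
  have : ∑ c, x c * radialTensor p' q' x c b = (p' + ‖x‖ ^ 2 * q') * x b := by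
    rw [← sum_radialTensor_mul_self]
    exact Finset.sum_congr rfl fun c _ => by
      rw [radialTensor_apply, radialTensor_apply, one_comm_apply b c]; ring
  rw [this, radialTensor_apply, radialTensor_apply]; ring

/-- The eigenvalues are p on the orthogonal complement of x and p + |x|² q along x; inverting each
of them gives the two coefficients. -/
theorem radialTensor_inv {p q : ℝ} {x : EuclideanSpace ℝ ι} (hp : p ≠ 0)
    (hA : p + ‖x‖ ^ 2 * q ≠ 0) :
    (radialTensor p q x)⁻¹ = radialTensor p⁻¹ (-(q / (p * (p + ‖x‖ ^ 2 * q)))) x := by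
  apply Matrix.inv_eq_right_inv
  rw [radialTensor_mul]
  have h1 : p * p⁻¹ = 1 := mul_inv_cancel₀ hp
  have h2 : p * -(q / (p * (p + ‖x‖ ^ 2 * q))) + q * p⁻¹
      + ‖x‖ ^ 2 * (q * -(q / (p * (p + ‖x‖ ^ 2 * q)))) = 0 := by
    generalize hAe : p + ‖x‖ ^ 2 * q = A at hA ⊢
    field_simp
    rw [← hAe]; ring
  rw [h1, h2]
  ext i j
  simp [radialTensor_apply]

/-- The full contraction of two radial tensors. -/
theorem sum_radialTensor_mul_radialTensor (p q p' q' : ℝ) (x : EuclideanSpace ℝ ι) :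
    ∑ a, ∑ b, radialTensor p q x a b * radialTensor p' q' x a b
      = Fintype.card ι * (p * p') + ‖x‖ ^ 2 * (p * q' + q * p' + ‖x‖ ^ 2 * (q * q')) := by
  have h : ∀ a, ∑ b, radialTensor p q x a b * radialTensor p' q' x a b
      = (radialTensor p q x * radialTensor p' q' x) a a := by
    intro a
    rw [Matrix.mul_apply]
    exact Finset.sum_congr rfl fun b _ => by
      rw [radialTensor_apply p' q' x a b, radialTensor_apply p' q' x b a, one_comm_apply b a]; ring
  simp only [h, radialTensor_mul]
  simp only [radialTensor_apply, Finset.sum_add_distrib, ← Finset.mul_sum,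
    sum_one_apply_self, sum_mul_self]
  ring

theorem hasGrad_radialTensor {β γ : ℝ → ℝ} {β' γ' : ℝ} {x : EuclideanSpace ℝ ι}
    (hβ : HasDerivAt β β' (‖x‖ ^ 2)) (hγ : HasDerivAt γ γ' (‖x‖ ^ 2)) (i j : ι) :
    HasGrad (fun y => radialTensor (β (‖y‖ ^ 2)) (γ (‖y‖ ^ 2)) y i j)
      (fun a => 2 * β' * x a * (1 : Matrix ι ι ℝ) i j
        + γ (‖x‖ ^ 2) * ((1 : Matrix ι ι ℝ) a i * x j + (1 : Matrix ι ι ℝ) a j * x i)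
        + 2 * γ' * (x a * x i * x j)) x := by
  refine (((HasGrad.radial hβ).mul (HasGrad.const _)).add ((HasGrad.radial hγ).mul
    ((HasGrad.coord i).mul (HasGrad.coord j)))).congr_grad fun a => ?_
  ring

/-- The components of a rotationally symmetric Christoffel symbol. -/
def radialChristoffel (α η ζ : ℝ) (x : EuclideanSpace ℝ ι) (c a b : ι) : ℝ :=
  α * (x c * (1 : Matrix ι ι ℝ) a b)
    + η * (x a * (1 : Matrix ι ι ℝ) c b + x b * (1 : Matrix ι ι ℝ) c a) + ζ * (x a * x b * x c)

/-- Only the value and the first partial derivatives of g at the single point x enter. This makes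
the formula available at boundary points of M, where g need not be radial in a full neighbourhood.
-/
theorem christoffel_radial {g : EuclideanSpace ℝ ι → Matrix ι ι ℝ} {x : EuclideanSpace ℝ ι}
    {β γ β' γ' : ℝ} (hg : g x = radialTensor β γ x)
    (hpd : ∀ a i j, pd a (fun y => g y i j) x = 2 * β' * x a * (1 : Matrix ι ι ℝ) i j
        + γ * ((1 : Matrix ι ι ℝ) a i * x j + (1 : Matrix ι ι ℝ) a j * x i)
        + 2 * γ' * (x a * x i * x j))
    (hβ : β ≠ 0) (hA : β + ‖x‖ ^ 2 * γ ≠ 0) (c a b : ι) :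
    christoffel g c a b x = radialChristoffel ((γ - β') / (β + ‖x‖ ^ 2 * γ)) (β' / β)
      (γ' / (β + ‖x‖ ^ 2 * γ) - 2 * β' * γ / (β * (β + ‖x‖ ^ 2 * γ))) x c a b := by
  rw [christoffel, hg, radialTensor_inv hβ hA, sum_radialTensor_mul]
  simp only [hpd]
  have hsum : ∑ d, x d * (2 * β' * x a * (1 : Matrix ι ι ℝ) b d
        + γ * ((1 : Matrix ι ι ℝ) a b * x d + (1 : Matrix ι ι ℝ) a d * x b)
        + 2 * γ' * (x a * x b * x d)
        + (2 * β' * x b * (1 : Matrix ι ι ℝ) a d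
          + γ * ((1 : Matrix ι ι ℝ) b a * x d + (1 : Matrix ι ι ℝ) b d * x a)
          + 2 * γ' * (x b * x a * x d))
        - (2 * β' * x d * (1 : Matrix ι ι ℝ) a b
          + γ * ((1 : Matrix ι ι ℝ) d a * x b + (1 : Matrix ι ι ℝ) d b * x a)
          + 2 * γ' * (x d * x a * x b)))
      = 4 * β' * x a * x b + ‖x‖ ^ 2 * (2 * (γ - β') * (1 : Matrix ι ι ℝ) a b
        + 2 * γ' * (x a * x b)) := by
    have h : ∀ d, x d * (2 * β' * x a * (1 : Matrix ι ι ℝ) b d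
        + γ * ((1 : Matrix ι ι ℝ) a b * x d + (1 : Matrix ι ι ℝ) a d * x b)
        + 2 * γ' * (x a * x b * x d)
        + (2 * β' * x b * (1 : Matrix ι ι ℝ) a d
          + γ * ((1 : Matrix ι ι ℝ) b a * x d + (1 : Matrix ι ι ℝ) b d * x a)
          + 2 * γ' * (x b * x a * x d))
        - (2 * β' * x d * (1 : Matrix ι ι ℝ) a b
          + γ * ((1 : Matrix ι ι ℝ) d a * x b + (1 : Matrix ι ι ℝ) d b * x a)
          + 2 * γ' * (x d * x a * x b)))
        = (2 * β' * x a) * ((1 : Matrix ι ι ℝ) b d * x d)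
          + (2 * β' * x b) * ((1 : Matrix ι ι ℝ) a d * x d)
          + (2 * (γ - β') * (1 : Matrix ι ι ℝ) a b + 2 * γ' * (x a * x b)) * (x d * x d) := by
      intro d
      rw [one_comm_apply d a, one_comm_apply d b, one_comm_apply b a]; ring
    simp only [h, Finset.sum_add_distrib, ← Finset.mul_sum, sum_one_mul, sum_mul_self]
    ring
  rw [hsum, radialChristoffel, one_comm_apply c a, one_comm_apply c b, one_comm_apply b a]
  generalize hAe : β + ‖x‖ ^ 2 * γ = A at hA ⊢
  field_simp
  rw [← hAe]
  ring

theorem hasGrad_radialChristoffel {α η ζ : ℝ → ℝ} {α' η' ζ' : ℝ} {x : EuclideanSpace ℝ ι}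
    (hα : HasDerivAt α α' (‖x‖ ^ 2)) (hη : HasDerivAt η η' (‖x‖ ^ 2))
    (hζ : HasDerivAt ζ ζ' (‖x‖ ^ 2)) (c a b : ι) :
    HasGrad (fun y => radialChristoffel (α (‖y‖ ^ 2)) (η (‖y‖ ^ 2)) (ζ (‖y‖ ^ 2)) y c a b)
      (fun d => 2 * x d * radialChristoffel α' η' ζ' x c a b
        + α (‖x‖ ^ 2) * ((1 : Matrix ι ι ℝ) d c * (1 : Matrix ι ι ℝ) a b)
        + η (‖x‖ ^ 2) * ((1 : Matrix ι ι ℝ) d a * (1 : Matrix ι ι ℝ) c b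
          + (1 : Matrix ι ι ℝ) d b * (1 : Matrix ι ι ℝ) c a)
        + ζ (‖x‖ ^ 2) * ((1 : Matrix ι ι ℝ) d a * x b * x c + x a * (1 : Matrix ι ι ℝ) d b * x c
          + x a * x b * (1 : Matrix ι ι ℝ) d c)) x := by
  have C := fun b : ι => HasGrad.coord (x := x) b
  refine ((((HasGrad.radial hα).mul ((C c).mul (HasGrad.const _))).add
    ((HasGrad.radial hη).mul (((C a).mul (HasGrad.const _)).add
      ((C b).mul (HasGrad.const _))))).add
    ((HasGrad.radial hζ).mul (((C a).mul (C b)).mul (C c)))).congr_grad fun d => ?_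
  rw [radialChristoffel]
  ring

theorem sum_radialChristoffel_contract (α η ζ : ℝ) (x : EuclideanSpace ℝ ι) (a : ι) :
    ∑ c, radialChristoffel α η ζ x c a c
      = (α + (Fintype.card ι + 1) * η + ‖x‖ ^ 2 * ζ) * x a := by
  have h : ∀ c, radialChristoffel α η ζ x c a c = (α + η) * ((1 : Matrix ι ι ℝ) a c * x c)
      + (η * x a) * (1 : Matrix ι ι ℝ) c c + (ζ * x a) * (x c * x c) := by
    intro c
    rw [radialChristoffel, one_comm_apply c a]; ring
  simp only [h, Finset.sum_add_distrib, ← Finset.mul_sum, sum_one_mul, sum_one_apply_self,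
    sum_mul_self]
  ring

theorem radialChristoffel_symm (α η ζ : ℝ) (x : EuclideanSpace ℝ ι) (c a b : ι) :
    radialChristoffel α η ζ x c a b = radialChristoffel α η ζ x c b a := by
  rw [radialChristoffel, radialChristoffel, one_comm_apply a b]; ring

theorem sum_mul_radialChristoffel (α η ζ : ℝ) (x : EuclideanSpace ℝ ι) (a b : ι) :
    ∑ c, x c * radialChristoffel α η ζ x c a b
      = radialTensor (‖x‖ ^ 2 * α) (2 * η + ‖x‖ ^ 2 * ζ) x a b := by
  have h : ∀ c, x c * radialChristoffel α η ζ x c a b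
      = (α * (1 : Matrix ι ι ℝ) a b + ζ * (x a * x b)) * (x c * x c)
        + (η * x a) * ((1 : Matrix ι ι ℝ) b c * x c)
        + (η * x b) * ((1 : Matrix ι ι ℝ) a c * x c) := by
    intro c
    rw [radialChristoffel, one_comm_apply c a, one_comm_apply c b]; ring
  simp only [h, Finset.sum_add_distrib, ← Finset.mul_sum, sum_one_mul, sum_mul_self]
  rw [radialTensor_apply]; ring

theorem sum_radialChristoffel_mul (α η ζ : ℝ) (x : EuclideanSpace ℝ ι) (a b : ι) :
    ∑ c, ∑ d, radialChristoffel α η ζ x c b d * radialChristoffel α η ζ x d a c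
      = radialTensor (2 * ‖x‖ ^ 2 * α * η)
        (α ^ 2 + 2 * α * η + 2 * ‖x‖ ^ 2 * α * ζ + (Fintype.card ι + 3) * η ^ 2
            + 4 * ‖x‖ ^ 2 * η * ζ + ‖x‖ ^ 4 * ζ ^ 2) x a b := by
  have hd : ∀ c, ∑ d, radialChristoffel α η ζ x c b d * radialChristoffel α η ζ x d a c
      = ((α ^ 2 + α * η + η ^ 2) * x b) * ((1 : Matrix ι ι ℝ) a c * x c)
        + η ^ 2 * x a * x b * (1 : Matrix ι ι ℝ) c c
        + ‖x‖ ^ 2 * α * η * ((1 : Matrix ι ι ℝ) a c * (1 : Matrix ι ι ℝ) b c)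
        + (α * η + ‖x‖ ^ 2 * η * ζ + 2 * η ^ 2) * x a * ((1 : Matrix ι ι ℝ) b c * x c)
        + ‖x‖ ^ 2 * α * ζ * x b * ((1 : Matrix ι ι ℝ) a c * x c)
        + (α * ζ * x a * x b + α * η * (1 : Matrix ι ι ℝ) a b
          + 3 * η * ζ * x a * x b + ‖x‖ ^ 2 * ζ ^ 2 * x a * x b) * (x c * x c) := by
    intro c
    have hcd : ∀ d, radialChristoffel α η ζ x c b d * radialChristoffel α η ζ x d a c
        = (α * x c * (α * (1 : Matrix ι ι ℝ) a c + ζ * (x a * x c)))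
            * ((1 : Matrix ι ι ℝ) b d * x d)
          + (α * x c * (η * x a)) * ((1 : Matrix ι ι ℝ) b d * (1 : Matrix ι ι ℝ) d c)
          + (α * x c * (η * x c)) * ((1 : Matrix ι ι ℝ) b d * (1 : Matrix ι ι ℝ) d a)
          + (η * x b * (α * (1 : Matrix ι ι ℝ) a c + ζ * (x a * x c)))
            * ((1 : Matrix ι ι ℝ) c d * x d)
          + (η * x b * (η * x a)) * ((1 : Matrix ι ι ℝ) c d * (1 : Matrix ι ι ℝ) d c)
          + (η * x b * (η * x c)) * ((1 : Matrix ι ι ℝ) c d * (1 : Matrix ι ι ℝ) d a)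
          + ((η * (1 : Matrix ι ι ℝ) b c + ζ * (x b * x c))
            * (α * (1 : Matrix ι ι ℝ) a c + ζ * (x a * x c))) * (x d * x d)
          + ((η * (1 : Matrix ι ι ℝ) b c + ζ * (x b * x c)) * (η * x a))
            * ((1 : Matrix ι ι ℝ) c d * x d)
          + ((η * (1 : Matrix ι ι ℝ) b c + ζ * (x b * x c)) * (η * x c))
            * ((1 : Matrix ι ι ℝ) a d * x d) := by
      intro d
      rw [radialChristoffel, radialChristoffel, one_comm_apply c b, one_comm_apply d c,
        one_comm_apply d a]; ring
    simp only [hcd, Finset.sum_add_distrib, ← Finset.mul_sum, sum_one_mul, sum_mul_self]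
    rw [one_comm_apply b a, one_comm_apply c a]
    ring
  simp only [hd, Finset.sum_add_distrib, ← Finset.mul_sum, sum_one_mul, sum_one_apply_self,
    sum_mul_self]
  rw [radialTensor_apply, one_comm_apply b a]; ring

/-- The Ricci expression `∂_c Γᶜ_{ab} - ∂_b Γᶜ_{ac} + Γᶜ_{cd} Γᵈ_{ab} - Γᶜ_{bd} Γᵈ_{ac}` of a
rotationally symmetric Christoffel symbol. -/
theorem sum_radialChristoffel (α η ζ α' η' ζ' : ℝ) (x : EuclideanSpace ℝ ι) (a b : ι) :
    ∑ c, ((2 * x c * radialChristoffel α' η' ζ' x c a b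
          + α * ((1 : Matrix ι ι ℝ) c c * (1 : Matrix ι ι ℝ) a b)
          + η * ((1 : Matrix ι ι ℝ) c a * (1 : Matrix ι ι ℝ) c b
            + (1 : Matrix ι ι ℝ) c b * (1 : Matrix ι ι ℝ) c a)
          + ζ * ((1 : Matrix ι ι ℝ) c a * x b * x c + x a * (1 : Matrix ι ι ℝ) c b * x c
            + x a * x b * (1 : Matrix ι ι ℝ) c c))
        - (2 * x b * radialChristoffel α' η' ζ' x c a c
          + α * ((1 : Matrix ι ι ℝ) b c * (1 : Matrix ι ι ℝ) a c)
          + η * ((1 : Matrix ι ι ℝ) b a * (1 : Matrix ι ι ℝ) c c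
            + (1 : Matrix ι ι ℝ) b c * (1 : Matrix ι ι ℝ) c a)
          + ζ * ((1 : Matrix ι ι ℝ) b a * x c * x c + x a * (1 : Matrix ι ι ℝ) b c * x c
            + x a * x c * (1 : Matrix ι ι ℝ) b c))
        + ∑ d, (radialChristoffel α η ζ x c c d * radialChristoffel α η ζ x d a b
          - radialChristoffel α η ζ x c b d * radialChristoffel α η ζ x d a c))
      = radialTensor
        (Fintype.card ι * α + 2 * ‖x‖ ^ 2 * α' + 2 * η
          - (α + (Fintype.card ι + 1) * η + ‖x‖ ^ 2 * ζ)
          + ‖x‖ ^ 2 * α * (α + (Fintype.card ι + 1) * η + ‖x‖ ^ 2 * ζ) - 2 * ‖x‖ ^ 2 * α * η)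
        (4 * η' + 2 * ‖x‖ ^ 2 * ζ' + (Fintype.card ι + 2) * ζ
          - 2 * (α' + (Fintype.card ι + 1) * η' + ζ + ‖x‖ ^ 2 * ζ')
          + (α + (Fintype.card ι + 1) * η + ‖x‖ ^ 2 * ζ) * (2 * η + ‖x‖ ^ 2 * ζ)
          - (α ^ 2 + 2 * α * η + 2 * ‖x‖ ^ 2 * α * ζ + (Fintype.card ι + 3) * η ^ 2
            + 4 * ‖x‖ ^ 2 * η * ζ + ‖x‖ ^ 4 * ζ ^ 2)) x a b := by
  have h : ∀ c, ((2 * x c * radialChristoffel α' η' ζ' x c a b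
          + α * ((1 : Matrix ι ι ℝ) c c * (1 : Matrix ι ι ℝ) a b)
          + η * ((1 : Matrix ι ι ℝ) c a * (1 : Matrix ι ι ℝ) c b
            + (1 : Matrix ι ι ℝ) c b * (1 : Matrix ι ι ℝ) c a)
          + ζ * ((1 : Matrix ι ι ℝ) c a * x b * x c + x a * (1 : Matrix ι ι ℝ) c b * x c
            + x a * x b * (1 : Matrix ι ι ℝ) c c))
        - (2 * x b * radialChristoffel α' η' ζ' x c a c
          + α * ((1 : Matrix ι ι ℝ) b c * (1 : Matrix ι ι ℝ) a c)
          + η * ((1 : Matrix ι ι ℝ) b a * (1 : Matrix ι ι ℝ) c c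
            + (1 : Matrix ι ι ℝ) b c * (1 : Matrix ι ι ℝ) c a)
          + ζ * ((1 : Matrix ι ι ℝ) b a * x c * x c + x a * (1 : Matrix ι ι ℝ) b c * x c
            + x a * x c * (1 : Matrix ι ι ℝ) b c)))
      = 2 * (x c * radialChristoffel α' η' ζ' x c a b)
        + (α * (1 : Matrix ι ι ℝ) a b + ζ * (x a * x b) - η * (1 : Matrix ι ι ℝ) a b)
          * (1 : Matrix ι ι ℝ) c c
        + (η - α) * ((1 : Matrix ι ι ℝ) a c * (1 : Matrix ι ι ℝ) b c)
        + ζ * x b * ((1 : Matrix ι ι ℝ) a c * x c) - ζ * x a * ((1 : Matrix ι ι ℝ) b c * x c)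
        - 2 * x b * radialChristoffel α' η' ζ' x c a c
        - ζ * (1 : Matrix ι ι ℝ) a b * (x c * x c) := by
    intro c
    rw [one_comm_apply c a, one_comm_apply c b, one_comm_apply b a]; ring
  have h2 : ∑ c, ∑ d, radialChristoffel α η ζ x c c d * radialChristoffel α η ζ x d a b
      = (α + (Fintype.card ι + 1) * η + ‖x‖ ^ 2 * ζ)
        * radialTensor (‖x‖ ^ 2 * α) (2 * η + ‖x‖ ^ 2 * ζ) x a b := by
    rw [Finset.sum_comm]
    simp only [← Finset.sum_mul]
    rw [← sum_mul_radialChristoffel, Finset.mul_sum]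
    refine Finset.sum_congr rfl fun d _ => ?_
    have h3 : ∑ c, radialChristoffel α η ζ x c c d
        = (α + (Fintype.card ι + 1) * η + ‖x‖ ^ 2 * ζ) * x d := by
      rw [← sum_radialChristoffel_contract]
      exact Finset.sum_congr rfl fun c _ => radialChristoffel_symm _ _ _ _ _ _ _
    rw [h3]; ring
  rw [Finset.sum_add_distrib]
  simp only [h, Finset.sum_sub_distrib, Finset.sum_add_distrib, ← Finset.mul_sum, h2,
    sum_radialChristoffel_mul, sum_radialChristoffel_contract, sum_mul_radialChristoffel,
    sum_one_mul, sum_one_apply_self, sum_mul_self]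
  simp only [radialTensor_apply, one_comm_apply b a]
  ring

end Radial

end SpacetimePenrose
end

noncomputable section
namespace SpacetimePenrose

/-! ### Curvature, traces and divergences of rotationally symmetric tensors -/

section RadialCurvature

variable {ι : Type*} [Fintype ι] [DecidableEq ι]

theorem eventually_normSq {x : EuclideanSpace ℝ ι} {P : ℝ → Prop} (h : ∀ᶠ s in 𝓝 (‖x‖ ^ 2), P s) :
    ∀ᶠ y in 𝓝 x, P (‖y‖ ^ 2) :=
  (continuous_norm.pow 2).continuousAt.eventually h

theorem _root_.ContDiffAt.deriv_infty {f : ℝ → ℝ} {s : ℝ} (h : ContDiffAt ℝ ∞ f s) :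
    ContDiffAt ℝ ∞ (deriv f) s :=
  ((h.fderiv_right (m := ∞) (by simp)).clm_apply contDiffAt_const :
    ContDiffAt ℝ ∞ (fun t => fderiv ℝ f t 1) s)

theorem _root_.ContDiffAt.hasDerivAt_infty {f : ℝ → ℝ} {s : ℝ} (h : ContDiffAt ℝ ∞ f s) :
    HasDerivAt f (deriv f s) s := (h.differentiableAt (by simp)).hasDerivAt

/-- The metric `g` coincides near `x` with `β δ + γ x xᵀ`, where `β` and `γ` are smooth functions of
`|x|²`. -/
structure IsRadialNear (g : EuclideanSpace ℝ ι → Matrix ι ι ℝ) (β γ : ℝ → ℝ)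
    (x : EuclideanSpace ℝ ι) : Prop where
  eventually_eq : ∀ᶠ y in 𝓝 x, g y = radialTensor (β (‖y‖ ^ 2)) (γ (‖y‖ ^ 2)) y
  smooth_fst : ContDiffAt ℝ ∞ β (‖x‖ ^ 2)
  smooth_snd : ContDiffAt ℝ ∞ γ (‖x‖ ^ 2)

namespace IsRadialNear

variable {g k : EuclideanSpace ℝ ι → Matrix ι ι ℝ} {β γ κ τ : ℝ → ℝ} {x : EuclideanSpace ℝ ι}

theorem eq (h : IsRadialNear g β γ x) :
    g x = radialTensor (β (‖x‖ ^ 2)) (γ (‖x‖ ^ 2)) x := h.eventually_eq.self_of_nhds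

theorem eventually (h : IsRadialNear g β γ x) (N : ℕ) : ∀ᶠ y in 𝓝 x,
    (∀ᶠ z in 𝓝 y, g z = radialTensor (β (‖z‖ ^ 2)) (γ (‖z‖ ^ 2)) z) ∧
      ContDiffAt ℝ N β (‖y‖ ^ 2) ∧ ContDiffAt ℝ N γ (‖y‖ ^ 2) := by
  filter_upwards [h.eventually_eq.eventually_nhds,
    eventually_normSq (h.smooth_fst.eventually_top N),
    eventually_normSq (h.smooth_snd.eventually_top N)] with y h1 h2 h3 using ⟨h1, h2, h3⟩

theorem hasGrad_of_differentiable
    (hg : ∀ᶠ z in 𝓝 x, g z = radialTensor (β (‖z‖ ^ 2)) (γ (‖z‖ ^ 2)) z)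
    (hβ : DifferentiableAt ℝ β (‖x‖ ^ 2)) (hγ : DifferentiableAt ℝ γ (‖x‖ ^ 2)) (i j : ι) :
    HasGrad (fun y => g y i j)
      (fun a => 2 * deriv β (‖x‖ ^ 2) * x a * (1 : Matrix ι ι ℝ) i j
        + γ (‖x‖ ^ 2) * ((1 : Matrix ι ι ℝ) a i * x j + (1 : Matrix ι ι ℝ) a j * x i)
        + 2 * deriv γ (‖x‖ ^ 2) * (x a * x i * x j)) x :=
  (hasGrad_radialTensor hβ.hasDerivAt hγ.hasDerivAt i j).congr_eventuallyEq
    (hg.mono fun y hy => by dsimp only; rw [hy])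

theorem hasGrad (h : IsRadialNear g β γ x) (i j : ι) :
    HasGrad (fun y => g y i j)
      (fun a => 2 * deriv β (‖x‖ ^ 2) * x a * (1 : Matrix ι ι ℝ) i j
        + γ (‖x‖ ^ 2) * ((1 : Matrix ι ι ℝ) a i * x j + (1 : Matrix ι ι ℝ) a j * x i)
        + 2 * deriv γ (‖x‖ ^ 2) * (x a * x i * x j)) x :=
  hasGrad_of_differentiable h.eventually_eq (h.smooth_fst.differentiableAt (by simp))
    (h.smooth_snd.differentiableAt (by simp)) i j

/-- The coefficient of `x_c δ_{ab}` in the Christoffel symbols of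
`β δ + γ x xᵀ`. -/
def coeffα (β γ : ℝ → ℝ) (s : ℝ) : ℝ := (γ s - deriv β s) / (β s + s * γ s)
/-- The coefficient of `x_a δ_{cb} + x_b δ_{ca}` in the Christoffel symbols of
`β δ + γ x xᵀ`. -/
def coeffη (β : ℝ → ℝ) (s : ℝ) : ℝ := deriv β s / β s
/-- The coefficient of `x_a x_b x_c` in the Christoffel symbols of
`β δ + γ x xᵀ`. -/
def coeffζ (β γ : ℝ → ℝ) (s : ℝ) : ℝ :=
  deriv γ s / (β s + s * γ s) - 2 * deriv β s * γ s / (β s * (β s + s * γ s))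

theorem christoffel_eventually (h : IsRadialNear g β γ x) (hβ : β (‖x‖ ^ 2) ≠ 0)
    (hA : β (‖x‖ ^ 2) + ‖x‖ ^ 2 * γ (‖x‖ ^ 2) ≠ 0) :
    ∀ᶠ y in 𝓝 x, ∀ c a b, christoffel g c a b y
      = radialChristoffel (coeffα β γ (‖y‖ ^ 2)) (coeffη β (‖y‖ ^ 2)) (coeffζ β γ (‖y‖ ^ 2))
        y c a b := by
  have h1 : ∀ᶠ s in 𝓝 (‖x‖ ^ 2), β s ≠ 0 :=
    h.smooth_fst.continuousAt.eventually_ne hβ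
  have h2 : ∀ᶠ s in 𝓝 (‖x‖ ^ 2), β s + s * γ s ≠ 0 :=
    (h.smooth_fst.continuousAt.add
      (continuousAt_id.mul h.smooth_snd.continuousAt)).eventually_ne hA
  filter_upwards [h.eventually 1, eventually_normSq h1, eventually_normSq h2] with y hy hy1 hy2
  intro c a b
  exact christoffel_radial hy.1.self_of_nhds
    (fun a i j => (hasGrad_of_differentiable hy.1 (hy.2.1.differentiableAt (by simp))
      (hy.2.2.differentiableAt (by simp)) i j).2 a) hy1 hy2 c a b

theorem christoffel_eq (h : IsRadialNear g β γ x) (hβ : β (‖x‖ ^ 2) ≠ 0)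
    (hA : β (‖x‖ ^ 2) + ‖x‖ ^ 2 * γ (‖x‖ ^ 2) ≠ 0) (c a b : ι) :
    christoffel g c a b x
      = radialChristoffel (coeffα β γ (‖x‖ ^ 2)) (coeffη β (‖x‖ ^ 2)) (coeffζ β γ (‖x‖ ^ 2))
        x c a b := (h.christoffel_eventually hβ hA).self_of_nhds c a b

/-- The derivative of the coefficient ζ cancels between ∂_c Γᶜ_{ab} and ∂_b Γᶜ_{ac}, so the result
needs only the derivatives of α and η. The coefficient values are parameters so that simplified
expressions can be supplied. -/
theorem ricci_eq (h : IsRadialNear g β γ x) (hβ : β (‖x‖ ^ 2) ≠ 0)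
    (hA : β (‖x‖ ^ 2) + ‖x‖ ^ 2 * γ (‖x‖ ^ 2) ≠ 0) {α η ζ α' η' s : ℝ} (hs : ‖x‖ ^ 2 = s)
    (eα : coeffα β γ s = α) (eη : coeffη β s = η) (eζ : coeffζ β γ s = ζ)
    (hα : HasDerivAt (coeffα β γ) α' s) (hη : HasDerivAt (coeffη β) η' s) (a b : ι) :
    ricci g a b x = radialTensor
        (Fintype.card ι * α + 2 * s * α' + 2 * η
          - (α + (Fintype.card ι + 1) * η + s * ζ)
          + s * α * (α + (Fintype.card ι + 1) * η + s * ζ) - 2 * s * α * η)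
        (4 * η' + (Fintype.card ι + 2) * ζ - 2 * (α' + (Fintype.card ι + 1) * η' + ζ)
          + (α + (Fintype.card ι + 1) * η + s * ζ) * (2 * η + s * ζ)
          - (α ^ 2 + 2 * α * η + 2 * s * α * ζ + (Fintype.card ι + 3) * η ^ 2
            + 4 * s * η * ζ + s ^ 2 * ζ ^ 2)) x a b := by
  subst hs
  have hβ' : ContDiffAt ℝ ∞ (deriv β) (‖x‖ ^ 2) := h.smooth_fst.deriv_infty
  have hγ' : ContDiffAt ℝ ∞ (deriv γ) (‖x‖ ^ 2) := h.smooth_snd.deriv_infty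
  have hAs : ContDiffAt ℝ ∞ (fun s => β s + s * γ s) (‖x‖ ^ 2) :=
    h.smooth_fst.add (contDiffAt_id.mul h.smooth_snd)
  have hζ : HasDerivAt (coeffζ β γ) (deriv (coeffζ β γ) (‖x‖ ^ 2)) (‖x‖ ^ 2) := by
    apply ContDiffAt.hasDerivAt_infty
    exact (hγ'.div hAs hA).sub (((contDiffAt_const.mul hβ').mul h.smooth_snd).div
      (h.smooth_fst.mul hAs) (mul_ne_zero hβ hA))
  have hΓ := h.christoffel_eventually hβ hA
  have hpd : ∀ c a b, HasGrad (christoffel g c a b) _ x := fun c a b =>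
    (hasGrad_radialChristoffel hα hη hζ c a b).congr_eventuallyEq (hΓ.mono fun y hy => hy c a b)
  rw [ricci]
  simp only [(hpd _ _ _).2, h.christoffel_eq hβ hA]
  rw [sum_radialChristoffel, eα, eη, eζ]
  congr 1
  ring

theorem inv_eq (h : IsRadialNear g β γ x) (hβ : β (‖x‖ ^ 2) ≠ 0)
    (hA : β (‖x‖ ^ 2) + ‖x‖ ^ 2 * γ (‖x‖ ^ 2) ≠ 0) :
    (g x)⁻¹ = radialTensor (β (‖x‖ ^ 2))⁻¹ (-(γ (‖x‖ ^ 2) / (β (‖x‖ ^ 2) *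
      (β (‖x‖ ^ 2) + ‖x‖ ^ 2 * γ (‖x‖ ^ 2))))) x := by
  rw [h.eq, radialTensor_inv hβ hA]

end IsRadialNear

open IsRadialNear

theorem sum_inv_mul_radialTensor {g : EuclideanSpace ℝ ι → Matrix ι ι ℝ} {β γ : ℝ → ℝ}
    {x : EuclideanSpace ℝ ι} (h : IsRadialNear g β γ x) (hβ : β (‖x‖ ^ 2) ≠ 0)
    (hA : β (‖x‖ ^ 2) + ‖x‖ ^ 2 * γ (‖x‖ ^ 2) ≠ 0) (p q : ℝ) :
    ∑ a, ∑ b, (g x)⁻¹ a b * radialTensor p q x a b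
      = (Fintype.card ι - 1) * (p / β (‖x‖ ^ 2))
        + (p + ‖x‖ ^ 2 * q) / (β (‖x‖ ^ 2) + ‖x‖ ^ 2 * γ (‖x‖ ^ 2)) := by
  rw [h.inv_eq hβ hA, sum_radialTensor_mul_radialTensor]
  generalize hAe : β (‖x‖ ^ 2) + ‖x‖ ^ 2 * γ (‖x‖ ^ 2) = A at hA ⊢
  field_simp
  rw [← hAe]; ring

/-- The scalar curvature of `β δ + γ x xᵀ` in terms of the 1-jet of `A = β + s γ` and the 2-jet
of `β`. -/
theorem scalarCurvature_radial {g : EuclideanSpace ℝ ι → Matrix ι ι ℝ} {β γ : ℝ → ℝ}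
    {x : EuclideanSpace ℝ ι} {s b b1 b2 A A1 : ℝ}
    (h : IsRadialNear g β γ x) (hs : ‖x‖ ^ 2 = s) (hs0 : s ≠ 0) (hb : β s = b)
    (hb0 : b ≠ 0) (hA : β s + s * γ s = A) (hA0 : A ≠ 0) (hb1 : deriv β s = b1)
    (hb2 : deriv (deriv β) s = b2) (hA1 : HasDerivAt (fun s => β s + s * γ s) A1 s) :
    scalarCurvature g x = (Fintype.card ι - 1) * (
      (Fintype.card ι - 2) * (1 - (b + s * b1) ^ 2 / (A * b)) / (s * b)
      - 4 * (2 * b1 + s * b2) / (A * b)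
      + 2 * (b + s * b1) * (A1 * b + A * b1) / (A * b) ^ 2) := by
  subst hs
  have hβ0 : β (‖x‖ ^ 2) ≠ 0 := hb ▸ hb0
  have hA0' : β (‖x‖ ^ 2) + ‖x‖ ^ 2 * γ (‖x‖ ^ 2) ≠ 0 := hA ▸ hA0
  have dβ : HasDerivAt β b1 (‖x‖ ^ 2) := hb1 ▸ h.smooth_fst.hasDerivAt_infty
  have dβ' : HasDerivAt (deriv β) b2 (‖x‖ ^ 2) := hb2 ▸ h.smooth_fst.deriv_infty.hasDerivAt_infty
  have dγ := h.smooth_snd.hasDerivAt_infty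
  have hg : γ (‖x‖ ^ 2) = (A - b) / ‖x‖ ^ 2 := by
    rw [eq_div_iff hs0]; linear_combination hA - hb
  have hg1 : deriv γ (‖x‖ ^ 2) = (A1 - b1 - γ (‖x‖ ^ 2)) / ‖x‖ ^ 2 := by
    have e : A1 = b1 + (1 * γ (‖x‖ ^ 2) + ‖x‖ ^ 2 * deriv γ (‖x‖ ^ 2)) :=
      hA1.unique (dβ.add ((hasDerivAt_id _).mul dγ))
    rw [eq_div_iff hs0, e]; ring
  have hα := (dγ.sub dβ').div hA1 hA0'
  have hη := dβ'.div dβ hβ0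
  have hR := h.ricci_eq hβ0 hA0' rfl rfl rfl rfl hα hη
  simp only [scalarCurvature, hR]
  rw [sum_inv_mul_radialTensor h hβ0 hA0', coeffα, coeffη, coeffζ]
  simp only [Pi.sub_apply, Pi.add_apply, Pi.mul_apply, id]
  rw [hA, hb, hb1, hg1, hg]
  generalize ‖x‖ ^ 2 = s at hs0
  field_simp
  ring

theorem trace_radial {g k : EuclideanSpace ℝ ι → Matrix ι ι ℝ} {β γ : ℝ → ℝ}
    {x : EuclideanSpace ℝ ι} {κ l : ℝ} (h : IsRadialNear g β γ x)
    (hk : k x = radialTensor κ l x) (hβ : β (‖x‖ ^ 2) ≠ 0)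
    (hA : β (‖x‖ ^ 2) + ‖x‖ ^ 2 * γ (‖x‖ ^ 2) ≠ 0) :
    trace g k x = (Fintype.card ι - 1) * (κ / β (‖x‖ ^ 2))
        + (κ + ‖x‖ ^ 2 * l) / (β (‖x‖ ^ 2) + ‖x‖ ^ 2 * γ (‖x‖ ^ 2)) := by
  rw [trace, hk, sum_inv_mul_radialTensor h hβ hA]

theorem normSq_radial {g k : EuclideanSpace ℝ ι → Matrix ι ι ℝ} {β γ : ℝ → ℝ}
    {x : EuclideanSpace ℝ ι} {κ l : ℝ} (h : IsRadialNear g β γ x)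
    (hk : k x = radialTensor κ l x) (hβ : β (‖x‖ ^ 2) ≠ 0)
    (hA : β (‖x‖ ^ 2) + ‖x‖ ^ 2 * γ (‖x‖ ^ 2) ≠ 0) :
    normSq g k x = (Fintype.card ι - 1) * (κ / β (‖x‖ ^ 2)) ^ 2
        + ((κ + ‖x‖ ^ 2 * l) / (β (‖x‖ ^ 2) + ‖x‖ ^ 2 * γ (‖x‖ ^ 2))) ^ 2 := by
  -- Read as the pairing of k with g⁻¹ k g⁻ᵀ, the fourfold sum reduces to products of radial
  -- tensors.
  have h1 : normSq g k x = ∑ a, ∑ b, k x a b * ((g x)⁻¹ * k x * ((g x)⁻¹).transpose) a b := by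
    rw [normSq]
    refine Finset.sum_congr rfl fun a _ => Finset.sum_congr rfl fun b _ => ?_
    simp only [Matrix.mul_apply, Matrix.transpose_apply, Finset.mul_sum, Finset.sum_mul]
    rw [Finset.sum_comm]
    exact Finset.sum_congr rfl fun c _ => Finset.sum_congr rfl fun d _ => by ring
  have h2 : ∀ p q : ℝ, (radialTensor p q x).transpose = radialTensor p q x := by
    intro p q; ext i j
    rw [Matrix.transpose_apply, radialTensor_apply, radialTensor_apply, one_comm_apply j i]; ring
  rw [h1, h.inv_eq hβ hA, hk, h2, radialTensor_mul, radialTensor_mul,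
    sum_radialTensor_mul_radialTensor]
  generalize hAe : β (‖x‖ ^ 2) + ‖x‖ ^ 2 * γ (‖x‖ ^ 2) = A at hA ⊢
  field_simp
  rw [← hAe]; ring

theorem covDeriv_radial {g T : EuclideanSpace ℝ ι → Matrix ι ι ℝ} {x : EuclideanSpace ℝ ι}
    {α η ζ t t1 u u1 : ℝ}
    (hΓ : ∀ c a b, christoffel g c a b x = radialChristoffel α η ζ x c a b)
    (hT : T x = radialTensor t u x)
    (hpd : ∀ a i j, pd a (fun y => T y i j) x = 2 * t1 * x a * (1 : Matrix ι ι ℝ) i j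
        + u * ((1 : Matrix ι ι ℝ) a i * x j + (1 : Matrix ι ι ℝ) a j * x i)
        + 2 * u1 * (x a * x i * x j)) (a b c : ι) :
    covDeriv g T a b c x
      = (u - (t + ‖x‖ ^ 2 * u) * α - t * η)
          * ((1 : Matrix ι ι ℝ) a b * x c + x b * (1 : Matrix ι ι ℝ) a c)
        + (2 * t1 - 2 * t * η) * (x a * (1 : Matrix ι ι ℝ) b c)
        + (2 * u1 - 2 * t * ζ - 2 * u * (2 * η + ‖x‖ ^ 2 * ζ)) * (x a * x b * x c) := by
  have h1 : ∀ a b c, ∑ d, radialChristoffel α η ζ x d a b * radialTensor t u x d c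
      = t * radialChristoffel α η ζ x c a b
        + u * x c * radialTensor (‖x‖ ^ 2 * α) (2 * η + ‖x‖ ^ 2 * ζ) x a b := by
    intro a b c
    rw [← sum_mul_radialChristoffel, ← sum_one_mul c fun d => radialChristoffel α η ζ x d a b,
      Finset.mul_sum, Finset.mul_sum, ← Finset.sum_add_distrib]
    refine Finset.sum_congr rfl fun d _ => ?_
    rw [radialTensor_apply, one_comm_apply d c]; ring
  have h2 : ∀ d, radialTensor t u x b d = radialTensor t u x d b := by
    intro d; rw [radialTensor_apply, radialTensor_apply, one_comm_apply b d]; ring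
  rw [covDeriv, hpd, hT, Finset.sum_add_distrib]
  simp only [hΓ, h2, h1]
  simp only [radialChristoffel, radialTensor_apply]
  rw [one_comm_apply c b, one_comm_apply c a, one_comm_apply b a]
  ring

theorem divergence_radial {g T : EuclideanSpace ℝ ι → Matrix ι ι ℝ} {x : EuclideanSpace ℝ ι}
    {α η ζ t t1 u u1 p q : ℝ} (hinv : (g x)⁻¹ = radialTensor p q x)
    (hΓ : ∀ c a b, christoffel g c a b x = radialChristoffel α η ζ x c a b)
    (hT : T x = radialTensor t u x)
    (hpd : ∀ a i j, pd a (fun y => T y i j) x = 2 * t1 * x a * (1 : Matrix ι ι ℝ) i j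
        + u * ((1 : Matrix ι ι ℝ) a i * x j + (1 : Matrix ι ι ℝ) a j * x i)
        + 2 * u1 * (x a * x i * x j)) (c : ι) :
    divergence g T c x
      = ((Fintype.card ι * p + ‖x‖ ^ 2 * q) * (u - (t + ‖x‖ ^ 2 * u) * α - t * η)
        + (p + ‖x‖ ^ 2 * q) * (2 * t1 - 2 * t * η + (u - (t + ‖x‖ ^ 2 * u) * α - t * η))
        + ‖x‖ ^ 2 * (p + ‖x‖ ^ 2 * q)
          * (2 * u1 - 2 * t * ζ - 2 * u * (2 * η + ‖x‖ ^ 2 * ζ))) * x c := by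
  rw [divergence, hinv]
  simp only [covDeriv_radial hΓ hT hpd]
  generalize (u - (t + ‖x‖ ^ 2 * u) * α - t * η) = v1
  generalize (2 * u1 - 2 * t * ζ - 2 * u * (2 * η + ‖x‖ ^ 2 * ζ)) = v3
  have hb : ∀ a, ∑ b, radialTensor p q x a b * (v1 * ((1 : Matrix ι ι ℝ) a b * x c
        + x b * (1 : Matrix ι ι ℝ) a c) + (2 * t1 - 2 * t * η) * (x a * (1 : Matrix ι ι ℝ) b c)
        + v3 * (x a * x b * x c))
      = p * v1 * x c * (1 : Matrix ι ι ℝ) a a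
        + (q * v1 * x c + (2 * t1 - 2 * t * η) * q * x c
          + v3 * x c * (p + ‖x‖ ^ 2 * q)) * (x a * x a)
        + (v1 * (p + ‖x‖ ^ 2 * q) + (2 * t1 - 2 * t * η) * p)
          * ((1 : Matrix ι ι ℝ) c a * x a) := by
    intro a
    have e : ∀ b, radialTensor p q x a b * (v1 * ((1 : Matrix ι ι ℝ) a b * x c
        + x b * (1 : Matrix ι ι ℝ) a c) + (2 * t1 - 2 * t * η) * (x a * (1 : Matrix ι ι ℝ) b c)
        + v3 * (x a * x b * x c))
        = v1 * x c * ((1 : Matrix ι ι ℝ) a b * radialTensor p q x a b)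
          + (v1 * (1 : Matrix ι ι ℝ) a c + v3 * x a * x c) * (radialTensor p q x a b * x b)
          + (2 * t1 - 2 * t * η) * x a * ((1 : Matrix ι ι ℝ) b c * radialTensor p q x a b) := by
      intro b; ring
    simp only [e, Finset.sum_add_distrib, ← Finset.mul_sum, sum_one_mul, sum_one_mul',
      sum_radialTensor_mul_self]
    rw [radialTensor_apply, radialTensor_apply, one_comm_apply c a]; ring
  simp only [hb, Finset.sum_add_distrib, ← Finset.mul_sum, sum_one_mul, sum_one_apply_self,
    sum_mul_self]
  ring

/-- The divergence of `k - (tr k) g` for radial `g` and `k`. -/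
theorem divergence_momentum_radial {g k : EuclideanSpace ℝ ι → Matrix ι ι ℝ} {β γ κ l : ℝ → ℝ}
    {x : EuclideanSpace ℝ ι} {s b b1 A c c1 K : ℝ}
    (h : IsRadialNear g β γ x) (hk : IsRadialNear k κ l x) (hs : ‖x‖ ^ 2 = s) (hs0 : s ≠ 0)
    (hb : β s = b) (hb0 : b ≠ 0) (hA : β s + s * γ s = A) (hA0 : A ≠ 0) (hb1 : deriv β s = b1)
    (hc : κ s = c) (hc1 : deriv κ s = c1) (hK : κ s + s * l s = K) (i : ι) :
    divergence g (fun y => k y - trace g k y • g y) i x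
      = (Fintype.card ι - 1) * ((b + s * b1) / (s * b) * (K / A - c / b)
        - 2 * (c1 / b - c * b1 / b ^ 2)) * x i := by
  subst hs
  have hβ0 : β (‖x‖ ^ 2) ≠ 0 := hb ▸ hb0
  have hA0' : β (‖x‖ ^ 2) + ‖x‖ ^ 2 * γ (‖x‖ ^ 2) ≠ 0 := hA ▸ hA0
  have dβ : HasDerivAt β b1 (‖x‖ ^ 2) := hb1 ▸ h.smooth_fst.hasDerivAt_infty
  have dκ : HasDerivAt κ c1 (‖x‖ ^ 2) := hc1 ▸ hk.smooth_fst.hasDerivAt_infty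
  have dγ := h.smooth_snd.hasDerivAt_infty
  have dl := hk.smooth_snd.hasDerivAt_infty
  have hg : γ (‖x‖ ^ 2) = (A - b) / ‖x‖ ^ 2 := by
    rw [eq_div_iff hs0]; linear_combination hA - hb
  have hl : l (‖x‖ ^ 2) = (K - c) / ‖x‖ ^ 2 := by
    rw [eq_div_iff hs0]; linear_combination hK - hc
  have dA := dβ.add ((hasDerivAt_id _).mul dγ)
  have dK := dκ.add ((hasDerivAt_id _).mul dl)
  set m : ℝ := (Fintype.card ι : ℝ) with hm
  have dθ := ((dκ.div dβ hβ0).const_mul (m - 1)).add (dK.div dA hA0')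
  set θ : ℝ → ℝ := fun s => (m - 1) * (κ s / β s) + (κ s + s * l s) / (β s + s * γ s) with hθ
  have dθ' : HasDerivAt θ _ (‖x‖ ^ 2) := dθ
  have hT : ∀ᶠ y in 𝓝 x, (k y - trace g k y • g y)
      = radialTensor (κ (‖y‖ ^ 2) - θ (‖y‖ ^ 2) * β (‖y‖ ^ 2))
        (l (‖y‖ ^ 2) - θ (‖y‖ ^ 2) * γ (‖y‖ ^ 2)) y := by
    have h1 : ∀ᶠ s in 𝓝 (‖x‖ ^ 2), β s ≠ 0 := h.smooth_fst.continuousAt.eventually_ne hβ0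
    have h2 : ∀ᶠ s in 𝓝 (‖x‖ ^ 2), β s + s * γ s ≠ 0 :=
      (h.smooth_fst.continuousAt.add
        (continuousAt_id.mul h.smooth_snd.continuousAt)).eventually_ne hA0'
    filter_upwards [h.eventually_eq, hk.eventually_eq, eventually_normSq h1,
      eventually_normSq h2] with y e1 e2 e3 e4
    have : trace g k y = θ (‖y‖ ^ 2) := by
      rw [trace, e1, e2, radialTensor_inv e3 e4, sum_radialTensor_mul_radialTensor, hθ, ← hm]
      dsimp only
      generalize hAe : β (‖y‖ ^ 2) + ‖y‖ ^ 2 * γ (‖y‖ ^ 2) = A at e4 ⊢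
      field_simp
      rw [← hAe]; ring
    rw [this, e1, e2]
    ext i j
    simp only [Matrix.sub_apply, Matrix.smul_apply, radialTensor_apply, smul_eq_mul]
    ring
  have hpd := fun i j => ((hasGrad_radialTensor (dκ.sub (dθ'.mul dβ)) (dl.sub (dθ'.mul dγ))
    i j).congr_eventuallyEq (f := fun y => radialTensor _ _ y i j)
      (g := fun y => (k y - trace g k y • g y) i j) (hT.mono fun y hy => by
        dsimp only; rw [hy]; rfl)).2
  rw [divergence_radial (h.inv_eq hβ0 hA0') (h.christoffel_eq hβ0 hA0') hT.self_of_nhds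
    (fun a i j => hpd i j a)]
  congr 1
  simp only [coeffα, coeffη, coeffζ, hθ, Pi.sub_apply, Pi.add_apply, Pi.mul_apply, Pi.div_apply,
    id, ← hm]
  rw [hA, hK, hc, hb, hb1, hg, hl]
  generalize ‖x‖ ^ 2 = s at hs0
  field_simp
  ring

end RadialCurvature

end SpacetimePenrose
end

noncomputable section
namespace SpacetimePenrose

/-! ### Radial profiles of spherically symmetric data -/

namespace InitialDataSet

variable {n : ℕ}

/-- The radial coefficient functions, as functions of `s = |x|²`, of spherically symmetric initial
data: `A`, `K` are the radial and `b`, `c` the tangential components of `g`, `k`. -/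
structure HasProfile (D : InitialDataSet n) (A b K c : ℝ → ℝ) : Prop where
  smooth_A : ∀ s, 0 < s → D.r₀ ^ 2 ≤ s → ContDiffAt ℝ ∞ A s
  smooth_b : ∀ s, 0 < s → D.r₀ ^ 2 ≤ s → ContDiffAt ℝ ∞ b s
  smooth_K : ∀ s, 0 < s → D.r₀ ^ 2 ≤ s → ContDiffAt ℝ ∞ K s
  smooth_c : ∀ s, 0 < s → D.r₀ ^ 2 ≤ s → ContDiffAt ℝ ∞ c s
  pos_A : ∀ s, 0 < s → D.r₀ ^ 2 ≤ s → 0 < A s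
  pos_b : ∀ s, 0 < s → D.r₀ ^ 2 ≤ s → 0 < b s
  g_eq : ∀ x ∈ D.M, x ≠ 0 →
    D.g x = radialTensor (b (‖x‖ ^ 2)) ((A (‖x‖ ^ 2) - b (‖x‖ ^ 2)) / ‖x‖ ^ 2) x
  k_eq : ∀ x ∈ D.M, x ≠ 0 →
    D.k x = radialTensor (c (‖x‖ ^ 2)) ((K (‖x‖ ^ 2) - c (‖x‖ ^ 2)) / ‖x‖ ^ 2) x

/-- The functions in the definition of spherical symmetry carry no regularity. Smooth profiles are
read off from g and k on the half-axis √s e₀: the (0,0) component is radial, the (1,1) component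
tangential. Since the points of that axis lie in M for s ≥ r₀², smoothness up to the boundary is
inherited. -/
theorem exists_profile (hn : 2 ≤ n) {D : InitialDataSet n} (hD : D.IsSphericallySymmetric) :
    ∃ A b K c : ℝ → ℝ, D.HasProfile A b K c := by
  obtain ⟨g₁₁, ρ, kₙ, kₜ, h⟩ := hD
  set i0 : Fin n := ⟨0, by omega⟩
  set i1 : Fin n := ⟨1, by omega⟩
  have h01 : i1 ≠ i0 := by simp [i0, i1]
  set p : ℝ → EuclideanSpace ℝ (Fin n) := fun s => Real.sqrt s • EuclideanSpace.single i0 1 with hp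
  have hpn : ∀ s, ‖p s‖ = Real.sqrt s := fun s => by
    simp [hp, norm_smul, abs_of_nonneg (Real.sqrt_nonneg s)]
  have hp0 : ∀ s, p s i0 = Real.sqrt s := fun s => by simp [hp]
  have hp1 : ∀ s, p s i1 = 0 := fun s => by simp [hp, h01]
  have hM : ∀ s, D.r₀ ^ 2 ≤ s → p s ∈ D.M := fun s hs => by
    show D.r₀ ≤ ‖p s‖
    rw [hpn]; exact Real.le_sqrt_of_sq_le hs
  have hne : ∀ s, 0 < s → p s ≠ 0 := fun s hs => by
    rw [← norm_pos_iff, hpn]; exact Real.sqrt_pos.2 hs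
  have hpc : ∀ s, 0 < s → ContDiffAt ℝ ∞ p s := fun s hs =>
    (Real.contDiffAt_sqrt hs.ne').smul contDiffAt_const
  have hval : ∀ s, 0 < s → D.r₀ ^ 2 ≤ s →
      D.g (p s) i0 i0 = g₁₁ (Real.sqrt s) ∧ D.g (p s) i1 i1 = ρ (Real.sqrt s) ^ 2 / s ∧
      D.k (p s) i0 i0 = g₁₁ (Real.sqrt s) * kₙ (Real.sqrt s) ∧
      D.k (p s) i1 i1 = ρ (Real.sqrt s) ^ 2 / s * kₜ (Real.sqrt s) := by
    intro s hs hs'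
    obtain ⟨h1, h2, h3, h4⟩ := h (p s) (hM s hs') (hne s hs)
    rw [hpn] at h1 h2
    have hq := Real.sq_sqrt hs.le
    have hq' := Real.sq_sqrt h1.le
    have hqp := Real.sqrt_pos.2 hs
    have e0 : D.g (p s) i0 i0 = g₁₁ (Real.sqrt s) := by
      rw [h3, hpn, hp0]; simp only [Matrix.one_apply_eq]; rw [← sq, hq]; field_simp; ring
    have e1 : D.g (p s) i1 i1 = ρ (Real.sqrt s) ^ 2 / s := by
      rw [h3, hpn, hp1]; simp only [Matrix.one_apply_eq]; rw [hq]; ring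
    refine ⟨e0, e1, ?_, ?_⟩
    · rw [h4, e0, hpn, hp0, mul_div_assoc, div_self hqp.ne', mul_one, ← sq, hq']; ring
    · rw [h4, e1, hpn, hp1]; ring
  refine ⟨fun s => D.g (p s) i0 i0, fun s => D.g (p s) i1 i1, fun s => D.k (p s) i0 i0,
    fun s => D.k (p s) i1 i1, ?_, ?_, ?_, ?_, ?_, ?_, ?_, ?_⟩
  · exact fun s hs hs' => (D.smooth_g i0 i0 (p s) (hM s hs')).comp s (hpc s hs)
  · exact fun s hs hs' => (D.smooth_g i1 i1 (p s) (hM s hs')).comp s (hpc s hs)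
  · exact fun s hs hs' => (D.smooth_k i0 i0 (p s) (hM s hs')).comp s (hpc s hs)
  · exact fun s hs hs' => (D.smooth_k i1 i1 (p s) (hM s hs')).comp s (hpc s hs)
  · exact fun s hs hs' => (D.posDef_g _ (hM s hs')).diag_pos
  · exact fun s hs hs' => (D.posDef_g _ (hM s hs')).diag_pos
  · intro x hx hx0
    have hx1 : 0 < ‖x‖ := norm_pos_iff.2 hx0
    obtain ⟨h1, h2, h3, h4⟩ := h x hx hx0
    obtain ⟨e1, e2, e3, e4⟩ := hval (‖x‖ ^ 2) (by positivity)
      (pow_le_pow_left₀ D.r₀_nonneg hx 2)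
    ext i j
    rw [h3, radialTensor_apply, e1, e2, Real.sqrt_sq hx1.le]
    field_simp; ring
  · intro x hx hx0
    have hx1 : 0 < ‖x‖ := norm_pos_iff.2 hx0
    obtain ⟨h1, h2, h3, h4⟩ := h x hx hx0
    obtain ⟨e1, e2, e3, e4⟩ := hval (‖x‖ ^ 2) (by positivity)
      (pow_le_pow_left₀ D.r₀_nonneg hx 2)
    ext i j
    have hq' := Real.sq_sqrt h1.le
    have e : (Real.sqrt (g₁₁ ‖x‖) * x i / ‖x‖) * (Real.sqrt (g₁₁ ‖x‖) * x j / ‖x‖)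
        = g₁₁ ‖x‖ * (x i * x j / ‖x‖ ^ 2) := by
      rw [← hq']; field_simp; rw [Real.sqrt_sq (Real.sqrt_nonneg _)]
    rw [h4, h3, e, radialTensor_apply, e3, e4, Real.sqrt_sq hx1.le]
    field_simp; ring

/-- The scalar curvature of the metric with radial profile `A`, `b`. -/
def profileScal (n : ℕ) (A b : ℝ → ℝ) (s : ℝ) : ℝ :=
  ((n : ℝ) - 1) * (((n : ℝ) - 2) * (1 - (b s + s * deriv b s) ^ 2 / (A s * b s)) / (s * b s)
      - 4 * (2 * deriv b s + s * deriv (deriv b) s) / (A s * b s)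
      + 2 * (b s + s * deriv b s) * (deriv A s * b s + A s * deriv b s) / (A s * b s) ^ 2)

/-- The trace of `k` for the profile `A`, `b`, `K`, `c`. -/
def profileTrace (n : ℕ) (A b K c : ℝ → ℝ) (s : ℝ) : ℝ :=
  ((n : ℝ) - 1) * (c s / b s) + K s / A s

/-- `16 π μ` for the profile `A`, `b`, `K`, `c`. -/
def profileEnergy (n : ℕ) (A b K c : ℝ → ℝ) (s : ℝ) : ℝ :=
  profileScal n A b s + profileTrace n A b K c s ^ 2
    - (((n : ℝ) - 1) * (c s / b s) ^ 2 + (K s / A s) ^ 2)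

/-- The function `j` with `8 π Jᵢ = j xᵢ` for the profile `A`, `b`, `K`, `c`. -/
def profileMomentum (n : ℕ) (A b K c : ℝ → ℝ) (s : ℝ) : ℝ :=
  ((n : ℝ) - 1) * ((b s + s * deriv b s) / (s * b s) * (K s / A s - c s / b s)
        - 2 * (deriv c s / b s - c s * deriv b s / b s ^ 2))

/-- The squared norm of the spacetime gradient of the area radius. -/
def profileF (A b c : ℝ → ℝ) (s : ℝ) : ℝ :=
  ((b s + s * deriv b s) ^ 2 / A s - s * c s ^ 2) / b s

namespace HasProfile

variable {D : InitialDataSet n} {A b K c : ℝ → ℝ}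

theorem normSq_mem {x : EuclideanSpace ℝ (Fin n)} (hx : x ∈ D.M) (hx0 : x ≠ 0) :
    0 < ‖x‖ ^ 2 ∧ D.r₀ ^ 2 ≤ ‖x‖ ^ 2 :=
  ⟨by have := norm_pos_iff.2 hx0; positivity, pow_le_pow_left₀ D.r₀_nonneg hx 2⟩

theorem ne_zero_of_lt_norm {x : EuclideanSpace ℝ (Fin n)} (hx : D.r₀ < ‖x‖) : x ≠ 0 :=
  norm_pos_iff.1 (D.r₀_nonneg.trans_lt hx)

theorem isRadialNear_g (h : D.HasProfile A b K c) {x : EuclideanSpace ℝ (Fin n)}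
    (hx : D.r₀ < ‖x‖) : IsRadialNear D.g b (fun s => (A s - b s) / s) x := by
  obtain ⟨h1, h2⟩ := normSq_mem (D := D) hx.le (ne_zero_of_lt_norm hx)
  refine ⟨?_, h.smooth_b _ h1 h2,
    ((h.smooth_A _ h1 h2).sub (h.smooth_b _ h1 h2)).div contDiffAt_id h1.ne'⟩
  filter_upwards [continuous_norm.continuousAt.eventually (lt_mem_nhds hx)] with y hy
  exact h.g_eq y hy.le (ne_zero_of_lt_norm hy)

theorem isRadialNear_k (h : D.HasProfile A b K c) {x : EuclideanSpace ℝ (Fin n)}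
    (hx : D.r₀ < ‖x‖) : IsRadialNear D.k c (fun s => (K s - c s) / s) x := by
  obtain ⟨h1, h2⟩ := normSq_mem (D := D) hx.le (ne_zero_of_lt_norm hx)
  refine ⟨?_, h.smooth_c _ h1 h2,
    ((h.smooth_K _ h1 h2).sub (h.smooth_c _ h1 h2)).div contDiffAt_id h1.ne'⟩
  filter_upwards [continuous_norm.continuousAt.eventually (lt_mem_nhds hx)] with y hy
  exact h.k_eq y hy.le (ne_zero_of_lt_norm hy)

theorem add_mul_div (A b : ℝ → ℝ) {s : ℝ} (hs : 0 < s) :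
    b s + s * ((A s - b s) / s) = A s := by field_simp; ring

theorem hasDerivAt_add_mul_div (h : D.HasProfile A b K c) {s : ℝ} (hs : 0 < s)
    (hs' : D.r₀ ^ 2 ≤ s) :
    HasDerivAt (fun s => b s + s * ((A s - b s) / s)) (deriv A s) s := by
  refine (h.smooth_A s hs hs').hasDerivAt_infty.congr_of_eventuallyEq ?_
  filter_upwards [lt_mem_nhds hs] with t ht using add_mul_div A b ht

theorem energyDensity_eq (h : D.HasProfile A b K c) {x : EuclideanSpace ℝ (Fin n)}
    (hx : D.r₀ < ‖x‖) :
    D.energyDensity x = profileEnergy n A b K c (‖x‖ ^ 2) / (16 * Real.pi) := by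
  obtain ⟨h1, h2⟩ := normSq_mem (D := D) hx.le (ne_zero_of_lt_norm hx)
  have hA := add_mul_div A b h1
  have hK := add_mul_div K c h1
  have hb0 := (h.pos_b _ h1 h2).ne'
  have hA0 := (h.pos_A _ h1 h2).ne'
  have hg := h.isRadialNear_g hx
  rw [energyDensity, scalarCurvature_radial hg rfl h1.ne' rfl hb0 hA hA0 rfl rfl
    (h.hasDerivAt_add_mul_div h1 h2), trace_radial hg (h.isRadialNear_k hx).eq hb0 (hA.symm ▸ hA0),
    normSq_radial hg (h.isRadialNear_k hx).eq hb0 (hA.symm ▸ hA0), hA, hK, Fintype.card_fin]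
  rfl

theorem momentumDensity_eq (h : D.HasProfile A b K c) {x : EuclideanSpace ℝ (Fin n)}
    (hx : D.r₀ < ‖x‖) (i : Fin n) :
    D.momentumDensity i x = profileMomentum n A b K c (‖x‖ ^ 2) * x i / (8 * Real.pi) := by
  obtain ⟨h1, h2⟩ := normSq_mem (D := D) hx.le (ne_zero_of_lt_norm hx)
  have hA := add_mul_div A b h1
  have hK := add_mul_div K c h1
  rw [momentumDensity, divergence_momentum_radial (h.isRadialNear_g hx) (h.isRadialNear_k hx) rfl
    h1.ne' rfl (h.pos_b _ h1 h2).ne' hA (h.pos_A _ h1 h2).ne' rfl rfl rfl hK, Fintype.card_fin]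
  rfl

/-- J is radial and g has radial component A, so |J| = |j| √(s/A) / (8π); the factor 2 is the ratio
of the normalizations 16π and 8π. -/
theorem momentum_le_energy (h : D.HasProfile A b K c) (hn : 1 ≤ n)
    (hdec : D.DominantEnergyCondition) {s : ℝ} (hs : D.r₀ ^ 2 < s) :
    2 * |profileMomentum n A b K c s| * Real.sqrt (s / A s) ≤ profileEnergy n A b K c s := by
  have hs0 : 0 < s := (sq_nonneg _).trans_lt hs
  set x : EuclideanSpace ℝ (Fin n) := EuclideanSpace.single ⟨0, hn⟩ (Real.sqrt s) with hx
  have hxn : ‖x‖ ^ 2 = s := by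
    rw [hx, PiLp.norm_single, Real.norm_eq_abs, sq_abs, Real.sq_sqrt hs0.le]
  have hx' : D.r₀ < ‖x‖ := by
    refine lt_of_pow_lt_pow_left₀ 2 (norm_nonneg _) ?_
    rwa [hxn]
  obtain ⟨h1, h2⟩ := normSq_mem (D := D) hx'.le (ne_zero_of_lt_norm hx')
  have hd := hdec x hx'.le
  simp only [h.energyDensity_eq hx', h.momentumDensity_eq hx', hxn] at hd
  have hA := add_mul_div A b h1
  have hg := h.isRadialNear_g hx'
  set j := profileMomentum n A b K c s
  have hsum : ∑ i, ∑ l, (D.g x)⁻¹ i l * (j * x i / (8 * Real.pi)) * (j * x l / (8 * Real.pi))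
      = (|j| / (8 * Real.pi)) ^ 2 * (s / A s) := by
    have e : ∀ i, ∑ l, (D.g x)⁻¹ i l * (j * x i / (8 * Real.pi)) * (j * x l / (8 * Real.pi))
        = (j / (8 * Real.pi)) ^ 2 * (x i * ∑ l, (D.g x)⁻¹ i l * x l) := by
      intro i
      rw [Finset.mul_sum, Finset.mul_sum]
      exact Finset.sum_congr rfl fun l _ => by ring
    simp only [e, ← Finset.mul_sum]
    rw [hg.inv_eq (h.pos_b _ h1 h2).ne' (hA.symm ▸ (h.pos_A _ h1 h2).ne')]
    simp only [sum_radialTensor_mul_self]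
    have e2 : ∀ z : ℝ, ∑ i, x i * (z * x i) = z * ‖x‖ ^ 2 := fun z => by
      rw [← sum_mul_self, Finset.mul_sum]
      exact Finset.sum_congr rfl fun i _ => by ring
    rw [e2]
    rw [hA, hxn, div_pow, div_pow, sq_abs]
    have hb0 := (h.pos_b _ h1 h2).ne'
    have hA0 := (h.pos_A _ h1 h2).ne'
    rw [hxn] at hb0 hA0
    field_simp; ring
  rw [hsum, Real.sqrt_mul (sq_nonneg _), Real.sqrt_sq (by positivity)] at hd
  have hpi := Real.pi_pos
  rw [div_mul_eq_mul_div, div_le_div_iff₀ (by positivity) (by positivity)] at hd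
  nlinarith

/-- This is where the constraint equations enter. The second derivative of b and the first
derivatives of A and c are absorbed into the energy and momentum densities, and the terms with K
cancel between the two. -/
theorem hasDerivAt_profileF (h : D.HasProfile A b K c) {s : ℝ} (hs : 0 < s)
    (hs' : D.r₀ ^ 2 ≤ s) (hn : (n : ℝ) - 1 ≠ 0) :
    HasDerivAt (profileF A b c) (((n : ℝ) - 2) * (b s + s * deriv b s) / (2 * s * b s)
        * (1 - profileF A b c s)
      - (profileEnergy n A b K c s / 2 * (b s + s * deriv b s)
          - s * c s * profileMomentum n A b K c s) / ((n : ℝ) - 1)) s := by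
  have dA := (h.smooth_A s hs hs').hasDerivAt_infty
  have db := (h.smooth_b s hs hs').hasDerivAt_infty
  have db' := (h.smooth_b s hs hs').deriv_infty.hasDerivAt_infty
  have dc := (h.smooth_c s hs hs').hasDerivAt_infty
  have hA := (h.pos_A s hs hs').ne'
  have hb := (h.pos_b s hs hs').ne'
  have d := ((((db.add ((hasDerivAt_id s).mul db')).pow 2).div dA hA).sub
    ((hasDerivAt_id s).mul (dc.pow 2))).div db hb
  refine d.congr_deriv ?_
  simp only [Pi.sub_apply, Pi.add_apply, Pi.mul_apply, Pi.div_apply, Pi.pow_apply, id,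
    profileEnergy, profileMomentum, profileScal, profileTrace, profileF]
  have hs1 := hs.ne'
  generalize A s = a at *
  generalize b s = q at *
  field_simp
  ring

end HasProfile
end InitialDataSet
end SpacetimePenrose
end

noncomputable section
namespace SpacetimePenrose

namespace InitialDataSet

variable {n : ℕ} {D : InitialDataSet n} {A b K c : ℝ → ℝ}

/-! ### Null expansions at points where the normal is radial -/

theorem tendsto_smul_nhdsGT (x : EuclideanSpace ℝ (Fin n)) :
    Tendsto (fun t : ℝ => t • x) (𝓝[>] 1) (𝓝 x) := by
  have : Tendsto (fun t : ℝ => t • x) (𝓝 1) (𝓝 ((1 : ℝ) • x)) :=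
    (continuous_id.smul continuous_const).tendsto 1
  rw [one_smul] at this
  exact this.mono_left nhdsWithin_le_nhds

theorem lt_norm_smul {x : EuclideanSpace ℝ (Fin n)} {r t : ℝ} (hx : r ≤ ‖x‖) (hx0 : x ≠ 0)
    (ht : 1 < t) : r < ‖t • x‖ := by
  rw [norm_smul, Real.norm_eq_abs, abs_of_pos (by linarith)]
  nlinarith [norm_pos_iff.2 hx0]

namespace HasProfile

/-- For |x| = r₀ the radial form of g is known only on one side. Both sides of the formula are
continuous at x and agree at t x for t > 1, so they agree in the limit t → 1. -/
theorem pd_g (h : D.HasProfile A b K c) {x : EuclideanSpace ℝ (Fin n)} (hx : x ∈ D.M)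
    (hx0 : x ≠ 0) (a i j : Fin n) :
    pd a (fun y => D.g y i j) x
      = 2 * deriv b (‖x‖ ^ 2) * x a * (1 : Matrix (Fin n) (Fin n) ℝ) i j
        + (A (‖x‖ ^ 2) - b (‖x‖ ^ 2)) / ‖x‖ ^ 2 * ((1 : Matrix (Fin n) (Fin n) ℝ) a i * x j
          + (1 : Matrix (Fin n) (Fin n) ℝ) a j * x i)
        + 2 * deriv (fun s => (A s - b s) / s) (‖x‖ ^ 2) * (x a * x i * x j) := by
  obtain ⟨h1, h2⟩ := normSq_mem hx hx0
  have hc1 : ContinuousAt (pd a (fun y => D.g y i j)) x := ((D.smooth_g i j x hx).pd a).continuousAt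
  have hγ : ContDiffAt ℝ ∞ (fun s => (A s - b s) / s) (‖x‖ ^ 2) :=
    ((h.smooth_A _ h1 h2).sub (h.smooth_b _ h1 h2)).div contDiffAt_id h1.ne'
  have hsq : ContinuousAt (fun y : EuclideanSpace ℝ (Fin n) => ‖y‖ ^ 2) x :=
    (continuous_norm.pow 2).continuousAt
  have hco : ∀ i : Fin n, ContinuousAt (fun y : EuclideanSpace ℝ (Fin n) => y i) x := fun i =>
    (EuclideanSpace.proj i : EuclideanSpace ℝ (Fin n) →L[ℝ] ℝ).continuous.continuousAt
  have hb1 : ContinuousAt (fun y : EuclideanSpace ℝ (Fin n) => deriv b (‖y‖ ^ 2)) x :=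
    ContinuousAt.comp (f := fun y : EuclideanSpace ℝ (Fin n) => ‖y‖ ^ 2)
      (h.smooth_b _ h1 h2).deriv_infty.continuousAt hsq
  have hg0 : ContinuousAt (fun y : EuclideanSpace ℝ (Fin n) =>
      (A (‖y‖ ^ 2) - b (‖y‖ ^ 2)) / ‖y‖ ^ 2) x :=
    ContinuousAt.comp (f := fun y : EuclideanSpace ℝ (Fin n) => ‖y‖ ^ 2) hγ.continuousAt hsq
  have hg1 : ContinuousAt (fun y : EuclideanSpace ℝ (Fin n) =>
      deriv (fun s => (A s - b s) / s) (‖y‖ ^ 2)) x :=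
    ContinuousAt.comp (f := fun y : EuclideanSpace ℝ (Fin n) => ‖y‖ ^ 2)
      hγ.deriv_infty.continuousAt hsq
  have hc2 : ContinuousAt (fun y : EuclideanSpace ℝ (Fin n) =>
      2 * deriv b (‖y‖ ^ 2) * y a * (1 : Matrix (Fin n) (Fin n) ℝ) i j
        + (A (‖y‖ ^ 2) - b (‖y‖ ^ 2)) / ‖y‖ ^ 2 * ((1 : Matrix (Fin n) (Fin n) ℝ) a i * y j
          + (1 : Matrix (Fin n) (Fin n) ℝ) a j * y i)
        + 2 * deriv (fun s => (A s - b s) / s) (‖y‖ ^ 2) * (y a * y i * y j)) x :=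
    ((((continuousAt_const.mul hb1).mul (hco a)).mul continuousAt_const).add
      (hg0.mul ((continuousAt_const.mul (hco j)).add (continuousAt_const.mul (hco i))))).add
      ((continuousAt_const.mul hg1).mul (((hco a).mul (hco i)).mul (hco j)))
  refine tendsto_nhds_unique_of_eventuallyEq (hc1.tendsto.comp (tendsto_smul_nhdsGT x))
    (hc2.tendsto.comp (tendsto_smul_nhdsGT x)) ?_
  filter_upwards [self_mem_nhdsWithin] with t ht
  exact ((h.isRadialNear_g (lt_norm_smul hx hx0 ht)).hasGrad i j).2 a

/-- Only the coefficient of x_d δ_{ij} survives the tangential projection in the mean curvature; the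
other two are left unspecified. -/
theorem christoffel_eq (h : D.HasProfile A b K c) {x : EuclideanSpace ℝ (Fin n)} (hx : x ∈ D.M)
    (hx0 : x ≠ 0) : ∃ η ζ : ℝ, ∀ d i j, christoffel D.g d i j x = radialChristoffel
      ((A (‖x‖ ^ 2) - b (‖x‖ ^ 2) - ‖x‖ ^ 2 * deriv b (‖x‖ ^ 2)) / (‖x‖ ^ 2 * A (‖x‖ ^ 2)))
      η ζ x d i j := by
  obtain ⟨h1, h2⟩ := normSq_mem hx hx0
  have hA := add_mul_div A b h1
  have hb0 := (h.pos_b _ h1 h2).ne'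
  have hA0 := (h.pos_A _ h1 h2).ne'
  have key := christoffel_radial (h.g_eq x hx hx0) (h.pd_g hx hx0) hb0 (hA.symm ▸ hA0)
  have e : ((A (‖x‖ ^ 2) - b (‖x‖ ^ 2)) / ‖x‖ ^ 2 - deriv b (‖x‖ ^ 2))
      / (b (‖x‖ ^ 2) + ‖x‖ ^ 2 * ((A (‖x‖ ^ 2) - b (‖x‖ ^ 2)) / ‖x‖ ^ 2))
      = (A (‖x‖ ^ 2) - b (‖x‖ ^ 2) - ‖x‖ ^ 2 * deriv b (‖x‖ ^ 2)) / (‖x‖ ^ 2 * A (‖x‖ ^ 2)) := by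
    rw [hA]
    field_simp
  exact ⟨_, _, fun d i j => (key d i j).trans
    (congrArg (fun α => radialChristoffel α _ _ x d i j) e)⟩

/-- The tangential projection `δ - x xᵀ / |x|²`. -/
theorem inv_sub_unitNormal (h : D.HasProfile A b K c) {x : EuclideanSpace ℝ (Fin n)}
    (hx : x ∈ D.M) (hx0 : x ≠ 0) {u : EuclideanSpace ℝ (Fin n) → ℝ} {l : ℝ} (hl : 0 < l)
    (hu : ∀ a, pd a u x = l * x a) :
    gradNorm D.g u x = l * ‖x‖ / Real.sqrt (A (‖x‖ ^ 2)) ∧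
    ∀ i j, (D.g x)⁻¹ i j - unitNormal D.g u i x * unitNormal D.g u j x
      = radialTensor (b (‖x‖ ^ 2))⁻¹ (-(b (‖x‖ ^ 2) * ‖x‖ ^ 2)⁻¹) x i j := by
  obtain ⟨h1, h2⟩ := normSq_mem hx hx0
  have hA := add_mul_div A b h1
  have hb0 := (h.pos_b _ h1 h2).ne'
  have hA0 := h.pos_A _ h1 h2
  have hinv : (D.g x)⁻¹ = radialTensor (b (‖x‖ ^ 2))⁻¹ (-((A (‖x‖ ^ 2) - b (‖x‖ ^ 2)) / ‖x‖ ^ 2 /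
      (b (‖x‖ ^ 2) * A (‖x‖ ^ 2)))) x := by
    rw [h.g_eq x hx hx0, radialTensor_inv hb0 (hA.symm ▸ hA0.ne'), hA]
  have hraise : ∀ i, ∑ j, (D.g x)⁻¹ i j * pd j u x = l / A (‖x‖ ^ 2) * x i := by
    intro i
    simp only [hu, hinv, mul_left_comm _ l _, ← Finset.mul_sum, sum_radialTensor_mul_self]
    field_simp; ring
  have hxp : 0 < ‖x‖ := norm_pos_iff.2 hx0
  have hsA := Real.sqrt_pos.2 hA0
  have hsA2 := Real.sq_sqrt hA0.le
  have hgrad : gradNorm D.g u x = l * ‖x‖ / Real.sqrt (A (‖x‖ ^ 2)) := by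
    have e : ∑ i, ∑ j, (D.g x)⁻¹ i j * pd i u x * pd j u x
        = (l * ‖x‖ / Real.sqrt (A (‖x‖ ^ 2))) ^ 2 := by
      have e1 : ∀ i, ∑ j, (D.g x)⁻¹ i j * pd i u x * pd j u x
          = l * x i * ∑ j, (D.g x)⁻¹ i j * pd j u x := by
        intro i
        rw [← hu, Finset.mul_sum]
        exact Finset.sum_congr rfl fun j _ => by ring
      simp only [e1, hraise]
      have e2 : ∀ i, l * x i * (l / A (‖x‖ ^ 2) * x i) = l ^ 2 / A (‖x‖ ^ 2) * (x i * x i) :=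
        fun i => by ring
      simp only [e2, ← Finset.mul_sum, sum_mul_self]
      rw [div_pow, hsA2]; ring
    rw [gradNorm, e, Real.sqrt_sq (by positivity)]
  refine ⟨hgrad, fun i j => ?_⟩
  rw [unitNormal, unitNormal, hraise, hraise, hgrad, hinv, radialTensor_apply, radialTensor_apply]
  have e3 : l / A (‖x‖ ^ 2) * x i / (l * ‖x‖ / Real.sqrt (A (‖x‖ ^ 2)))
      * (l / A (‖x‖ ^ 2) * x j / (l * ‖x‖ / Real.sqrt (A (‖x‖ ^ 2))))
      = x i * x j / (‖x‖ ^ 2 * A (‖x‖ ^ 2)) := by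
    have : l / A (‖x‖ ^ 2) * x i / (l * ‖x‖ / Real.sqrt (A (‖x‖ ^ 2)))
      * (l / A (‖x‖ ^ 2) * x j / (l * ‖x‖ / Real.sqrt (A (‖x‖ ^ 2))))
      = (l / A (‖x‖ ^ 2)) ^ 2 * (x i * x j) * Real.sqrt (A (‖x‖ ^ 2)) ^ 2 / (l * ‖x‖) ^ 2 := by
      field_simp
    rw [this, hsA2]; field_simp
  rw [e3]
  generalize A (‖x‖ ^ 2) = a at *
  generalize b (‖x‖ ^ 2) = q at *
  have := hA0.ne'
  field_simp
  ring

theorem tangentialTrace_eq (h : D.HasProfile A b K c) {x : EuclideanSpace ℝ (Fin n)}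
    (hx : x ∈ D.M) (hx0 : x ≠ 0) {u : EuclideanSpace ℝ (Fin n) → ℝ} {l : ℝ} (hl : 0 < l)
    (hu : ∀ a, pd a u x = l * x a) :
    tangentialTrace D.g D.k u x = ((n : ℝ) - 1) * (c (‖x‖ ^ 2) / b (‖x‖ ^ 2)) := by
  obtain ⟨h1, h2⟩ := normSq_mem hx hx0
  have hb0 := (h.pos_b _ h1 h2).ne'
  simp only [tangentialTrace, (h.inv_sub_unitNormal hx hx0 hl hu).2]
  rw [h.k_eq x hx hx0, sum_radialTensor_mul_radialTensor, Fintype.card_fin]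
  field_simp
  ring

/-- Near x the function u is compared with (l/2)|y|², which has the same gradient l x at x. The
first term is the tangential trace of the difference of the two Hessians, and the second is the mean
curvature of the coordinate sphere through x. -/
theorem meanCurvature_eq (h : D.HasProfile A b K c) {x : EuclideanSpace ℝ (Fin n)}
    (hx : x ∈ D.M) (hx0 : x ≠ 0) {u : EuclideanSpace ℝ (Fin n) → ℝ} {l : ℝ} (hl : 0 < l)
    (hu : ∀ a, pd a u x = l * x a) :
    meanCurvature D.g u x
      = (∑ i, ∑ j, radialTensor 1 (-(‖x‖ ^ 2)⁻¹) x i j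
          * (pd i (pd j u) x - l * (1 : Matrix (Fin n) (Fin n) ℝ) i j))
          * (Real.sqrt (A (‖x‖ ^ 2)) / (b (‖x‖ ^ 2) * l * ‖x‖))
        + ((n : ℝ) - 1) * (b (‖x‖ ^ 2) + ‖x‖ ^ 2 * deriv b (‖x‖ ^ 2))
          / (Real.sqrt (A (‖x‖ ^ 2)) * b (‖x‖ ^ 2) * ‖x‖) := by
  obtain ⟨h1, h2⟩ := normSq_mem hx hx0
  have hb0 := h.pos_b _ h1 h2
  have hA0 := h.pos_A _ h1 h2
  obtain ⟨η, ζ, hΓ⟩ := h.christoffel_eq hx hx0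
  obtain ⟨hgrad, hP⟩ := h.inv_sub_unitNormal hx hx0 hl hu
  set α := (A (‖x‖ ^ 2) - b (‖x‖ ^ 2) - ‖x‖ ^ 2 * deriv b (‖x‖ ^ 2)) / (‖x‖ ^ 2 * A (‖x‖ ^ 2))
    with hα
  have hhess : ∀ i j, hessian D.g u i j x
      = (pd i (pd j u) x - l * (1 : Matrix (Fin n) (Fin n) ℝ) i j)
        + radialTensor (l - l * (‖x‖ ^ 2 * α)) (-(l * (2 * η + ‖x‖ ^ 2 * ζ))) x i j := by
    intro i j
    have : ∑ d, christoffel D.g d i j x * pd d u x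
        = l * radialTensor (‖x‖ ^ 2 * α) (2 * η + ‖x‖ ^ 2 * ζ) x i j := by
      rw [← sum_mul_radialChristoffel, Finset.mul_sum]
      exact Finset.sum_congr rfl fun d _ => by rw [hΓ, hu]; ring
    rw [hessian, this, radialTensor_apply, radialTensor_apply]; ring
  have hfac : ∀ i j, radialTensor (b (‖x‖ ^ 2))⁻¹ (-(b (‖x‖ ^ 2) * ‖x‖ ^ 2)⁻¹) x i j
      = (b (‖x‖ ^ 2))⁻¹ * radialTensor 1 (-(‖x‖ ^ 2)⁻¹) x i j := by
    intro i j
    rw [radialTensor_apply, radialTensor_apply, mul_inv]; ring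
  rw [meanCurvature, hgrad]
  simp only [hP, hhess, hfac, mul_assoc, ← Finset.mul_sum, mul_add, Finset.sum_add_distrib]
  rw [sum_radialTensor_mul_radialTensor, Fintype.card_fin, hα]
  have hxp : 0 < ‖x‖ := norm_pos_iff.2 hx0
  have hsA := Real.sqrt_pos.2 hA0
  have hsA2 := Real.sq_sqrt hA0.le
  generalize (∑ i, ∑ j, radialTensor 1 (-(‖x‖ ^ 2)⁻¹) x i j
          * (pd i (pd j u) x - l * (1 : Matrix (Fin n) (Fin n) ℝ) i j)) = Q
  generalize A (‖x‖ ^ 2) = a at *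
  generalize b (‖x‖ ^ 2) = q at *
  obtain ⟨w, hw, rfl⟩ : ∃ w, 0 < w ∧ a = w ^ 2 := ⟨Real.sqrt a, hsA, hsA2.symm⟩
  rw [Real.sqrt_sq hw.le]
  field_simp
  ring

end HasProfile

/-! ### The outermost point of a closed hypersurface -/

theorem isPreconnected_lt_norm (hn : 2 ≤ n) {r : ℝ} (hr : 0 ≤ r) :
    IsPreconnected {x : EuclideanSpace ℝ (Fin n) | r < ‖x‖} := by
  have hrank : 1 < Module.rank ℝ (EuclideanSpace ℝ (Fin n)) := by
    rw [← Module.finrank_eq_rank, finrank_euclideanSpace_fin]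
    exact_mod_cast hn
  have h1 : IsPreconnected (Ioi r ×ˢ Metric.sphere (0 : EuclideanSpace ℝ (Fin n)) 1) :=
    isPreconnected_Ioi.prod (isConnected_sphere hrank 0 zero_le_one).isPreconnected
  have h2 := h1.image (fun p : ℝ × EuclideanSpace ℝ (Fin n) => p.1 • p.2)
    (continuous_fst.smul continuous_snd).continuousOn
  convert h2 using 1
  ext x
  simp only [mem_ofPred_eq, mem_image, mem_prod, mem_Ioi, mem_sphere_iff_norm, sub_zero, Prod.exists]
  constructor
  · intro hx
    have : 0 < ‖x‖ := hr.trans_lt hx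
    exact ⟨‖x‖, ‖x‖⁻¹ • x, ⟨hx, by simp [norm_smul, this.ne']⟩, by
      rw [smul_smul, mul_inv_cancel₀ this.ne', one_smul]⟩
  · rintro ⟨t, y, ⟨ht, hy⟩, rfl⟩
    rw [norm_smul, hy, mul_one, Real.norm_eq_abs]
    exact ht.trans_le (le_abs_self t)

theorem pos_of_isPreconnected {X : Type*} [TopologicalSpace X] {s : Set X} (hs : IsPreconnected s)
    {f : X → ℝ} (hf : ContinuousOn f s) (h0 : ∀ x ∈ s, f x ≠ 0) {x y : X} (hx : x ∈ s) (hfx : 0 < f x)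
    (hy : y ∈ s) : 0 < f y := by
  by_contra hfy
  obtain ⟨z, hz, hz0⟩ := hs.intermediate_value hy hx hf
    (⟨not_lt.1 hfy, hfx.le⟩ : (0 : ℝ) ∈ Icc (f y) (f x))
  exact h0 z hz hz0

/-- p is a point of the hypersurface farthest from the origin. The exterior of its sphere is
connected, misses the hypersurface and contains points outside the bounded enclosed region, so u is
positive on all of it. If p were 0, then u would have a minimum there, contradicting regularity. -/
theorem _root_.SpacetimePenrose.ClosedHypersurface.exists_forall_norm_le (hn : 2 ≤ n)
    (S : ClosedHypersurface n) :
    ∃ p ∈ S.carrier, (∀ x ∈ S.carrier, ‖x‖ ≤ ‖p‖) ∧ p ≠ 0 ∧ (∀ x, ‖p‖ < ‖x‖ → 0 < S.u x) ∧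
      ∀ x, ‖p‖ ≤ ‖x‖ → 0 ≤ S.u x := by
  have hcont : Continuous S.u := S.smooth.continuous
  have hcl : IsClosed S.carrier := isClosed_eq hcont continuous_const
  have hcomp : IsCompact S.carrier :=
    S.isCompact_enclosed.of_isClosed_subset hcl fun x (hx : S.u x = 0) => hx.le
  obtain ⟨p, hp, hmax⟩ := hcomp.exists_isMaxOn S.nonempty continuous_norm.continuousOn
  have hpos : ∀ x, ‖p‖ < ‖x‖ → 0 < S.u x := by
    intro x hx
    obtain ⟨R, hR⟩ := S.isCompact_enclosed.isBounded.exists_norm_le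
    set e : EuclideanSpace ℝ (Fin n) := EuclideanSpace.single ⟨0, by omega⟩ (max R ‖p‖ + 1)
    have he : ‖e‖ = max R ‖p‖ + 1 := by
      rw [PiLp.norm_single, Real.norm_eq_abs, abs_of_pos]
      linarith [le_max_right R ‖p‖, norm_nonneg p]
    have hue : 0 < S.u e := by
      by_contra hcon
      have := hR e (not_lt.1 hcon)
      rw [he] at this
      linarith [le_max_left R ‖p‖]
    exact pos_of_isPreconnected (isPreconnected_lt_norm hn (norm_nonneg p)) hcont.continuousOn
      (fun y (hy : ‖p‖ < ‖y‖) h0 => absurd (hmax h0) (not_le.2 hy))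
      (x := e) (by show ‖p‖ < ‖e‖; rw [he]; linarith [le_max_right R ‖p‖]) hue hx
  have hp0 : p ≠ 0 := by
    rintro rfl
    refine S.regular 0 hp (IsLocalMin.fderiv_eq_zero (Eventually.of_forall fun x => ?_))
    rw [show S.u 0 = 0 from hp]
    rcases eq_or_ne x 0 with rfl | hx
    · exact (show S.u 0 = 0 from hp).ge
    · exact (hpos x (by simpa using hx)).le
  refine ⟨p, hp, fun x hx => hmax hx, hp0, hpos, fun x hx => ?_⟩
  have hx0 : x ≠ 0 := by
    rw [← norm_pos_iff]; exact (norm_pos_iff.2 hp0).trans_le hx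
  refine ge_of_tendsto ((hcont.tendsto x).comp (tendsto_smul_nhdsGT x)) ?_
  filter_upwards [self_mem_nhdsWithin] with t ht
  exact (hpos _ (lt_norm_smul hx hx0 ht)).le

theorem hasDerivAt_comp_curve {u : EuclideanSpace ℝ (Fin n) → ℝ}
    {γ : ℝ → EuclideanSpace ℝ (Fin n)} {γ' : EuclideanSpace ℝ (Fin n)} {t : ℝ}
    (hu : DifferentiableAt ℝ u (γ t)) (hγ : HasDerivAt γ γ' t) :
    HasDerivAt (fun s => u (γ s)) (∑ a, pd a u (γ t) * γ' a) t := by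
  rw [← fderiv_apply_eq_sum]
  exact hu.hasFDerivAt.comp_hasDerivAt t hγ

/-- A negative second derivative would make 0 a local maximum as well. Then f would be locally
constant and its second derivative zero. -/
theorem second_deriv_nonneg_of_isLocalMin {f f' : ℝ → ℝ} {d : ℝ} (hmin : IsLocalMin f 0)
    (hf : ∀ t, HasDerivAt f (f' t) t) (hd : HasDerivAt f' d 0) : 0 ≤ d := by
  by_contra hneg
  have hf' : deriv f = f' := funext fun t => (hf t).deriv
  have h0 : deriv f 0 = 0 := hmin.deriv_eq_zero
  have hmax : IsLocalMax f 0 := by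
    refine isLocalMax_of_deriv_deriv_neg ?_ h0 (hf 0).continuousAt
    rw [hf', hd.deriv]; exact not_le.1 hneg
  have hconst : f =ᶠ[𝓝 0] fun _ => f 0 := by
    filter_upwards [hmin, hmax] with t h1 h2 using le_antisymm h2 h1
  have h2 : deriv f =ᶠ[𝓝 0] fun _ => 0 := by
    filter_upwards [hconst.eventuallyEq_nhds] with t ht
    rw [ht.deriv_eq, deriv_const]
  have h3 : d = 0 := by
    rw [← hd.deriv, ← hf', h2.deriv_eq, deriv_const]
  exact hneg h3.ge

/-- At a point of maximal norm, the gradient of the defining function is radial and its Hessian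
dominates the one of the defining function of the sphere in tangential directions. -/
theorem _root_.SpacetimePenrose.ClosedHypersurface.touching (S : ClosedHypersurface n)
    {p : EuclideanSpace ℝ (Fin n)} (hp : S.u p = 0) (hp0 : p ≠ 0)
    (hge : ∀ x, ‖p‖ ≤ ‖x‖ → 0 ≤ S.u x) :
    ∃ l, 0 < l ∧ (∀ a, pd a S.u p = l * p a) ∧
      0 ≤ ∑ i, ∑ j, radialTensor 1 (-(‖p‖ ^ 2)⁻¹) p i j
          * (pd i (pd j S.u) p - l * (1 : Matrix (Fin n) (Fin n) ℝ) i j) := by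
  have hR : 0 < ‖p‖ := norm_pos_iff.2 hp0
  have hdiff : ∀ x, DifferentiableAt ℝ S.u x := fun x =>
    S.smooth.contDiffAt.differentiableAt (by simp)
  set l : ℝ := (∑ a, pd a S.u p * p a) / ‖p‖ ^ 2 with hl
  -- The vᵢ are the projections of the coordinate vectors to the orthogonal complement of p.
  set v : Fin n → EuclideanSpace ℝ (Fin n) := fun i =>
    EuclideanSpace.single i 1 - (p i / ‖p‖ ^ 2) • p with hv
  have hva : ∀ i a, v i a = radialTensor 1 (-(‖p‖ ^ 2)⁻¹) p i a := by
    intro i a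
    simp [hv, radialTensor_apply, Matrix.one_apply, Pi.single_apply, eq_comm]
    ring
  have hvp : ∀ i, ∑ a, v i a * p a = 0 := by
    intro i
    simp only [hva, sum_radialTensor_mul_self]
    field_simp; ring
  -- The quadratic term bends the tangent line just enough that |γ(t)|² = |p|² (1 + (t² q/2)²) with
  -- q = |vᵢ|²/|p|². The curve therefore stays outside the ball, and u ∘ γ has a minimum at t = 0.
  -- Its first derivative shows that the gradient is radial, its second that Hess u(vᵢ,vᵢ) ≥ l
  -- |vᵢ|².
  set γ : Fin n → ℝ → EuclideanSpace ℝ (Fin n) := fun i t =>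
    p + t • v i - (t ^ 2 / 2 * (‖v i‖ ^ 2 / ‖p‖ ^ 2)) • p with hγ
  have hγd : ∀ i t, HasDerivAt (γ i) (v i - (t * (‖v i‖ ^ 2 / ‖p‖ ^ 2)) • p) t := by
    intro i t
    have h1 := (((hasDerivAt_id t).smul_const (v i)).const_add p).sub
      (((((hasDerivAt_id t).pow 2).div_const 2).mul_const
        (‖v i‖ ^ 2 / ‖p‖ ^ 2)).smul_const p)
    refine h1.congr_deriv ?_
    simp
  have hγn : ∀ i t, ‖p‖ ≤ ‖γ i t‖ := by
    intro i t
    refine le_of_sq_le_sq ?_ (norm_nonneg _)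
    set q := ‖v i‖ ^ 2 / ‖p‖ ^ 2 with hq
    have e : ‖γ i t‖ ^ 2 = ‖p‖ ^ 2 + ‖p‖ ^ 2 * (t ^ 2 / 2 * q) ^ 2 := by
      rw [← sum_mul_self]
      have e1 : ∀ a, γ i t a * γ i t a = (1 - t ^ 2 / 2 * q) ^ 2 * (p a * p a)
          + t ^ 2 * (v i a * v i a) + 2 * t * (1 - t ^ 2 / 2 * q) * (v i a * p a) := by
        intro a
        simp only [hγ, PiLp.add_apply, PiLp.sub_apply, PiLp.smul_apply, smul_eq_mul, ← hq]
        ring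
      simp only [e1, Finset.sum_add_distrib, ← Finset.mul_sum, sum_mul_self, hvp]
      have : ‖v i‖ ^ 2 = q * ‖p‖ ^ 2 := by rw [hq]; field_simp
      rw [this]; ring
    rw [e]; linarith [mul_nonneg (sq_nonneg ‖p‖) (sq_nonneg (t ^ 2 / 2 * q))]
  have hγ0 : ∀ i, γ i 0 = p := fun i => by simp [hγ]
  have hmin : ∀ i, IsLocalMin (fun t => S.u (γ i t)) 0 := fun i =>
    Eventually.of_forall fun t => by
      dsimp only; rw [hγ0, hp]; exact hge _ (hγn i t)
  have hf := fun i t => hasDerivAt_comp_curve (hdiff (γ i t)) (hγd i t)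
  have hgrad : ∀ a, pd a S.u p = l * p a := by
    intro i
    have h1 := (hmin i).hasDerivAt_eq_zero (hf i 0)
    simp only [hγ0, zero_mul, zero_smul, sub_zero] at h1
    have h2 : ∑ a, pd a S.u p * v i a = pd i S.u p - p i / ‖p‖ ^ 2 * ∑ a, pd a S.u p * p a := by
      have e : ∀ a, pd a S.u p * v i a = (1 : Matrix (Fin n) (Fin n) ℝ) i a * pd a S.u p
          - p i / ‖p‖ ^ 2 * (pd a S.u p * p a) := by
        intro a
        rw [hva, radialTensor_apply]; ring
      simp only [e, Finset.sum_sub_distrib, ← Finset.mul_sum, sum_one_mul]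
    rw [h2] at h1
    rw [hl]; linear_combination h1
  have hl0 : 0 ≤ l := by
    have hray : HasDerivAt (fun t : ℝ => (1 + t) • p) p 0 := by
      simpa using ((hasDerivAt_id (0 : ℝ)).const_add 1).smul_const p
    have h1 := hasDerivAt_comp_curve (u := S.u) (hdiff _) hray
    simp only [add_zero, one_smul] at h1
    have h2 := h1.tendsto_slope_zero_right
    refine div_nonneg (ge_of_tendsto h2 ?_) (sq_nonneg _)
    filter_upwards [self_mem_nhdsWithin] with t ht
    have ht' : (0 : ℝ) < t := ht
    simp only [zero_add, add_zero, one_smul, hp, sub_zero, smul_eq_mul]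
    refine mul_nonneg (inv_nonneg.2 ht'.le) (hge _ ?_)
    exact (lt_norm_smul le_rfl hp0 (by linarith)).le
  have hlpos : 0 < l := by
    refine lt_of_le_of_ne hl0 fun h0 => S.regular p hp ?_
    ext w
    rw [fderiv_apply_eq_sum]
    simp [hgrad, ← h0]
  refine ⟨l, hlpos, hgrad, ?_⟩
  have hsecond : ∀ i, 0 ≤ (∑ a, ∑ d, pd d (pd a S.u) p * v i d * v i a) - l * ‖v i‖ ^ 2 := by
    intro i
    have hterm : ∀ a, HasDerivAt (fun t => pd a S.u (γ i t) * (v i - (t * (‖v i‖ ^ 2 / ‖p‖ ^ 2)) • p) a)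
        ((∑ d, pd d (pd a S.u) p * v i d) * v i a
          - pd a S.u p * (‖v i‖ ^ 2 / ‖p‖ ^ 2 * p a)) 0 := by
      intro a
      have h1 := hasDerivAt_comp_curve (u := pd a S.u)
        ((S.smooth.contDiffAt.pd a).differentiableAt (by simp)) (hγd i 0)
      have h2 : HasDerivAt (fun t : ℝ => (v i - (t * (‖v i‖ ^ 2 / ‖p‖ ^ 2)) • p) a)
          (-(‖v i‖ ^ 2 / ‖p‖ ^ 2 * p a)) 0 := by
        have := (((hasDerivAt_id (0 : ℝ)).mul_const (‖v i‖ ^ 2 / ‖p‖ ^ 2)).mul_const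
          (p a)).const_sub (v i a)
        simpa using this
      refine (h1.mul h2).congr_deriv ?_
      simp [hγ0]
      ring
    have hsum : HasDerivAt (fun t => ∑ a, pd a S.u (γ i t)
        * (v i - (t * (‖v i‖ ^ 2 / ‖p‖ ^ 2)) • p) a) _ 0 := HasDerivAt.fun_sum fun a _ => hterm a
    have h3 := second_deriv_nonneg_of_isLocalMin (hmin i) (hf i) hsum
    refine h3.trans_eq ?_
    rw [Finset.sum_sub_distrib]
    have e1 : ∑ a, pd a S.u p * (‖v i‖ ^ 2 / ‖p‖ ^ 2 * p a) = l * ‖v i‖ ^ 2 := by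
      have : ∀ a, pd a S.u p * (‖v i‖ ^ 2 / ‖p‖ ^ 2 * p a)
          = l * (‖v i‖ ^ 2 / ‖p‖ ^ 2) * (p a * p a) := fun a => by rw [hgrad]; ring
      simp only [this, ← Finset.mul_sum, sum_mul_self]
      field_simp
    rw [e1]
    simp only [Finset.sum_mul]
  have htotal := Finset.sum_nonneg fun i (_ : i ∈ Finset.univ) => hsecond i
  refine htotal.trans_eq ?_
  -- Σᵢ vᵢ vᵢᵀ is the tangential projection itself, being the square of a projection. Summing the
  -- second-order inequalities over i therefore gives the projected trace.
  have hPP : ∀ a d, ∑ i, v i d * v i a = radialTensor 1 (-(‖p‖ ^ 2)⁻¹) p d a := by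
    intro a d
    have e : ∑ i, v i d * v i a = (radialTensor 1 (-(‖p‖ ^ 2)⁻¹) p
        * radialTensor 1 (-(‖p‖ ^ 2)⁻¹) p) d a := by
      rw [Matrix.mul_apply]
      refine Finset.sum_congr rfl fun i _ => ?_
      rw [hva, hva, radialTensor_apply, radialTensor_apply _ _ _ d i, one_comm_apply i d,
        radialTensor_apply]
      ring
    rw [e, radialTensor_mul]
    congr 1
    · ring
    · field_simp; ring
  have hi : ∀ i, (∑ a, ∑ d, pd d (pd a S.u) p * v i d * v i a) - l * ‖v i‖ ^ 2
      = ∑ d, ∑ a, v i d * v i a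
        * (pd d (pd a S.u) p - l * (1 : Matrix (Fin n) (Fin n) ℝ) d a) := by
    intro i
    rw [Finset.sum_comm, ← sum_mul_self, Finset.mul_sum, ← Finset.sum_sub_distrib]
    refine Finset.sum_congr rfl fun d _ => ?_
    rw [← sum_one_mul d fun a => v i a * v i d, Finset.mul_sum, ← Finset.sum_sub_distrib]
    exact Finset.sum_congr rfl fun a _ => by ring
  simp only [hi, ← hPP, Finset.sum_mul]
  rw [Finset.sum_comm]
  exact Finset.sum_congr rfl fun d _ => Finset.sum_comm

end InitialDataSet
end SpacetimePenrose
end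

noncomputable section
namespace SpacetimePenrose

/-! ### Coordinate spheres as closed hypersurfaces -/

variable {n : ℕ}

/-- The coordinate sphere of radius `R`. -/
def sphereHypersurface (hn : 2 ≤ n) {R : ℝ} (hR : 0 < R) : ClosedHypersurface n where
  u x := ‖x‖ ^ 2 - R ^ 2
  smooth := (contDiff_norm_sq ℝ).sub contDiff_const
  regular x hx h0 := by
    have h1 := (HasGrad.normSq (x := x)).sub (HasGrad.const (R ^ 2))
    have h2 : fderiv ℝ (fun y : EuclideanSpace ℝ (Fin n) => ‖y‖ ^ 2 - R ^ 2) x x = 2 * ‖x‖ ^ 2 := by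
      rw [fderiv_apply_eq_sum, ← sum_mul_self, Finset.mul_sum]
      exact Finset.sum_congr rfl fun i _ => by rw [h1.2]; ring
    rw [h0] at h2
    have : 0 < R ^ 2 := by positivity
    simp only [zero_apply] at h2
    linarith
  nonempty := ⟨EuclideanSpace.single ⟨0, by omega⟩ R, by
    rw [PiLp.norm_single, Real.norm_eq_abs, sq_abs, sub_self]⟩
  isCompact_enclosed := by
    have e : {x : EuclideanSpace ℝ (Fin n) | ‖x‖ ^ 2 - R ^ 2 ≤ 0} = Metric.closedBall 0 R := by
      ext x
      simp only [mem_ofPred_eq, Metric.mem_closedBall, dist_zero_right, sub_nonpos]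
      exact sq_le_sq₀ (norm_nonneg x) hR.le
    rw [e]
    exact isCompact_closedBall _ _
  isConnected_outside := by
    have e : {x : EuclideanSpace ℝ (Fin n) | 0 < ‖x‖ ^ 2 - R ^ 2} = {x | R < ‖x‖} := by
      ext x
      simp only [mem_ofPred_eq, sub_pos]
      exact sq_lt_sq₀ hR.le (norm_nonneg x)
    rw [e]
    refine ⟨⟨EuclideanSpace.single ⟨0, by omega⟩ (R + 1), ?_⟩,
      InitialDataSet.isPreconnected_lt_norm hn hR.le⟩
    rw [mem_ofPred_eq, PiLp.norm_single, Real.norm_eq_abs, abs_of_pos (by linarith)]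
    linarith

theorem sphereHypersurface_carrier (hn : 2 ≤ n) {R : ℝ} (hR : 0 < R) :
    (sphereHypersurface hn hR).carrier = Metric.sphere 0 R := by
  ext x
  simp only [ClosedHypersurface.carrier, sphereHypersurface, mem_ofPred_eq, mem_sphere_iff_norm,
    sub_zero, sub_eq_zero]
  exact sq_eq_sq₀ (norm_nonneg x) hR.le

theorem sphereHypersurface_enclosed (hn : 2 ≤ n) {R : ℝ} (hR : 0 < R) :
    (sphereHypersurface hn hR).enclosed = Metric.closedBall 0 R := by
  ext x
  simp only [ClosedHypersurface.enclosed, sphereHypersurface, mem_ofPred_eq,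
    Metric.mem_closedBall, dist_zero_right, sub_nonpos]
  exact sq_le_sq₀ (norm_nonneg x) hR.le

theorem sphereHypersurface_pd (hn : 2 ≤ n) {R : ℝ} (hR : 0 < R) (a : Fin n) :
    pd a (sphereHypersurface hn hR).u = fun x => 2 * x a := by
  funext x
  have h1 := (HasGrad.normSq (x := x)).sub (HasGrad.const (R ^ 2))
  exact (h1.2 a).trans (by ring)

theorem sphereHypersurface_pd_pd (hn : 2 ≤ n) {R : ℝ} (hR : 0 < R) (a b : Fin n)
    (x : EuclideanSpace ℝ (Fin n)) :
    pd a (pd b (sphereHypersurface hn hR).u) x = 2 * (1 : Matrix (Fin n) (Fin n) ℝ) a b := by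
  rw [sphereHypersurface_pd]
  exact ((HasGrad.coord b).const_mul 2).2 a

/-! ### The outermost apparent horizon is a coordinate sphere -/

namespace InitialDataSet

variable {D : InitialDataSet n} {A b K c : ℝ → ℝ}

/-- The future null expansion of the coordinate spheres, up to a positive factor. -/
def profileThetaPlus (A b c : ℝ → ℝ) (s : ℝ) : ℝ := b s + s * deriv b s + c s * Real.sqrt (s * A s)

/-- The past null expansion of the coordinate spheres, up to a positive factor. -/
def profileThetaMinus (A b c : ℝ → ℝ) (s : ℝ) : ℝ := b s + s * deriv b s - c s * Real.sqrt (s * A s)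

namespace HasProfile

/-- The tangential trace of k depends on S only through its tangent plane. Hence S and the
coordinate sphere through x differ in their expansions only by the excess of the Hessian, which has
a sign when S touches the sphere from inside. -/
theorem theta_eq (h : D.HasProfile A b K c) {x : EuclideanSpace ℝ (Fin n)}
    (hx : x ∈ D.M) (hx0 : x ≠ 0) {S : ClosedHypersurface n} {l : ℝ} (hl : 0 < l)
    (hu : ∀ a, pd a S.u x = l * x a) :
    D.thetaPlus S x
      = (∑ i, ∑ j, radialTensor 1 (-(‖x‖ ^ 2)⁻¹) x i j
          * (pd i (pd j S.u) x - l * (1 : Matrix (Fin n) (Fin n) ℝ) i j))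
          * (Real.sqrt (A (‖x‖ ^ 2)) / (b (‖x‖ ^ 2) * l * ‖x‖))
        + ((n : ℝ) - 1) / (Real.sqrt (A (‖x‖ ^ 2)) * b (‖x‖ ^ 2) * ‖x‖)
          * profileThetaPlus A b c (‖x‖ ^ 2) ∧
    D.thetaMinus S x
      = (∑ i, ∑ j, radialTensor 1 (-(‖x‖ ^ 2)⁻¹) x i j
          * (pd i (pd j S.u) x - l * (1 : Matrix (Fin n) (Fin n) ℝ) i j))
          * (Real.sqrt (A (‖x‖ ^ 2)) / (b (‖x‖ ^ 2) * l * ‖x‖))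
        + ((n : ℝ) - 1) / (Real.sqrt (A (‖x‖ ^ 2)) * b (‖x‖ ^ 2) * ‖x‖)
          * profileThetaMinus A b c (‖x‖ ^ 2) := by
  obtain ⟨h1, h2⟩ := normSq_mem hx hx0
  have hb0 := h.pos_b _ h1 h2
  have hsA := Real.sqrt_pos.2 (h.pos_A _ h1 h2)
  have hxp : 0 < ‖x‖ := norm_pos_iff.2 hx0
  have hr : Real.sqrt (‖x‖ ^ 2 * A (‖x‖ ^ 2)) = ‖x‖ * Real.sqrt (A (‖x‖ ^ 2)) := by
    rw [Real.sqrt_mul h1.le, Real.sqrt_sq hxp.le]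
  have hbs := hb0.ne'
  have hAs := hsA.ne'
  constructor
  · rw [thetaPlus, h.meanCurvature_eq hx hx0 hl hu, h.tangentialTrace_eq hx hx0 hl hu,
      profileThetaPlus, hr]
    generalize Real.sqrt (A (‖x‖ ^ 2)) = a at *
    generalize b (‖x‖ ^ 2) = q at *
    field_simp
    ring
  · rw [thetaMinus, h.meanCurvature_eq hx hx0 hl hu, h.tangentialTrace_eq hx hx0 hl hu,
      profileThetaMinus, hr]
    generalize Real.sqrt (A (‖x‖ ^ 2)) = a at *
    generalize b (‖x‖ ^ 2) = q at *
    field_simp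
    ring

theorem theta_coeff_pos (h : D.HasProfile A b K c) (hn : 2 ≤ n) {x : EuclideanSpace ℝ (Fin n)}
    (hx : x ∈ D.M) (hx0 : x ≠ 0) :
    0 < ((n : ℝ) - 1) / (Real.sqrt (A (‖x‖ ^ 2)) * b (‖x‖ ^ 2) * ‖x‖) := by
  obtain ⟨h1, h2⟩ := normSq_mem hx hx0
  have hb0 := h.pos_b _ h1 h2
  have hsA := Real.sqrt_pos.2 (h.pos_A _ h1 h2)
  have hxp : 0 < ‖x‖ := norm_pos_iff.2 hx0
  have : (2 : ℝ) ≤ n := by exact_mod_cast hn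
  exact div_pos (by linarith) (by positivity)

theorem isApparentHorizon_sphere (h : D.HasProfile A b K c) (hn : 2 ≤ n) {R : ℝ} (hR : 0 < R)
    (hR' : D.r₀ ≤ R) (h0 : profileThetaPlus A b c (R ^ 2) = 0 ∨
      profileThetaMinus A b c (R ^ 2) = 0) :
    D.IsApparentHorizon (sphereHypersurface hn hR) := by
  have hmem : ∀ x ∈ (sphereHypersurface hn hR).carrier, ‖x‖ = R := fun x hx => by
    simpa [sphereHypersurface_carrier] using hx
  have hM : ∀ x ∈ (sphereHypersurface hn hR).carrier, x ∈ D.M := fun x hx => by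
    show D.r₀ ≤ ‖x‖; rwa [hmem x hx]
  have hne : ∀ x ∈ (sphereHypersurface hn hR).carrier, x ≠ 0 := fun x hx => by
    rw [← norm_pos_iff, hmem x hx]; exact hR
  have key := fun x hx => h.theta_eq (hM x hx) (hne x hx) two_pos
    (fun a => congrFun (sphereHypersurface_pd hn hR a) x)
  simp only [sphereHypersurface_pd_pd, sub_self, mul_zero, Finset.sum_const_zero, zero_mul,
    zero_add] at key
  refine ⟨hM, h0.imp (fun h0 x hx => ?_) fun h0 x hx => ?_⟩
  · rw [(key x hx).1, hmem x hx, h0, mul_zero]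
  · rw [(key x hx).2, hmem x hx, h0, mul_zero]

theorem continuousAt_theta (h : D.HasProfile A b K c) {s : ℝ} (hs : 0 < s) (hs' : D.r₀ ^ 2 ≤ s) :
    ContinuousAt (profileThetaPlus A b c) s ∧ ContinuousAt (profileThetaMinus A b c) s := by
  have hA := (h.smooth_A s hs hs').continuousAt
  have hb := (h.smooth_b s hs hs').continuousAt
  have hb' := (h.smooth_b s hs hs').deriv_infty.continuousAt
  have hc := (h.smooth_c s hs hs').continuousAt
  have h1 : ContinuousAt (fun s => b s + s * deriv b s) s := hb.add (continuousAt_id.mul hb')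
  have h2 : ContinuousAt (fun s => c s * Real.sqrt (s * A s)) s :=
    hc.mul (Real.continuous_sqrt.continuousAt.comp (continuousAt_id.mul hA))
  exact ⟨h1.add h2, h1.sub h2⟩

/-- The decay of the radial coefficient functions of asymptotically flat data. -/
theorem exists_decay (h : D.HasProfile A b K c) (hn : 3 ≤ n) (haf : D.IsAsymptoticallyFlat) :
    ∃ C s₀ : ℝ, 0 < C ∧ 0 < s₀ ∧ D.r₀ ^ 2 ≤ s₀ ∧ ∀ s, s₀ < s →
      |A s - 1| ≤ C / Real.sqrt s ^ (n - 2) ∧ |b s - 1| ≤ C / Real.sqrt s ^ (n - 2) ∧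
      |s * deriv b s| ≤ C / Real.sqrt s ^ (n - 2) ∧
      |c s * Real.sqrt s| ≤ C / Real.sqrt s ^ (n - 2) := by
  obtain ⟨ρ₀, C, hρ, hr, hx⟩ := haf
  refine ⟨max C 1, ρ₀ ^ 2, by positivity, by positivity, pow_le_pow_left₀ D.r₀_nonneg hr 2,
    fun s hs => ?_⟩
  have hs0 : 0 < s := (by positivity : (0 : ℝ) < ρ₀ ^ 2).trans hs
  have hq : 0 < Real.sqrt s := Real.sqrt_pos.2 hs0
  have hq2 := Real.sq_sqrt hs0.le
  have hC : C ≤ max C 1 := le_max_left _ _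
  set i0 : Fin n := ⟨0, by omega⟩
  set i1 : Fin n := ⟨1, by omega⟩
  have h01 : i1 ≠ i0 := by simp [i0, i1]
  set x : EuclideanSpace ℝ (Fin n) := EuclideanSpace.single i0 (Real.sqrt s) with hxd
  have hxn : ‖x‖ = Real.sqrt s := by
    rw [hxd, PiLp.norm_single, Real.norm_eq_abs, abs_of_pos hq]
  have hx0 : x i0 = Real.sqrt s := by simp [hxd]
  have hx1 : x i1 = 0 := by simp [hxd, h01]
  have hxρ : ρ₀ < ‖x‖ := by rw [hxn]; exact Real.lt_sqrt_of_sq_lt hs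
  have hxM : D.r₀ < ‖x‖ := hr.trans_lt hxρ
  obtain ⟨e1, e2, -, e4, -, -, -⟩ := hx x hxρ
  have hg := h.g_eq x hxM.le (ne_zero_of_lt_norm hxM)
  have hk := h.k_eq x hxM.le (ne_zero_of_lt_norm hxM)
  have hpd := h.pd_g hxM.le (ne_zero_of_lt_norm hxM) i0 i1 i1
  rw [hxn, hq2] at hg hk hpd
  -- At x = √s e₀ the components g₀₀, g₁₁, k₁₁ are A, b, c, and ∂₀ g₁₁ equals 2 √s b'. So s b' is
  -- √s/2 times a first derivative of g.
  have f1 := e1 i0 i0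
  have f2 := e1 i1 i1
  have f3 := e2 i1 i1 i0
  have f4 := e4 i1 i1
  rw [hg, hxn, radialTensor_apply, hx0, Matrix.one_apply_eq, ← sq, hq2] at f1
  rw [hg, hxn, radialTensor_apply, hx1, Matrix.one_apply_eq] at f2
  rw [hpd, hxn, hx0, hx1, Matrix.one_apply_eq] at f3
  rw [hk, hxn, radialTensor_apply, hx1, Matrix.one_apply_eq] at f4
  have hpow : Real.sqrt s ^ (n - 1) = Real.sqrt s ^ (n - 2) * Real.sqrt s := by
    rw [← pow_succ]; congr 1; omega
  have hP : 0 < Real.sqrt s ^ (n - 2) := by positivity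
  have hmono : C / Real.sqrt s ^ (n - 2) ≤ max C 1 / Real.sqrt s ^ (n - 2) := by gcongr
  have e : b s * 1 + (A s - b s) / s * s - 1 = A s - 1 := by field_simp; ring
  rw [e] at f1
  simp only [mul_one, mul_zero, add_zero] at f2 f3 f4
  refine ⟨f1.trans hmono, f2.trans hmono, ?_, ?_⟩
  · have e : s * deriv b s = (2 * deriv b s * Real.sqrt s) * (Real.sqrt s / 2) := by
      linear_combination (-deriv b s) * hq2
    rw [e, abs_mul, abs_of_pos (by positivity : 0 < Real.sqrt s / 2)]
    have f3' := mul_le_mul_of_nonneg_right f3 (by positivity : 0 ≤ Real.sqrt s / 2)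
    have hC0 : 0 ≤ C / Real.sqrt s ^ (n - 2) := (abs_nonneg _).trans f2
    have e5 : C / Real.sqrt s ^ (n - 1) * (Real.sqrt s / 2) = C / Real.sqrt s ^ (n - 2) / 2 := by
      rw [hpow]; field_simp
    rw [e5] at f3'
    linarith
  · rw [abs_mul, abs_of_pos hq]
    have f4' := mul_le_mul_of_nonneg_right f4 hq.le
    have e5 : C / Real.sqrt s ^ (n - 1) * Real.sqrt s = C / Real.sqrt s ^ (n - 2) := by
      rw [hpow]; field_simp
    rw [e5] at f4'
    exact f4'.trans hmono

theorem tendsto_decay (hn : 3 ≤ n) (C : ℝ) :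
    Tendsto (fun s : ℝ => C / Real.sqrt s ^ (n - 2)) atTop (𝓝 0) :=
  tendsto_const_nhds.div_atTop ((tendsto_pow_atTop (by omega)).comp Real.tendsto_sqrt_atTop)

theorem tendsto_profile (h : D.HasProfile A b K c) (hn : 3 ≤ n) (haf : D.IsAsymptoticallyFlat) :
    Tendsto A atTop (𝓝 1) ∧ Tendsto b atTop (𝓝 1) ∧
      Tendsto (fun s => s * deriv b s) atTop (𝓝 0) ∧
      Tendsto (fun s => c s * Real.sqrt s) atTop (𝓝 0) := by
  obtain ⟨C, s₀, hC, hs₀, hr, hd⟩ := h.exists_decay hn haf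
  have key : ∀ (f : ℝ → ℝ) (a : ℝ), (∀ s, s₀ < s → |f s - a| ≤ C / Real.sqrt s ^ (n - 2)) →
      Tendsto f atTop (𝓝 a) := by
    intro f a hf
    rw [tendsto_iff_norm_sub_tendsto_zero]
    refine squeeze_zero' (Eventually.of_forall fun s => norm_nonneg _) ?_ (tendsto_decay hn C)
    filter_upwards [eventually_gt_atTop s₀] with s hs using hf s hs
  exact ⟨key _ _ fun s hs => (hd s hs).1, key _ _ fun s hs => (hd s hs).2.1,
    key _ _ fun s hs => by rw [sub_zero]; exact (hd s hs).2.2.1,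
    key _ _ fun s hs => by rw [sub_zero]; exact (hd s hs).2.2.2⟩

theorem tendsto_theta (h : D.HasProfile A b K c) (hn : 3 ≤ n) (haf : D.IsAsymptoticallyFlat) :
    Tendsto (profileThetaPlus A b c) atTop (𝓝 1) ∧
      Tendsto (profileThetaMinus A b c) atTop (𝓝 1) := by
  obtain ⟨hA, hb, hb', hc⟩ := h.tendsto_profile hn haf
  have h1 : Tendsto (fun s => b s + s * deriv b s) atTop (𝓝 1) := by
    simpa using hb.add hb'
  have h2 : Tendsto (fun s => c s * Real.sqrt (s * A s)) atTop (𝓝 0) := by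
    have h3 := hc.mul ((Real.continuous_sqrt.tendsto 1).comp hA)
    rw [zero_mul] at h3
    refine h3.congr' ?_
    filter_upwards [eventually_ge_atTop 0] with s hs
    rw [Real.sqrt_mul hs]; simp only [Function.comp]; ring
  have hp := h1.add h2
  have hm := h1.sub h2
  rw [add_zero] at hp
  rw [sub_zero] at hm
  exact ⟨hp, hm⟩

/-- An outermost apparent horizon is a coordinate sphere, outside of which the null expansions of
the coordinate spheres are positive. -/
theorem outermost (h : D.HasProfile A b K c) (hn : 3 ≤ n) (haf : D.IsAsymptoticallyFlat)
    {S : ClosedHypersurface n} (hS : D.IsOutermostApparentHorizon S) :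
    ∃ R, 0 < R ∧ D.r₀ ≤ R ∧ S.carrier = Metric.sphere 0 R ∧ S.outside = {x | R < ‖x‖} ∧
      (profileThetaPlus A b c (R ^ 2) = 0 ∨ profileThetaMinus A b c (R ^ 2) = 0) ∧
      ∀ s, R ^ 2 < s → 0 < profileThetaPlus A b c s ∧ 0 < profileThetaMinus A b c s := by
  have hn2 : 2 ≤ n := by omega
  obtain ⟨⟨hSM, hSθ⟩, hout⟩ := hS
  obtain ⟨p, hp, hmax, hp0, hpos, hge⟩ := S.exists_forall_norm_le hn2
  obtain ⟨l, hl, hgrad, hQ⟩ := S.touching hp hp0 hge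
  have hpM := hSM hp
  obtain ⟨hs0, hsr⟩ := normSq_mem hpM hp0
  have hθ := h.theta_eq hpM hp0 hl hgrad
  have hcoef := h.theta_coeff_pos hn2 hpM hp0
  have hQ' : 0 ≤ Real.sqrt (A (‖p‖ ^ 2)) / (b (‖p‖ ^ 2) * l * ‖p‖) := by
    have := h.pos_b _ hs0 hsr
    positivity
  have hQ2 := mul_nonneg hQ hQ'
  obtain ⟨tp, tm⟩ := h.tendsto_theta hn haf
  -- At p the excess of the Hessian is nonnegative while the expansion of S vanishes, so the
  -- corresponding expansion of the sphere through p is nonpositive. It tends to 1 at infinity and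
  -- must vanish somewhere in between.
  have hzero : ∃ s, ‖p‖ ^ 2 ≤ s ∧ (profileThetaPlus A b c s = 0 ∨ profileThetaMinus A b c s = 0) := by
    have key : ∀ f : ℝ → ℝ, (∀ s, ‖p‖ ^ 2 ≤ s → ContinuousAt f s) → Tendsto f atTop (𝓝 1) →
        f (‖p‖ ^ 2) ≤ 0 → ∃ s, ‖p‖ ^ 2 ≤ s ∧ f s = 0 := by
      intro f hf ht hle
      obtain ⟨s, hs1, hs2⟩ := ((ht.eventually (lt_mem_nhds one_pos)).and
        (eventually_ge_atTop (‖p‖ ^ 2))).exists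
      obtain ⟨z, hz, hz0⟩ := intermediate_value_Icc hs2
        (fun t ht => (hf t ht.1).continuousWithinAt) (⟨hle, hs1.le⟩ : (0 : ℝ) ∈ Icc _ _)
      exact ⟨z, hz.1, hz0⟩
    have hcont := fun s (hs : ‖p‖ ^ 2 ≤ s) =>
      h.continuousAt_theta (hs0.trans_le hs) (hsr.trans hs)
    rcases hSθ with h0 | h0
    · have h1 := h0 p hp
      rw [hθ.1] at h1
      obtain ⟨s, hs, hs'⟩ := key _ (fun s hs => (hcont s hs).1) tp
        (nonpos_of_mul_nonpos_right (by linarith) hcoef)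
      exact ⟨s, hs, Or.inl hs'⟩
    · have h1 := h0 p hp
      rw [hθ.2] at h1
      obtain ⟨s, hs, hs'⟩ := key _ (fun s hs => (hcont s hs).2) tm
        (nonpos_of_mul_nonpos_right (by linarith) hcoef)
      exact ⟨s, hs, Or.inr hs'⟩
  -- Any marginal sphere of radius at least |p| encloses S and is an apparent horizon, so it
  -- coincides with S because S is outermost. This identifies S and also excludes further zeros
  -- beyond R.
  have hencl : ∀ {r : ℝ} (hr : 0 < r), ‖p‖ ≤ r → (profileThetaPlus A b c (r ^ 2) = 0 ∨
      profileThetaMinus A b c (r ^ 2) = 0) → S.carrier = Metric.sphere 0 r := by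
    intro r hr hpr h0
    rw [← sphereHypersurface_carrier hn2 hr]
    refine (hout _ (h.isApparentHorizon_sphere hn2 hr (le_trans hpM hpr) h0) ?_).symm
    rw [sphereHypersurface_enclosed]
    intro x hx
    simpa using (hmax x hx).trans hpr
  obtain ⟨s, hs, hs'⟩ := hzero
  have hss : 0 < s := hs0.trans_le hs
  set R := Real.sqrt s with hR
  have hRs : R ^ 2 = s := Real.sq_sqrt hss.le
  have hRp : 0 < R := Real.sqrt_pos.2 hss
  have hpR : ‖p‖ ≤ R := Real.le_sqrt_of_sq_le hs
  rw [← hRs] at hs'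
  have hcar := hencl hRp hpR hs'
  have hpR' : ‖p‖ = R := by simpa [hcar] using hp
  have hne : ∀ t, R ^ 2 < t → profileThetaPlus A b c t ≠ 0 ∧ profileThetaMinus A b c t ≠ 0 := by
    intro t ht
    rw [← not_or]
    intro h0
    have ht0 : 0 < t := (by positivity : 0 < R ^ 2).trans ht
    have hRt : R < Real.sqrt t := Real.lt_sqrt_of_sq_lt ht
    rw [← Real.sq_sqrt ht0.le] at h0
    have := hencl (hRp.trans hRt) (hpR.trans hRt.le) h0
    rw [hcar] at this
    have hmem : p ∈ Metric.sphere (0 : EuclideanSpace ℝ (Fin n)) (Real.sqrt t) := by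
      rw [← this, ← hcar]; exact hp
    have : ‖p‖ = Real.sqrt t := by simpa using hmem
    linarith
  refine ⟨R, hRp, le_trans hpM hpR, hcar, ?_, hs', fun t ht => ?_⟩
  · ext x
    refine ⟨fun hx => ?_, fun hx => hpos x (by rw [hpR']; exact hx)⟩
    by_contra hxR
    rw [mem_ofPred_eq, not_lt] at hxR
    obtain ⟨R', hR'⟩ := exists_gt R
    set e : EuclideanSpace ℝ (Fin n) := EuclideanSpace.single ⟨0, by omega⟩ R'
    have he : ‖e‖ = R' := by
      rw [PiLp.norm_single, Real.norm_eq_abs, abs_of_pos (hRp.trans hR')]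
    -- The exterior of S is connected and contains e with |e| > R. If it also contained a point with
    -- |x| ≤ R, it would meet the sphere of radius R, on which u vanishes.
    obtain ⟨z, hz, hzR⟩ := S.isConnected_outside.isPreconnected.intermediate_value hx
      (show 0 < S.u e from hpos e (by rw [he, hpR']; exact hR')) continuous_norm.continuousOn
      (⟨hxR, by rw [he]; exact hR'.le⟩ : R ∈ Icc ‖x‖ ‖e‖)
    have hz' : z ∈ S.carrier := by rw [hcar]; simpa using hzR
    exact (ne_of_gt hz) hz'
  · have hcont := fun s (hs : s ∈ Ioi (R ^ 2)) =>
      h.continuousAt_theta ((by positivity : 0 < R ^ 2).trans hs)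
        ((pow_le_pow_left₀ D.r₀_nonneg (le_trans hpM hpR) 2).trans (le_of_lt hs))
    obtain ⟨z, hz1, hz2⟩ := ((tp.eventually (lt_mem_nhds one_pos)).and
        (eventually_gt_atTop (R ^ 2))).exists
    obtain ⟨w, hw1, hw2⟩ := ((tm.eventually (lt_mem_nhds one_pos)).and
        (eventually_gt_atTop (R ^ 2))).exists
    exact ⟨pos_of_isPreconnected isPreconnected_Ioi
      (fun s hs => (hcont s hs).1.continuousWithinAt) (fun s hs => (hne s hs).1) hz2 hz1 ht,
      pos_of_isPreconnected isPreconnected_Ioi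
      (fun s hs => (hcont s hs).2.continuousWithinAt) (fun s hs => (hne s hs).2) hw2 hw1 ht⟩

end HasProfile
end InitialDataSet
end SpacetimePenrose
end

noncomputable section
namespace SpacetimePenrose

/-! ### The area of round spheres -/

section SphereArea

theorem euclideanHausdorffMeasure_image_le {X Y : Type*} [EMetricSpace X] [MeasurableSpace X]
    [BorelSpace X] [EMetricSpace Y] [MeasurableSpace Y] [BorelSpace Y] {C : NNReal} {f : X → Y}
    (hf : LipschitzWith C f) (d : ℕ) (s : Set X) :
    μHE[d] (f '' s) ≤ (C : ENNReal) ^ d * μHE[d] s := by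
  simp only [Measure.euclideanHausdorffMeasure_def, Measure.smul_apply]
  have h := hf.hausdorffMeasure_image_le (d := d) (by positivity) s
  rw [ENNReal.rpow_natCast] at h
  rw [ENNReal.smul_def, ENNReal.smul_def, smul_eq_mul, smul_eq_mul, mul_left_comm]
  gcongr

variable {m : ℕ}

/-- Insertion of a coordinate. -/
def insertCoord (i : Fin (m + 1)) (ε : ℝ) (y : EuclideanSpace ℝ (Fin m)) :
    EuclideanSpace ℝ (Fin (m + 1)) := WithLp.toLp 2 (Fin.insertNth i ε fun j => y j)

theorem dist_insertCoord (i : Fin (m + 1)) (ε : ℝ) (y z : EuclideanSpace ℝ (Fin m)) :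
    dist (insertCoord i ε y) (insertCoord i ε z) = dist y z := by
  rw [EuclideanSpace.dist_eq, EuclideanSpace.dist_eq, Fin.sum_univ_succAbove _ i]
  simp [insertCoord]

theorem norm_insertCoord (i : Fin (m + 1)) (ε : ℝ) (y : EuclideanSpace ℝ (Fin m)) :
    ‖insertCoord i ε y‖ ^ 2 = ε ^ 2 + ‖y‖ ^ 2 := by
  rw [← sum_mul_self, ← sum_mul_self, Fin.sum_univ_succAbove _ i]
  simp [insertCoord, sq]

/-- The central projection of a face of the cube to the sphere. -/
def sphereChart (i : Fin (m + 1)) (ε : ℝ) (y : EuclideanSpace ℝ (Fin m)) :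
    EuclideanSpace ℝ (Fin (m + 1)) := ‖insertCoord i ε y‖⁻¹ • insertCoord i ε y

/-- Points of a face of the cube have norm at least 1. Outside the unit ball, differences of
directions and of norms each contribute at most |v - w| to the difference of the normalizations; a
crude constant suffices for finiteness of the area. -/
theorem lipschitzWith_sphereChart (i : Fin (m + 1)) {ε : ℝ} (hε : ε ^ 2 = 1) :
    LipschitzWith 2 (sphereChart i ε) := by
  have h1 : ∀ y, 1 ≤ ‖insertCoord i ε y‖ := fun y => by
    refine le_of_sq_le_sq ?_ (norm_nonneg _)
    rw [norm_insertCoord, hε]; nlinarith [sq_nonneg ‖y‖]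
  refine LipschitzWith.of_dist_le_mul fun y z => ?_
  rw [← dist_insertCoord i ε y z, dist_eq_norm, dist_eq_norm, sphereChart, sphereChart]
  have hy := h1 y
  have hz := h1 z
  generalize insertCoord i ε y = v at *
  generalize insertCoord i ε z = w at *
  have e : ‖v‖⁻¹ • v - ‖w‖⁻¹ • w = ‖v‖⁻¹ • (v - w) + (‖v‖⁻¹ - ‖w‖⁻¹) • w := by
    rw [smul_sub, sub_smul]; abel
  have hvi : ‖v‖⁻¹ ≤ 1 := inv_le_one_of_one_le₀ hy
  have hv0 : 0 < ‖v‖ := by linarith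
  have hw0 : 0 < ‖w‖ := by linarith
  have e2 : |‖v‖⁻¹ - ‖w‖⁻¹| * ‖w‖ = ‖v‖⁻¹ * |‖w‖ - ‖v‖| := by
    rw [inv_sub_inv hv0.ne' hw0.ne', abs_div, abs_of_pos (mul_pos hv0 hw0)]
    field_simp
  have h3 : |‖w‖ - ‖v‖| ≤ ‖v - w‖ := by
    rw [norm_sub_rev]; exact abs_norm_sub_norm_le w v
  calc ‖‖v‖⁻¹ • v - ‖w‖⁻¹ • w‖
      ≤ ‖v‖⁻¹ * ‖v - w‖ + ‖v‖⁻¹ * |‖w‖ - ‖v‖| := by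
        rw [e]
        refine (norm_add_le _ _).trans (le_of_eq ?_)
        rw [norm_smul, norm_smul, norm_inv, norm_norm, Real.norm_eq_abs, e2]
    _ ≤ 1 * ‖v - w‖ + 1 * ‖v - w‖ := by gcongr
    _ = ((2 : NNReal) : ℝ) * ‖v - w‖ := by push_cast; ring

/-- Divide x by its coordinate of largest absolute value: the result lies on a face of the cube, and
the remaining m coordinates are bounded by 1, whence the radius √m. -/
theorem sphere_subset_iUnion_sphereChart :
    Metric.sphere (0 : EuclideanSpace ℝ (Fin (m + 1))) 1 ⊆ ⋃ i : Fin (m + 1),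
      (sphereChart i 1 '' Metric.closedBall 0 (Real.sqrt m) ∪
        sphereChart i (-1) '' Metric.closedBall 0 (Real.sqrt m)) := by
  intro x hx
  have hx1 : ‖x‖ = 1 := by simpa using hx
  obtain ⟨i, hi⟩ := Finite.exists_max fun j => |x j|
  have hxi : 0 < |x i| := by
    rcases (abs_nonneg (x i)).lt_or_eq with h | h
    · exact h
    · have : x = 0 := by
        ext j
        have := hi j
        rw [← h] at this
        simpa using abs_nonpos_iff.1 this
      rw [this, norm_zero] at hx1
      exact absurd hx1 zero_ne_one
  set y : EuclideanSpace ℝ (Fin m) := WithLp.toLp 2 fun j => |x i|⁻¹ * x (i.succAbove j) with hy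
  have hins : insertCoord i (|x i|⁻¹ * x i) y = |x i|⁻¹ • x := by
    ext j
    refine Fin.succAboveCases i ?_ (fun j => ?_) j
    · simp [insertCoord]
    · simp [insertCoord, hy]
  have hch : sphereChart i (|x i|⁻¹ * x i) y = x := by
    rw [sphereChart, hins, norm_smul, hx1, mul_one, norm_inv, Real.norm_eq_abs, abs_abs, inv_inv,
      smul_smul, mul_inv_cancel₀ hxi.ne', one_smul]
  have hyb : y ∈ Metric.closedBall 0 (Real.sqrt m) := by
    rw [mem_closedBall_zero_iff]
    refine Real.le_sqrt_of_sq_le ?_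
    rw [← sum_mul_self]
    have : ∀ j : Fin m, y j * y j ≤ 1 := by
      intro j
      have h1 : |y j| ≤ 1 := by
        show |(|x i|⁻¹ * x (i.succAbove j))| ≤ 1
        rw [abs_mul, abs_inv, abs_abs, inv_mul_le_iff₀ hxi, mul_one]
        exact hi _
      nlinarith [abs_le.1 h1]
    calc ∑ j, y j * y j ≤ ∑ _j : Fin m, (1 : ℝ) := Finset.sum_le_sum fun j _ => this j
      _ = m := by simp
  refine mem_iUnion.2 ⟨i, ?_⟩
  rcases abs_choice (x i) with h | h
  · left
    refine ⟨y, hyb, ?_⟩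
    have : |x i|⁻¹ * x i = 1 := by
      rw [h, inv_mul_cancel₀]; rw [h] at hxi; exact hxi.ne'
    rw [← this, hch]
  · right
    refine ⟨y, hyb, ?_⟩
    have : |x i|⁻¹ * x i = -1 := by
      have h0 : x i ≠ 0 := abs_pos.1 hxi
      rw [h, inv_neg, neg_mul, inv_mul_cancel₀ h0]
    rw [← this, hch]

theorem euclideanHausdorffMeasure_sphere_lt_top :
    μHE[m] (Metric.sphere (0 : EuclideanSpace ℝ (Fin (m + 1))) 1) < ⊤ := by
  have hb : ∀ (i : Fin (m + 1)) (ε : ℝ), ε ^ 2 = 1 →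
      μHE[m] (sphereChart i ε '' Metric.closedBall 0 (Real.sqrt m)) < ⊤ := by
    intro i ε hε
    refine (euclideanHausdorffMeasure_image_le (lipschitzWith_sphereChart i hε) m _).trans_lt ?_
    rw [EuclideanSpace.euclideanHausdorffMeasure_eq_volume]
    exact ENNReal.mul_lt_top (by simp) measure_closedBall_lt_top
  refine (measure_mono sphere_subset_iUnion_sphereChart).trans_lt ?_
  refine (measure_iUnion_fintype_le _ _).trans_lt (ENNReal.sum_lt_top.2 fun i _ => ?_)
  exact (measure_union_le _ _).trans_lt
    (ENNReal.add_lt_top.2 ⟨hb i 1 (by norm_num), hb i (-1) (by norm_num)⟩)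

/-- Forgetting one coordinate is 1-Lipschitz and maps the sphere onto a set containing the open unit
ball of one dimension less, which has positive volume. -/
theorem euclideanHausdorffMeasure_sphere_pos :
    0 < μHE[m] (Metric.sphere (0 : EuclideanSpace ℝ (Fin (m + 1))) 1) := by
  set f : EuclideanSpace ℝ (Fin (m + 1)) → EuclideanSpace ℝ (Fin m) :=
    fun x => WithLp.toLp 2 fun j => x j.succ with hf
  have hlip : LipschitzWith 1 f := by
    refine LipschitzWith.of_dist_le_mul fun x y => ?_
    rw [EuclideanSpace.dist_eq, EuclideanSpace.dist_eq, Fin.sum_univ_succ]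
    simp only [NNReal.coe_one, one_mul, hf]
    apply Real.sqrt_le_sqrt
    linarith [sq_nonneg (dist (x 0) (y 0))]
  have hsub : Metric.ball 0 1 ⊆ f '' Metric.sphere (0 : EuclideanSpace ℝ (Fin (m + 1))) 1 := by
    intro y hy
    have hy1 : ‖y‖ < 1 := by simpa using hy
    refine ⟨insertCoord 0 (Real.sqrt (1 - ‖y‖ ^ 2)) y, ?_, ?_⟩
    · have h1 : 0 ≤ 1 - ‖y‖ ^ 2 := by nlinarith [norm_nonneg y]
      rw [mem_sphere_zero_iff_norm, ← sq_eq_sq₀ (norm_nonneg _) zero_le_one, norm_insertCoord,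
        Real.sq_sqrt h1]
      ring
    · ext j; simp [hf, insertCoord]
  have h1 := (measure_mono hsub).trans (euclideanHausdorffMeasure_image_le hlip m _)
  rw [EuclideanSpace.euclideanHausdorffMeasure_eq_volume] at h1
  simp only [ENNReal.coe_one, one_pow, one_mul] at h1
  exact (Metric.measure_ball_pos volume _ one_pos).trans_le h1

variable {n : ℕ}

/-- Since `sphereVolume` is a `toReal`, both positivity and finiteness of the Hausdorff measure are
needed: an infinite value would be sent to 0. -/
theorem sphereVolume_pos (hn : 1 ≤ n) : 0 < sphereVolume n := by
  obtain ⟨m, rfl⟩ : ∃ m, n = m + 1 := ⟨n - 1, by omega⟩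
  exact ENNReal.toReal_pos euclideanHausdorffMeasure_sphere_pos.ne'
    euclideanHausdorffMeasure_sphere_lt_top.ne

open scoped Pointwise in
theorem measureReal_sphere {R : ℝ} (hR : 0 < R) :
    (μHE[n - 1] : Measure (EuclideanSpace ℝ (Fin n))).real (Metric.sphere 0 R)
      = R ^ (n - 1) * sphereVolume n := by
  have h : Metric.sphere (0 : EuclideanSpace ℝ (Fin n)) R = R • Metric.sphere 0 1 := by
    rw [smul_sphere' hR.ne', smul_zero, Real.norm_eq_abs, abs_of_pos hR, mul_one]
  rw [h, Measure.real, Measure.euclideanHausdorffMeasure_smul₀ _ hR.ne', sphereVolume,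
    ENNReal.smul_def, smul_eq_mul, ENNReal.toReal_mul]
  congr 1
  simp [abs_of_pos hR]

theorem setIntegral_sphere_of_const {R : ℝ} (hR : 0 < R) {f : EuclideanSpace ℝ (Fin n) → ℝ} {v : ℝ}
    (hf : ∀ x, ‖x‖ = R → f x = v) :
    ∫ x in Metric.sphere (0 : EuclideanSpace ℝ (Fin n)) R, f x ∂μHE[n - 1]
      = R ^ (n - 1) * sphereVolume n * v := by
  rw [setIntegral_congr_fun (g := fun _ => v) Metric.isClosed_sphere.measurableSet
    (fun x hx => hf x (by simpa using hx)), setIntegral_const, measureReal_sphere hR, smul_eq_mul]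

/-- The antipodal map is an isometry preserving the sphere, so the integral equals its own negative.
-/
theorem setIntegral_sphere_of_odd {R : ℝ} {f : EuclideanSpace ℝ (Fin n) → ℝ}
    (hf : ∀ x, ‖x‖ = R → f (-x) = -f x) :
    ∫ x in Metric.sphere (0 : EuclideanSpace ℝ (Fin n)) R, f x ∂μHE[n - 1] = 0 := by
  have hmp := (IsometryEquiv.neg (EuclideanSpace ℝ (Fin n))).measurePreserving_euclideanHausdorffMeasure
    (n - 1)
  have h1 := hmp.setIntegral_preimage_emb
    (IsometryEquiv.neg (EuclideanSpace ℝ (Fin n))).toHomeomorph.measurableEmbedding f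
    (Metric.sphere 0 R)
  have h2 : (IsometryEquiv.neg (EuclideanSpace ℝ (Fin n))) ⁻¹' Metric.sphere 0 R
      = Metric.sphere 0 R := by
    ext x; simp
  have h3 := setIntegral_congr_fun (μ := μHE[n - 1]) (g := fun x => -f x)
    (f := fun x => f (IsometryEquiv.neg (EuclideanSpace ℝ (Fin n)) x))
    (Metric.isClosed_sphere (x := 0) (ε := R)).measurableSet
    (fun x hx => hf x (by simpa using hx))
  rw [h2, h3, integral_neg] at h1
  linarith

end SphereArea

/-! ### ADM fluxes and the horizon area in terms of the profile -/

namespace InitialDataSet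

variable {n : ℕ} {D : InitialDataSet n} {A b K c : ℝ → ℝ}

namespace HasProfile

theorem energyFlux_eq (h : D.HasProfile A b K c) (hn : 2 ≤ n) {r : ℝ} (hr : 0 < r)
    (hr' : D.r₀ ≤ r) :
    D.energyFlux r = 1 / 2 * r ^ (n - 2)
      * (A (r ^ 2) - b (r ^ 2) - 2 * (r ^ 2 * deriv b (r ^ 2))) := by
  have hn' : (2 : ℝ) ≤ n := by exact_mod_cast hn
  have key : ∀ x : EuclideanSpace ℝ (Fin n), ‖x‖ = r →
      (∑ i, ∑ j, (pd i (fun y => D.g y i j) x - pd j (fun y => D.g y i i) x) * (x j / ‖x‖))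
        = ((n : ℝ) - 1) * (A (r ^ 2) - b (r ^ 2) - 2 * (r ^ 2 * deriv b (r ^ 2))) / r := by
    intro x hx
    have hxM : x ∈ D.M := by show D.r₀ ≤ ‖x‖; rwa [hx]
    have hx0 : x ≠ 0 := by rw [← norm_pos_iff, hx]; exact hr
    have e : ∀ i j, (pd i (fun y => D.g y i j) x - pd j (fun y => D.g y i i) x) * (x j / ‖x‖)
        = (2 * deriv b (r ^ 2) - (A (r ^ 2) - b (r ^ 2)) / r ^ 2) / r
            * ((1 : Matrix (Fin n) (Fin n) ℝ) i j * (x i * x j))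
          + ((A (r ^ 2) - b (r ^ 2)) / r ^ 2 - 2 * deriv b (r ^ 2)) / r * (x j * x j) := by
      intro i j
      rw [h.pd_g hxM hx0, h.pd_g hxM hx0, hx]
      rcases eq_or_ne i j with rfl | hij
      · simp only [Matrix.one_apply_eq]; ring
      · simp only [Matrix.one_apply_ne hij, Matrix.one_apply_ne hij.symm, Matrix.one_apply_eq]
        ring
    simp only [e]
    simp only [Finset.sum_add_distrib, ← Finset.mul_sum, sum_one_mul, sum_mul_self,
      Finset.sum_const, Finset.card_univ, Fintype.card_fin, hx, nsmul_eq_mul]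
    field_simp
    ring
  rw [energyFlux, setIntegral_sphere_of_const hr key]
  have hω := (sphereVolume_pos (n := n) (by omega)).ne'
  have hpow : r ^ (n - 1) = r ^ (n - 2) * r := by
    rw [← pow_succ]; congr 1; omega
  have hn1 : (n : ℝ) - 1 ≠ 0 := by linarith
  rw [hpow]
  field_simp

/-- g and k are even under x ↦ -x while the normal is odd. Thus the momentum flux vanishes on every
sphere and P = 0. -/
theorem momentumFlux_eq (h : D.HasProfile A b K c) {r : ℝ} (hr : 0 < r)
    (hr' : D.r₀ ≤ r) (i : Fin n) : D.momentumFlux i r = 0 := by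
  rw [momentumFlux, setIntegral_sphere_of_odd, mul_zero]
  intro x hx
  have hxM : x ∈ D.M := by show D.r₀ ≤ ‖x‖; rwa [hx]
  have hx0 : x ≠ 0 := by rw [← norm_pos_iff, hx]; exact hr
  have hxM' : -x ∈ D.M := by show D.r₀ ≤ ‖-x‖; rwa [norm_neg, hx]
  have hneg : ∀ p q : ℝ, radialTensor p q (-x) = radialTensor p q x := by
    intro p q; ext i j; simp [radialTensor_apply]
  have hg : D.g (-x) = D.g x := by
    rw [h.g_eq _ hxM' (neg_ne_zero.2 hx0), h.g_eq _ hxM hx0, norm_neg, hneg]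
  have hk : D.k (-x) = D.k x := by
    rw [h.k_eq _ hxM' (neg_ne_zero.2 hx0), h.k_eq _ hxM hx0, norm_neg, hneg]
  have ht : trace D.g D.k (-x) = trace D.g D.k x := by rw [trace, trace, hg, hk]
  rw [ht, hg, hk, norm_neg, ← Finset.sum_neg_distrib]
  exact Finset.sum_congr rfl fun j _ => by simp [neg_div]

/-- Rank-one perturbation of p times the identity. -/
theorem det_radialTensor {ι : Type*} [Fintype ι] [DecidableEq ι] {p q : ℝ} (hp : p ≠ 0)
    (x : EuclideanSpace ℝ ι) :
    (radialTensor p q x).det = p ^ Fintype.card ι * ((p + ‖x‖ ^ 2 * q) / p) := by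
  have e : radialTensor p q x = p • (1 + Matrix.replicateCol Unit (fun i => q / p * x i)
      * Matrix.replicateRow Unit fun i => x i) := by
    ext i j
    simp [radialTensor_apply, Matrix.mul_apply]
    field_simp
  rw [e, Matrix.det_smul, Matrix.det_one_add_replicateCol_mul_replicateRow]
  congr 1
  have : (fun i => x i) ⬝ᵥ (fun i => q / p * x i) = q / p * ‖x‖ ^ 2 := by
    rw [← sum_mul_self, Finset.mul_sum]
    exact Finset.sum_congr rfl fun i _ => by ring
  rw [this]
  field_simp

/-- The defining function of S is arbitrary even when S is a round sphere. `touching`, applied at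
every point, shows that its gradient is a positive multiple of x; this multiple and the radial
component A cancel from the area element, leaving the constant √b^{n-1}. -/
theorem area_eq (h : D.HasProfile A b K c) (hn : 2 ≤ n) {S : ClosedHypersurface n} {R : ℝ}
    (hR : 0 < R) (hR' : D.r₀ ≤ R) (hcar : S.carrier = Metric.sphere 0 R)
    (hout : S.outside = {x | R < ‖x‖}) :
    D.area S = Real.sqrt (R ^ 2 * b (R ^ 2)) ^ (n - 1) * sphereVolume n := by
  have key : ∀ x : EuclideanSpace ℝ (Fin n), ‖x‖ = R →
      Real.sqrt ((D.g x).det * ((∑ i, ∑ j, (D.g x)⁻¹ i j * pd i S.u x * pd j S.u x)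
        / ∑ i, pd i S.u x ^ 2)) = Real.sqrt (b (R ^ 2)) ^ (n - 1) := by
    intro x hx
    have hxM : x ∈ D.M := by show D.r₀ ≤ ‖x‖; rwa [hx]
    have hx0 : x ≠ 0 := by rw [← norm_pos_iff, hx]; exact hR
    have hx1 : x ∈ S.carrier := by rw [hcar]; simpa using hx
    have hge : ∀ y, ‖x‖ ≤ ‖y‖ → 0 ≤ S.u y := by
      intro y hy
      rcases hy.lt_or_eq with hy | hy
      · have : y ∈ S.outside := by rw [hout, mem_ofPred_eq, ← hx]; exact hy
        exact le_of_lt this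
      · have : y ∈ S.carrier := by rw [hcar]; simpa [hx] using hy.symm
        exact (show S.u y = 0 from this).ge
    obtain ⟨l, hl, hgrad, -⟩ := S.touching hx1 hx0 hge
    obtain ⟨h1, h2⟩ := normSq_mem hxM hx0
    have hA := add_mul_div A b h1
    have hb0 := h.pos_b _ h1 h2
    have hA0 := h.pos_A _ h1 h2
    have e1 : ∑ i, ∑ j, (D.g x)⁻¹ i j * pd i S.u x * pd j S.u x
        = l ^ 2 * (‖x‖ ^ 2 / A (‖x‖ ^ 2)) := by
      rw [h.g_eq x hxM hx0, radialTensor_inv hb0.ne' (hA.symm ▸ hA0.ne'), hA]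
      have e2 : ∀ p q : ℝ, ∀ i, ∑ j, radialTensor p q x i j * pd i S.u x * pd j S.u x
          = l ^ 2 * (p + ‖x‖ ^ 2 * q) * (x i * x i) := by
        intro p q i
        have : ∀ j, radialTensor p q x i j * pd i S.u x * pd j S.u x
            = l ^ 2 * x i * (radialTensor p q x i j * x j) := fun j => by
          rw [hgrad, hgrad]; ring
        simp only [this, ← Finset.mul_sum, sum_radialTensor_mul_self]
        ring
      simp only [e2, ← Finset.mul_sum, sum_mul_self]
      field_simp
      ring
    have e3 : ∑ i, pd i S.u x ^ 2 = l ^ 2 * ‖x‖ ^ 2 := by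
      rw [← sum_mul_self, Finset.mul_sum]
      exact Finset.sum_congr rfl fun i _ => by rw [hgrad]; ring
    rw [e1, e3, h.g_eq x hxM hx0, det_radialTensor hb0.ne', hA, Fintype.card_fin, hx]
    rw [hx] at hb0 hA0
    have e4 : b (R ^ 2) ^ n * (A (R ^ 2) / b (R ^ 2)) * (l ^ 2 * (R ^ 2 / A (R ^ 2))
        / (l ^ 2 * R ^ 2)) = (Real.sqrt (b (R ^ 2)) ^ (n - 1)) ^ 2 := by
      rw [← pow_mul, mul_comm (n - 1) 2, pow_mul, Real.sq_sqrt hb0.le]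
      obtain ⟨m, rfl⟩ : ∃ m, n = m + 1 := ⟨n - 1, by omega⟩
      rw [Nat.add_sub_cancel, pow_succ]
      field_simp
    rw [e4, Real.sqrt_sq (by positivity)]
  rw [area, hcar, setIntegral_sphere_of_const hR key, Real.sqrt_mul (sq_nonneg R),
    Real.sqrt_sq hR.le, mul_pow]
  ring

end HasProfile
end InitialDataSet
end SpacetimePenrose
end

noncomputable section
namespace SpacetimePenrose
namespace InitialDataSet

variable {n : ℕ} {D : InitialDataSet n} {A b K c : ℝ → ℝ}

/-! ### Monotonicity of the Hawking mass -/

/-- Twice the Hawking mass of the coordinate sphere `|x|² = s`. -/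
def hawking (n : ℕ) (A b c : ℝ → ℝ) (s : ℝ) : ℝ :=
  Real.sqrt (s * b s) ^ (n - 2) * (1 - profileF A b c s)

namespace HasProfile

/-- Differentiating ρ^{n-2} produces exactly the negative of the term with 1 - F in the derivative
of F; only the matter terms remain. -/
theorem hasDerivAt_hawking (h : D.HasProfile A b K c) (hn : 3 ≤ n) {s : ℝ} (hs : 0 < s)
    (hs' : D.r₀ ^ 2 ≤ s) :
    HasDerivAt (hawking n A b c) (Real.sqrt (s * b s) ^ (n - 2) / ((n : ℝ) - 1)
      * (profileEnergy n A b K c s / 2 * (b s + s * deriv b s)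
          - s * c s * profileMomentum n A b K c s)) s := by
  have hn1 : (n : ℝ) - 1 ≠ 0 := by
    have : (3 : ℝ) ≤ n := by exact_mod_cast hn
    linarith
  have hb0 := h.pos_b s hs hs'
  have hsb : 0 < s * b s := mul_pos hs hb0
  have hw := Real.sqrt_pos.2 hsb
  have hw2 := Real.sq_sqrt hsb.le
  have db := (h.smooth_b s hs hs').hasDerivAt_infty
  have d1 := (((hasDerivAt_id s).mul db).sqrt (by simpa using hsb.ne')).pow (n - 2)
  have d2 := (h.hasDerivAt_profileF hs hs' hn1).const_sub 1
  refine (d1.mul d2).congr_deriv ?_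
  -- With n = m + 3 the exponents n - 2 and n - 2 - 1 become m + 1 and m, free of truncated
  -- subtraction.
  obtain ⟨m, rfl⟩ : ∃ m, n = m + 3 := ⟨n - 3, by omega⟩
  have e1 : m + 3 - 2 - 1 = m := by omega
  have e2 : m + 3 - 2 = m + 1 := by omega
  simp only [Pi.mul_apply, Pi.pow_apply, id, e1, e2]
  push_cast at hn1 ⊢
  set w := Real.sqrt (s * b s) with hwd
  have hbw : b s = w ^ 2 / s := by rw [hw2]; field_simp
  generalize profileF A b c s = F
  generalize profileEnergy (m + 3) A b K c s = E
  generalize profileMomentum (m + 3) A b K c s = j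
  rw [hbw]
  have := hs.ne'
  have := hw.ne'
  field_simp
  ring

theorem abs_mul_sqrt_lt {s : ℝ} (hp : 0 < profileThetaPlus A b c s)
    (hm : 0 < profileThetaMinus A b c s) : |c s| * Real.sqrt (s * A s) < b s + s * deriv b s := by
  rw [profileThetaPlus] at hp
  rw [profileThetaMinus] at hm
  rcases abs_cases (c s) with ⟨e, -⟩ | ⟨e, -⟩ <;> rw [e] <;> linarith

theorem sqrt_div_mul_sqrt_mul {s a : ℝ} (hs : 0 < s) (ha : 0 < a) :
    Real.sqrt (s / a) * Real.sqrt (s * a) = s := by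
  rw [← Real.sqrt_mul (by positivity)]
  have : s / a * (s * a) = s ^ 2 := by field_simp
  rw [this, Real.sqrt_sq hs.le]

/-- The integrand in the monotonicity formula is nonnegative under the dominant energy condition,
and vanishes only in vacuum. -/
theorem mass_density_nonneg {E j Y cc s a : ℝ} (hs : 0 < s) (ha : 0 < a)
    (hdec : 2 * |j| * Real.sqrt (s / a) ≤ E) (hY : |cc| * Real.sqrt (s * a) < Y) :
    0 ≤ E / 2 * Y - s * cc * j ∧ (E / 2 * Y - s * cc * j = 0 → E = 0 ∧ j = 0) := by
  have hprod := sqrt_div_mul_sqrt_mul hs ha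
  have hq : 0 < Real.sqrt (s / a) := Real.sqrt_pos.2 (by positivity)
  have hr : 0 < Real.sqrt (s * a) := Real.sqrt_pos.2 (by positivity)
  set q := Real.sqrt (s / a)
  set r := Real.sqrt (s * a)
  have hE : 0 ≤ E := le_trans (by positivity) hdec
  -- Splitting s = √(s/a) √(s a) pairs |j| with the factor from the energy condition and |cc| with
  -- the factor from the null expansions.
  have h1 : s * cc * j ≤ |j| * q * (|cc| * r) := by
    have : s * cc * j ≤ s * (|cc| * |j|) := by
      rw [← abs_mul, mul_assoc]
      exact mul_le_mul_of_nonneg_left (le_abs_self _) hs.le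
    refine this.trans (le_of_eq ?_)
    rw [← hprod]; ring
  have h2 : |j| * q * (|cc| * r) ≤ E / 2 * (|cc| * r) :=
    mul_le_mul_of_nonneg_right (by linarith) (by positivity)
  have h3 : E / 2 * (|cc| * r) ≤ E / 2 * Y := mul_le_mul_of_nonneg_left hY.le (by linarith)
  refine ⟨by linarith, fun h0 => ?_⟩
  -- Strictness in the expansion bound is what forces vacuum: for E > 0 the last inequality would be
  -- strict.
  have hE0 : E = 0 := by
    by_contra hne
    have hEpos : 0 < E / 2 := by
      have := lt_of_le_of_ne hE (Ne.symm hne); linarith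
    have := mul_lt_mul_of_pos_left hY hEpos
    linarith
  refine ⟨hE0, ?_⟩
  rw [hE0] at hdec
  have : |j| ≤ 0 := by nlinarith [abs_nonneg j]
  exact abs_nonpos_iff.1 this

theorem density_nonneg (h : D.HasProfile A b K c) (hn : 1 ≤ n)
    (hdec : D.DominantEnergyCondition) {s : ℝ} (hs : D.r₀ ^ 2 < s)
    (hp : 0 < profileThetaPlus A b c s) (hm : 0 < profileThetaMinus A b c s) :
    0 ≤ profileEnergy n A b K c s / 2 * (b s + s * deriv b s)
        - s * c s * profileMomentum n A b K c s ∧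
      (profileEnergy n A b K c s / 2 * (b s + s * deriv b s)
        - s * c s * profileMomentum n A b K c s = 0 →
        profileEnergy n A b K c s = 0 ∧ profileMomentum n A b K c s = 0) :=
  have hs0 : 0 < s := (sq_nonneg _).trans_lt hs
  mass_density_nonneg hs0 (h.pos_A s hs0 hs.le) (h.momentum_le_energy hn hdec hs)
    (abs_mul_sqrt_lt hp hm)

theorem monotoneOn_hawking (h : D.HasProfile A b K c) (hn : 3 ≤ n)
    (hdec : D.DominantEnergyCondition) {R : ℝ} (hR : 0 < R) (hR' : D.r₀ ≤ R)
    (hθ : ∀ s, R ^ 2 < s → 0 < profileThetaPlus A b c s ∧ 0 < profileThetaMinus A b c s) :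
    MonotoneOn (hawking n A b c) (Ici (R ^ 2)) := by
  have hR2 : 0 < R ^ 2 := by positivity
  have hr2 := pow_le_pow_left₀ D.r₀_nonneg hR' 2
  have hd := fun s (hs : R ^ 2 ≤ s) => h.hasDerivAt_hawking hn (hR2.trans_le hs) (hr2.trans hs)
  refine monotoneOn_of_deriv_nonneg (convex_Ici _)
    (fun s hs => (hd s hs).continuousAt.continuousWithinAt) ?_ ?_
  · rw [interior_Ici]
    exact fun s hs => (hd s (le_of_lt hs)).differentiableAt.differentiableWithinAt
  · rw [interior_Ici]
    intro s hs
    rw [(hd s (le_of_lt hs)).deriv]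
    have hn1 : (0 : ℝ) < (n : ℝ) - 1 := by
      have : (3 : ℝ) ≤ n := by exact_mod_cast hn
      linarith
    exact mul_nonneg (by positivity)
      (h.density_nonneg (by omega) hdec (hr2.trans_lt hs) (hθ s hs).1 (hθ s hs).2).1

/-- F is the product of the two expansions up to the factor 1/(A b), so it vanishes with either of
them; the next lemma uses the same factorization for its sign. -/
theorem profileF_eq_zero (h : D.HasProfile A b K c) {s : ℝ} (hs : 0 < s) (hs' : D.r₀ ^ 2 ≤ s)
    (h0 : profileThetaPlus A b c s = 0 ∨ profileThetaMinus A b c s = 0) :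
    profileF A b c s = 0 := by
  have hA := h.pos_A s hs hs'
  have hq := Real.sq_sqrt (mul_pos hs hA).le
  have hY : (b s + s * deriv b s) ^ 2 = c s ^ 2 * (s * A s) := by
    rw [profileThetaPlus, profileThetaMinus] at h0
    rw [← hq]
    rcases h0 with h0 | h0
    · have : b s + s * deriv b s = -(c s * Real.sqrt (s * A s)) := by linarith
      rw [this]; ring
    · have : b s + s * deriv b s = c s * Real.sqrt (s * A s) := by linarith
      rw [this]; ring
  rw [profileF, hY]
  field_simp
  ring

theorem profileF_pos (h : D.HasProfile A b K c) {s : ℝ} (hs : 0 < s) (hs' : D.r₀ ^ 2 ≤ s)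
    (hp : 0 < profileThetaPlus A b c s) (hm : 0 < profileThetaMinus A b c s) :
    0 < profileF A b c s := by
  have hA := h.pos_A s hs hs'
  have hq := Real.sq_sqrt (mul_pos hs hA).le
  have hpm := mul_pos hp hm
  rw [profileThetaPlus, profileThetaMinus] at hpm
  have h1 : 0 < (b s + s * deriv b s) ^ 2 - c s ^ 2 * (s * A s) := by
    rw [← hq]; nlinarith
  have e : profileF A b c s
      = ((b s + s * deriv b s) ^ 2 - c s ^ 2 * (s * A s)) / (A s * b s) := by
    have := (h.pos_b s hs hs').ne'
    have := hA.ne'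
    rw [profileF]; field_simp
  rw [e]
  exact div_pos h1 (mul_pos hA (h.pos_b s hs hs'))

/-- Twice the flux integral defining the ADM energy, as a function of `s = r²`. -/
def profileFlux (n : ℕ) (A b : ℝ → ℝ) (s : ℝ) : ℝ :=
  Real.sqrt s ^ (n - 2) * (A s - b s - 2 * (s * deriv b s))

theorem exists_profileFlux_le (h : D.HasProfile A b K c) (hn : 3 ≤ n)
    (haf : D.IsAsymptoticallyFlat) : ∃ B, ∀ᶠ s in atTop, |profileFlux n A b s| ≤ B := by
  obtain ⟨C, s₀, hC, hs₀, hr, hd⟩ := h.exists_decay hn haf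
  refine ⟨4 * C, ?_⟩
  filter_upwards [eventually_gt_atTop s₀] with s hs
  obtain ⟨h1, h2, h3, -⟩ := hd s hs
  have hq : 0 < Real.sqrt s ^ (n - 2) := pow_pos (Real.sqrt_pos.2 (hs₀.trans hs)) _
  rw [profileFlux, abs_mul, abs_of_pos hq, ← le_div_iff₀' hq]
  have e : 4 * C / Real.sqrt s ^ (n - 2) = 4 * (C / Real.sqrt s ^ (n - 2)) := by ring
  rw [e]
  rw [abs_le] at *
  constructor <;> linarith

/-- Expanding the square in F gives 1 - F = (A - b - 2 s b')/A + s c²/b - (s b')²/(A b). After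
multiplication by ρ^{n-2} the first term is the flux times a factor tending to 1. Each of the other
two is quadratic in a quantity of size O(s^{-(n-2)/2}), hence a bounded function times one tending
to 0. -/
theorem tendsto_hawking_sub_flux (h : D.HasProfile A b K c) (hn : 3 ≤ n)
    (haf : D.IsAsymptoticallyFlat) :
    Tendsto (fun s => hawking n A b c s - profileFlux n A b s) atTop (𝓝 0) := by
  obtain ⟨tA, tb, tb', tc⟩ := h.tendsto_profile hn haf
  obtain ⟨C, s₀, hC, hs₀, hr, hd⟩ := h.exists_decay hn haf
  obtain ⟨B, hB⟩ := h.exists_profileFlux_le hn haf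
  have tsb : Tendsto (fun s => Real.sqrt (b s) ^ (n - 2)) atTop (𝓝 1) := by
    have := ((Real.continuous_sqrt.tendsto 1).comp tb).pow (n - 2)
    simpa using this
  have bounded_mul : ∀ (f g : ℝ → ℝ) (B : ℝ), (∀ᶠ s in atTop, |f s| ≤ B) →
      Tendsto g atTop (𝓝 0) → Tendsto (fun s => f s * g s) atTop (𝓝 0) := by
    intro f g B hf hg
    have hg' : Tendsto (fun s => B * |g s|) atTop (𝓝 0) := by simpa using hg.abs.const_mul B
    refine squeeze_zero_norm' ?_ hg'
    filter_upwards [hf] with s hs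
    rw [Real.norm_eq_abs, abs_mul]
    exact mul_le_mul_of_nonneg_right hs (abs_nonneg _)
  have t1 : Tendsto (fun s => profileFlux n A b s * (Real.sqrt (b s) ^ (n - 2) / A s - 1)) atTop
      (𝓝 0) := by
    refine bounded_mul _ _ B hB ?_
    simpa using (tsb.div tA one_ne_zero).sub_const 1
  have t2 : Tendsto (fun s => (Real.sqrt s ^ (n - 2) * (c s * Real.sqrt s))
      * ((c s * Real.sqrt s) * (Real.sqrt (b s) ^ (n - 2) / b s))) atTop (𝓝 0) := by
    refine bounded_mul _ _ C ?_ ?_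
    · filter_upwards [eventually_gt_atTop s₀] with s hs
      have hq : 0 < Real.sqrt s ^ (n - 2) := pow_pos (Real.sqrt_pos.2 (hs₀.trans hs)) _
      rw [abs_mul, abs_of_pos hq, ← le_div_iff₀' hq]
      exact (hd s hs).2.2.2
    · simpa using tc.mul (tsb.div tb one_ne_zero)
  have t3 : Tendsto (fun s => (Real.sqrt s ^ (n - 2) * (s * deriv b s))
      * ((s * deriv b s) * (Real.sqrt (b s) ^ (n - 2) / (b s * A s)))) atTop (𝓝 0) := by
    refine bounded_mul _ _ C ?_ ?_
    · filter_upwards [eventually_gt_atTop s₀] with s hs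
      have hq : 0 < Real.sqrt s ^ (n - 2) := pow_pos (Real.sqrt_pos.2 (hs₀.trans hs)) _
      rw [abs_mul, abs_of_pos hq, ← le_div_iff₀' hq]
      exact (hd s hs).2.2.1
    · have := tb'.mul (tsb.div (tb.mul tA) (by norm_num))
      simpa using this
  have t := (t1.add t2).sub t3
  simp only [add_zero, sub_zero] at t
  refine t.congr' ?_
  filter_upwards [eventually_gt_atTop s₀] with s hs
  have hs0 := hs₀.trans hs
  have hA := (h.pos_A s hs0 (hr.trans hs.le)).ne'
  have hb := (h.pos_b s hs0 (hr.trans hs.le)).ne'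
  have hq2 := Real.sq_sqrt hs0.le
  rw [hawking, profileF, profileFlux, Real.sqrt_mul hs0.le, mul_pow]
  generalize Real.sqrt (b s) ^ (n - 2) = w
  generalize Real.sqrt s ^ (n - 2) = v
  have e : ∀ z : ℝ, (v * (c s * Real.sqrt s)) * ((c s * Real.sqrt s) * z)
      = v * c s ^ 2 * z * s := fun z => by
    linear_combination (v * c s ^ 2 * z) * hq2
  rw [e]
  field_simp
  ring

/-- The existence of the ADM energy is a consequence of monotonicity: `hawking` is monotone, and
bounded because it differs from the bounded flux by o(1). So it converges, and the flux has the same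
limit. -/
theorem tendsto_energyFlux (h : D.HasProfile A b K c) (hn : 3 ≤ n) (haf : D.IsAsymptoticallyFlat)
    {R : ℝ} (hmono : MonotoneOn (hawking n A b c) (Ici (R ^ 2))) :
    ∃ E, Tendsto D.energyFlux atTop (𝓝 E) ∧ Tendsto (hawking n A b c) atTop (𝓝 (2 * E)) ∧
      ∀ s, R ^ 2 ≤ s → hawking n A b c s ≤ 2 * E := by
  have hsub := h.tendsto_hawking_sub_flux hn haf
  obtain ⟨B, hB⟩ := h.exists_profileFlux_le hn haf
  -- Freezing `hawking` below R² gives a function that is monotone on the whole line and agrees with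
  -- it near infinity.
  set f : ℝ → ℝ := fun s => hawking n A b c (max (R ^ 2) s) with hf
  have hfm : Monotone f := fun s t hst =>
    hmono (mem_Ici.2 (le_max_left _ _)) (mem_Ici.2 (le_max_left _ _)) (max_le_max le_rfl hst)
  have hfe : f =ᶠ[atTop] hawking n A b c := by
    filter_upwards [eventually_ge_atTop (R ^ 2)] with s hs
    simp only [hf]; rw [max_eq_right hs]
  have hbdd : BddAbove (range f) := by
    have hev : ∀ᶠ s in atTop, f s ≤ B + 1 := by
      filter_upwards [hfe, hB, hsub.eventually (gt_mem_nhds one_pos)] with s h1 h2 h3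
      rw [h1]
      linarith [(abs_le.1 h2).2]
    obtain ⟨s₁, hs₁⟩ := eventually_atTop.1 hev
    refine ⟨B + 1, ?_⟩
    rintro _ ⟨s, rfl⟩
    exact (hfm (le_max_left s s₁)).trans (hs₁ _ (le_max_right _ _))
  have hlim := tendsto_atTop_ciSup hfm hbdd
  set L := ⨆ s, f s
  have hH : Tendsto (hawking n A b c) atTop (𝓝 L) := hlim.congr' hfe
  have hflux : Tendsto (profileFlux n A b) atTop (𝓝 L) := by
    have := hH.sub hsub
    simpa using this
  refine ⟨L / 2, ?_, ?_, fun s hs => ?_⟩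
  · have h1 := (hflux.comp (tendsto_pow_atTop (α := ℝ) two_ne_zero)).const_mul (1 / 2)
    have e : (1 / 2 : ℝ) * L = L / 2 := by ring
    rw [e] at h1
    refine h1.congr' ?_
    filter_upwards [eventually_gt_atTop 0, eventually_ge_atTop D.r₀] with r hr hr'
    rw [h.energyFlux_eq (by omega) hr hr']
    simp only [Function.comp, profileFlux]
    rw [Real.sqrt_sq hr.le]; ring
  · have e : 2 * (L / 2) = L := by ring
    rwa [e]
  · have e : 2 * (L / 2) = L := by ring
    rw [e]
    have := le_ciSup hbdd s
    simp only [hf] at this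
    rwa [max_eq_right hs] at this

/-- The mass inequality together with the characterization of equality in terms of the energy
density. -/
theorem mass_inequality (h : D.HasProfile A b K c) (hn : 3 ≤ n) (haf : D.IsAsymptoticallyFlat)
    (hdec : D.DominantEnergyCondition) {R : ℝ} (hR : 0 < R) (hR' : D.r₀ ≤ R)
    (h0 : profileThetaPlus A b c (R ^ 2) = 0 ∨ profileThetaMinus A b c (R ^ 2) = 0)
    (hθ : ∀ s, R ^ 2 < s → 0 < profileThetaPlus A b c s ∧ 0 < profileThetaMinus A b c s) :
    ∃ m, D.HasADMMass m ∧ 0 < m ∧ Real.sqrt (R ^ 2 * b (R ^ 2)) ^ (n - 2) ≤ 2 * m ∧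
      (2 * m = Real.sqrt (R ^ 2 * b (R ^ 2)) ^ (n - 2) →
        ∀ s, R ^ 2 < s → hawking n A b c s = 2 * m ∧ profileMomentum n A b K c s = 0) ∧
      ((∀ s, R ^ 2 < s → profileEnergy n A b K c s = 0) →
        2 * m = Real.sqrt (R ^ 2 * b (R ^ 2)) ^ (n - 2)) := by
  have hR2 : 0 < R ^ 2 := by positivity
  have hr2 := pow_le_pow_left₀ D.r₀_nonneg hR' 2
  have hmono := h.monotoneOn_hawking hn hdec hR hR' hθ
  obtain ⟨E, hE, hHE, hle⟩ := h.tendsto_energyFlux hn haf hmono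
  have hHR : hawking n A b c (R ^ 2) = Real.sqrt (R ^ 2 * b (R ^ 2)) ^ (n - 2) := by
    rw [hawking, h.profileF_eq_zero hR2 hr2 h0, sub_zero, mul_one]
  have hw : 0 < Real.sqrt (R ^ 2 * b (R ^ 2)) ^ (n - 2) :=
    pow_pos (Real.sqrt_pos.2 (mul_pos hR2 (h.pos_b _ hR2 hr2))) _
  have hineq := hle _ le_rfl
  rw [hHR] at hineq
  -- The horizon term makes E positive, which identifies √(E² - 0) with E.
  have hEpos : 0 < E := by linarith
  have hd := fun s (hs : R ^ 2 ≤ s) => h.hasDerivAt_hawking hn (hR2.trans_le hs) (hr2.trans hs)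
  refine ⟨E, ⟨E, fun _ => 0, hE, fun i => ?_, ?_⟩, hEpos, hineq, fun heq s hs => ?_, fun hvac => ?_⟩
  · refine tendsto_const_nhds.congr' ?_
    filter_upwards [eventually_gt_atTop 0, eventually_ge_atTop D.r₀] with r hr hr'
    rw [h.momentumFlux_eq hr hr']
  · simp [Real.sqrt_sq hEpos.le]
  -- In the equality case the monotone function `hawking` has the same value on the horizon as at
  -- infinity, so it is constant.
  · have hconst : ∀ t, R ^ 2 ≤ t → hawking n A b c t = 2 * E := fun t ht =>
      le_antisymm (hle t ht) (by
        rw [heq, ← hHR]; exact hmono self_mem_Ici ht ht)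
    refine ⟨hconst s hs.le, ?_⟩
    have hder : HasDerivAt (hawking n A b c) 0 s := by
      refine (hasDerivAt_const s (2 * E)).congr_of_eventuallyEq ?_
      filter_upwards [lt_mem_nhds hs] with t ht using hconst t ht.le
    have h1 := (hd s hs.le).unique hder
    have hn1 : (0 : ℝ) < (n : ℝ) - 1 := by
      have : (3 : ℝ) ≤ n := by exact_mod_cast hn
      linarith
    have hs0 := hR2.trans hs
    have hws : 0 < Real.sqrt (s * b s) ^ (n - 2) / ((n : ℝ) - 1) :=
      div_pos (pow_pos (Real.sqrt_pos.2 (mul_pos hs0 (h.pos_b _ hs0 (hr2.trans hs.le)))) _) hn1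
    have h2 := (mul_eq_zero.1 h1).resolve_left hws.ne'
    exact ((h.density_nonneg (by omega) hdec (hr2.trans_lt hs) (hθ s hs).1 (hθ s hs).2).2 h2).2
  -- Without energy density the dominant energy condition removes the momentum density too, and the
  -- derivative of `hawking` vanishes. Being nonincreasing is all that is needed, since the other
  -- inequality is already known.
  · have hanti : AntitoneOn (hawking n A b c) (Ici (R ^ 2)) := by
      refine antitoneOn_of_deriv_nonpos (convex_Ici _)
        (fun s hs => (hd s hs).continuousAt.continuousWithinAt) ?_ ?_
      · rw [interior_Ici]
        exact fun s hs => (hd s (le_of_lt hs)).differentiableAt.differentiableWithinAt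
      · rw [interior_Ici]
        intro s hs
        have hs0 := hR2.trans hs
        have hj : profileMomentum n A b K c s = 0 := by
          have h1 := h.momentum_le_energy (by omega) hdec (hr2.trans_lt hs)
          rw [hvac s hs] at h1
          have hq : 0 < Real.sqrt (s / A s) :=
            Real.sqrt_pos.2 (div_pos hs0 (h.pos_A _ hs0 (hr2.trans (le_of_lt hs))))
          have : |profileMomentum n A b K c s| ≤ 0 := by
            nlinarith [abs_nonneg (profileMomentum n A b K c s)]
          exact abs_nonpos_iff.1 this
        rw [(hd s (le_of_lt hs)).deriv, hvac s hs, hj]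
        simp
    refine le_antisymm ?_ hineq
    rw [← hHR]
    refine le_of_tendsto hHE ?_
    filter_upwards [eventually_ge_atTop (R ^ 2)] with s hs
    exact hanti self_mem_Ici hs hs

end HasProfile
end InitialDataSet
end SpacetimePenrose
end

noncomputable section
namespace SpacetimePenrose

/-! ### Pseudo-Riemannian metrics in coordinates -/

section Metric

variable {κ : Type*} [Fintype κ] [DecidableEq κ]

theorem contDiffAt_det {E : Type*} [NormedAddCommGroup E] [NormedSpace ℝ E] {M : E → Matrix κ κ ℝ}
    {z : E} (h : ∀ A B, ContDiffAt ℝ ∞ (fun w => M w A B) z) :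
    ContDiffAt ℝ ∞ (fun w => (M w).det) z := by
  simp only [Matrix.det_apply']
  exact ContDiffAt.sum fun σ _ => contDiffAt_const.mul (contDiffAt_prod fun i _ => h _ _)

theorem contDiffAt_inv_apply {E : Type*} [NormedAddCommGroup E] [NormedSpace ℝ E]
    {M : E → Matrix κ κ ℝ} {z : E} (h : ∀ A B, ContDiffAt ℝ ∞ (fun w => M w A B) z)
    (hdet : (M z).det ≠ 0) (A B : κ) : ContDiffAt ℝ ∞ (fun w => (M w)⁻¹ A B) z := by
  have h1 : ∀ w, (M w)⁻¹ A B = ((M w).det)⁻¹ * (M w).adjugate A B := fun w => by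
    rw [Matrix.inv_def, Matrix.smul_apply, smul_eq_mul, Ring.inverse_eq_inv']
  simp only [h1, Matrix.adjugate_apply]
  refine ((contDiffAt_det h).inv hdet).mul (contDiffAt_det fun C D => ?_)
  rcases eq_or_ne C B with rfl | hC
  · simp only [Matrix.updateRow_self]; exact contDiffAt_const
  · simp only [Matrix.updateRow_ne hC]; exact h C D

/-- `G` is smooth, symmetric and nondegenerate near `z`. -/
structure IsMetricNear (G : EuclideanSpace ℝ κ → Matrix κ κ ℝ) (z : EuclideanSpace ℝ κ) :
    Prop where
  smooth : ∀ A B, ContDiffAt ℝ ∞ (fun w => G w A B) z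
  symm : ∀ᶠ w in 𝓝 z, ∀ A B, G w A B = G w B A
  det_ne_zero : (G z).det ≠ 0

/-- The curvature tensor `R^A_{CDB}`, whose contraction of `A` and `D` is the Ricci tensor. -/
def riemann (G : EuclideanSpace ℝ κ → Matrix κ κ ℝ) (A C D B : κ) (z : EuclideanSpace ℝ κ) : ℝ :=
  pd D (christoffel G A C B) z - pd B (christoffel G A C D) z
    + ∑ F, (christoffel G A D F z * christoffel G F C B z
      - christoffel G A B F z * christoffel G F C D z)

namespace IsMetricNear

variable {G : EuclideanSpace ℝ κ → Matrix κ κ ℝ} {z : EuclideanSpace ℝ κ}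

theorem pd_symm (h : IsMetricNear G z) (D A B : κ) :
    pd D (fun w => G w A B) z = pd D (fun w => G w B A) z :=
  pd_congr (h.symm.mono fun _ hw => hw A B) D

theorem christoffel_symm (h : IsMetricNear G z) (A B C : κ) :
    christoffel G A B C z = christoffel G A C B z := by
  rw [christoffel, christoffel]
  congr 1
  exact Finset.sum_congr rfl fun D _ => by rw [h.pd_symm D B C]; ring

theorem mul_inv (h : IsMetricNear G z) : G z * (G z)⁻¹ = 1 :=
  Matrix.mul_nonsing_inv _ (isUnit_iff_ne_zero.2 h.det_ne_zero)

theorem inv_mul (h : IsMetricNear G z) : (G z)⁻¹ * G z = 1 :=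
  Matrix.nonsing_inv_mul _ (isUnit_iff_ne_zero.2 h.det_ne_zero)

theorem inv_symm (h : IsMetricNear G z) (A B : κ) : (G z)⁻¹ A B = (G z)⁻¹ B A := by
  have h1 : (G z).transpose = G z := by
    ext A B; exact h.symm.self_of_nhds B A
  have h2 := Matrix.transpose_nonsing_inv (G z)
  rw [h1] at h2
  exact (congrFun (congrFun h2 B) A)

theorem sum_mul_christoffel (h : IsMetricNear G z) (E B C : κ) :
    ∑ D, G z E D * christoffel G D B C z = 1 / 2 * (pd B (fun w => G w C E) z
      + pd C (fun w => G w B E) z - pd E (fun w => G w B C) z) := by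
  have e : ∀ D, G z E D * christoffel G D B C z = ∑ F, 1 / 2 * (G z E D * (G z)⁻¹ D F
      * (pd B (fun w => G w C F) z + pd C (fun w => G w B F) z - pd F (fun w => G w B C) z)) := by
    intro D
    rw [christoffel, Finset.mul_sum, Finset.mul_sum]
    exact Finset.sum_congr rfl fun F _ => by ring
  simp only [e]
  rw [Finset.sum_comm]
  simp only [← Finset.mul_sum, ← Finset.sum_mul]
  have e2 : ∀ F, ∑ D, G z E D * (G z)⁻¹ D F = (1 : Matrix κ κ ℝ) E F := fun F => by
    rw [← h.mul_inv, Matrix.mul_apply]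
  simp only [e2, sum_one_mul]

/-- Compatibility of the Levi-Civita connection with the metric. -/
theorem pd_eq (h : IsMetricNear G z) (C A B : κ) :
    pd C (fun w => G w A B) z = ∑ D, G z A D * christoffel G D C B z
      + ∑ D, G z B D * christoffel G D C A z := by
  rw [h.sum_mul_christoffel, h.sum_mul_christoffel, h.pd_symm C B A, h.pd_symm B C A,
    h.pd_symm A C B]
  ring

theorem contDiffAt_christoffel (h : IsMetricNear G z) (A B C : κ) :
    ContDiffAt ℝ ∞ (christoffel G A B C) z := by
  refine contDiffAt_const.mul (ContDiffAt.sum fun D _ => ?_)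
  exact (contDiffAt_inv_apply h.smooth h.det_ne_zero A D).mul
    ((((h.smooth C D).pd B).add ((h.smooth B D).pd C)).sub ((h.smooth B C).pd D))

theorem riemann_antisymm (G : EuclideanSpace ℝ κ → Matrix κ κ ℝ) (A C D B : κ)
    (z : EuclideanSpace ℝ κ) : riemann G A C D B z = -riemann G A C B D z := by
  have : ∑ F, (christoffel G A B F z * christoffel G F C D z
      - christoffel G A D F z * christoffel G F C B z)
      = -∑ F, (christoffel G A D F z * christoffel G F C B z
      - christoffel G A B F z * christoffel G F C D z) := by
    rw [← Finset.sum_neg_distrib]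
    exact Finset.sum_congr rfl fun F _ => by ring
  rw [riemann, riemann, this]; ring

/-- The lowered curvature tensor in terms of second derivatives of G and products of two Christoffel
symbols, a form in which its symmetries can be read off. It comes from differentiating the lowered
Christoffel symbols and eliminating ∂G by compatibility. -/
theorem sum_mul_riemann (h : ∀ᶠ w in 𝓝 z, IsMetricNear G w) (E C D B : κ) :
    ∑ A, G z E A * riemann G A C D B z
      = 1 / 2 * (pd D (pd C fun w => G w B E) z + pd D (pd B fun w => G w C E) z
          - pd D (pd E fun w => G w C B) z)
        - 1 / 2 * (pd B (pd C fun w => G w D E) z + pd B (pd D fun w => G w C E) z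
          - pd B (pd E fun w => G w C D) z)
        - ∑ A, ∑ F, G z A F * christoffel G F D E z * christoffel G A C B z
        + ∑ A, ∑ F, G z A F * christoffel G F B E z * christoffel G A C D z := by
  have hz := h.self_of_nhds
  have key : ∀ D B, ∑ A, G z E A * pd D (christoffel G A C B) z
      = 1 / 2 * (pd D (pd C fun w => G w B E) z + pd D (pd B fun w => G w C E) z
          - pd D (pd E fun w => G w C B) z)
        - ∑ A, pd D (fun w => G w E A) z * christoffel G A C B z := by
    intro D B
    have h1 : HasGrad (fun w => ∑ A, G w E A * christoffel G A C B w) _ z :=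
      HasGrad.sum (s := Finset.univ) fun A _ =>
        (hz.smooth E A).hasGrad.mul (hz.contDiffAt_christoffel A C B).hasGrad
    have h2 : HasGrad (fun w => 1 / 2 * (pd C (fun w => G w B E) w
        + pd B (fun w => G w C E) w - pd E (fun w => G w C B) w)) _ z :=
      HasGrad.const_mul _ (((((hz.smooth B E).pd C).hasGrad).add
        (((hz.smooth C E).pd B).hasGrad)).sub (((hz.smooth C B).pd E).hasGrad))
    have h3 := h2.congr_eventuallyEq (h.mono fun w hw => hw.sum_mul_christoffel E C B)
    have h4 := (h1.2 D).symm.trans (h3.2 D)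
    dsimp only at h4
    rw [Finset.sum_add_distrib] at h4
    linear_combination h4
  have hpd : ∀ D B, ∑ A, pd D (fun w => G w E A) z * christoffel G A C B z
      = ∑ A, (∑ F, G z E F * christoffel G F D A z) * christoffel G A C B z
        + ∑ A, ∑ F, G z A F * christoffel G F D E z * christoffel G A C B z := by
    intro D B
    rw [← Finset.sum_add_distrib]
    exact Finset.sum_congr rfl fun A _ => by rw [hz.pd_eq, add_mul, Finset.sum_mul, Finset.sum_mul]
  have hquad : ∀ D B, ∑ A, G z E A * ∑ F, christoffel G A D F z * christoffel G F C B z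
      = ∑ A, (∑ F, G z E F * christoffel G F D A z) * christoffel G A C B z := by
    intro D B
    simp only [Finset.mul_sum, Finset.sum_mul]
    rw [Finset.sum_comm]
    exact Finset.sum_congr rfl fun F _ => Finset.sum_congr rfl fun A _ => by ring
  have e : ∀ A, G z E A * riemann G A C D B z
      = G z E A * pd D (christoffel G A C B) z - G z E A * pd B (christoffel G A C D) z
        + G z E A * ∑ F, christoffel G A D F z * christoffel G F C B z
        - G z E A * ∑ F, christoffel G A B F z * christoffel G F C D z := by
    intro A
    rw [riemann, Finset.sum_sub_distrib]; ring
  simp only [e, Finset.sum_add_distrib, Finset.sum_sub_distrib]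
  rw [key, key, hpd, hpd, hquad, hquad]
  ring

/-- The second derivatives of G cancel by symmetry of G and of mixed partials; the quadratic terms
are exchanged by symmetry of G and of the lower indices of Γ. -/
theorem sum_mul_riemann_antisymm (h : ∀ᶠ w in 𝓝 z, IsMetricNear G w) (E C D B : κ) :
    ∑ A, G z E A * riemann G A C D B z = -∑ A, G z C A * riemann G A E D B z := by
  have hz := h.self_of_nhds
  have hsw : ∀ D E C B, ∑ A, ∑ F, G z A F * christoffel G F D E z * christoffel G A C B z
      = ∑ A, ∑ F, G z A F * christoffel G F B C z * christoffel G A E D z := by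
    intro D E C B
    rw [Finset.sum_comm]
    refine Finset.sum_congr rfl fun F _ => Finset.sum_congr rfl fun A _ => ?_
    rw [hz.symm.self_of_nhds A F, hz.christoffel_symm F D E, hz.christoffel_symm A C B]; ring
  have hs : ∀ X Y A B, pd X (pd Y fun w => G w A B) z = pd X (pd Y fun w => G w B A) z :=
    fun X Y A B => pd_congr (h.mono fun w hw => hw.pd_symm Y A B) X
  rw [sum_mul_riemann h, sum_mul_riemann h, hsw D E C B, hsw B E C D]
  linear_combination 1 / 2 * (hs D C B E - hs D E C B - hs B C D E + hs B E C D
    + pd_comm (hz.smooth C E) D B + pd_comm (hz.smooth E C) D B)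

end IsMetricNear
end Metric
end SpacetimePenrose
end

noncomputable section
namespace SpacetimePenrose

/-! ### The Gauss equation for a spacelike hypersurface -/

section Gauss

open Matrix

variable {n : ℕ} {G : EuclideanSpace ℝ (Unit ⊕ Fin n) → Matrix (Unit ⊕ Fin n) (Unit ⊕ Fin n) ℝ}
  {Φ N : EuclideanSpace ℝ (Fin n) → EuclideanSpace ℝ (Unit ⊕ Fin n)}
  {g k : EuclideanSpace ℝ (Fin n) → Matrix (Fin n) (Fin n) ℝ}
  {x : EuclideanSpace ℝ (Fin n)}

/-- The matrix `Γ^A_{BC} ∂ₐ Φ^B` of the pulled back Levi-Civita connection. -/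
def connAlong (G : EuclideanSpace ℝ (Unit ⊕ Fin n) → Matrix (Unit ⊕ Fin n) (Unit ⊕ Fin n) ℝ)
    (Φ : EuclideanSpace ℝ (Fin n) → EuclideanSpace ℝ (Unit ⊕ Fin n)) (a : Fin n)
    (x : EuclideanSpace ℝ (Fin n)) : Matrix (Unit ⊕ Fin n) (Unit ⊕ Fin n) ℝ :=
  Matrix.of fun A C => ∑ B, christoffel G A B C (Φ x) * tangent Φ a B x

/-- The covariant derivative of a vector field along a map. -/
def covAlong (G : EuclideanSpace ℝ (Unit ⊕ Fin n) → Matrix (Unit ⊕ Fin n) (Unit ⊕ Fin n) ℝ)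
    (Φ : EuclideanSpace ℝ (Fin n) → EuclideanSpace ℝ (Unit ⊕ Fin n)) (a : Fin n)
    (V : EuclideanSpace ℝ (Fin n) → Unit ⊕ Fin n → ℝ)
    (x : EuclideanSpace ℝ (Fin n)) : Unit ⊕ Fin n → ℝ :=
  fun A => pd a (fun y => V y A) x + (connAlong G Φ a x *ᵥ V x) A

theorem covAlong_tangent (i j : Fin n) (A : Unit ⊕ Fin n) :
    covAlong G Φ i (fun y A => tangent Φ j A y) x A = accel G Φ i j A x := by
  rw [covAlong, accel, Finset.sum_comm]
  congr 1
  simp only [mulVec, dotProduct, connAlong, of_apply, Finset.sum_mul]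

theorem contDiffAt_apply {κ : Type*} [Fintype κ] {E : Type*} [NormedAddCommGroup E]
    [NormedSpace ℝ E] {Φ : E → EuclideanSpace ℝ κ} {x : E} (h : ContDiffAt ℝ ∞ Φ x) (A : κ) :
    ContDiffAt ℝ ∞ (fun y => Φ y A) x :=
  (contDiffAt_piLp 2).1 h A

/-- The product rule for the metric pairing of two vector fields along Φ, that is, metric
compatibility of the pulled back connection. -/
theorem hasGrad_pairing (hG : IsMetricNear G (Φ x)) (hΦ : DifferentiableAt ℝ Φ x)
    {V W : EuclideanSpace ℝ (Fin n) → Unit ⊕ Fin n → ℝ}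
    (hV : ∀ A, DifferentiableAt ℝ (fun y => V y A) x)
    (hW : ∀ A, DifferentiableAt ℝ (fun y => W y A) x) :
    HasGrad (fun y => V y ⬝ᵥ G (Φ y) *ᵥ W y)
      (fun a => covAlong G Φ a V x ⬝ᵥ G (Φ x) *ᵥ W x
        + V x ⬝ᵥ G (Φ x) *ᵥ covAlong G Φ a W x) x := by
  have h1 : HasGrad (fun y => ∑ A, V y A * ∑ B, G (Φ y) A B * W y B) _ x :=
    HasGrad.sum (s := Finset.univ) fun A _ => (hV A).hasGrad.mul <|
      HasGrad.sum (s := Finset.univ) fun B _ =>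
        (pd_comp ((hG.smooth A B).differentiableAt (by simp)) hΦ).mul (hW B).hasGrad
  refine h1.congr_grad fun a => ?_
  set C := connAlong G Φ a x with hC
  -- Compatibility along Φ in matrix form: the derivative of G ∘ Φ is G C + Cᵀ G.
  have hM : (Matrix.of fun A B => ∑ D, pd D (fun w => G w A B) (Φ x) * pd a (fun y => Φ y D) x)
      = G (Φ x) * C + Cᵀ * G (Φ x) := by
    ext A B
    simp only [of_apply, Matrix.add_apply, Matrix.mul_apply, hG.pd_eq, add_mul,
      Finset.sum_add_distrib, Finset.sum_mul, hC, connAlong, Finset.mul_sum, transpose_apply]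
    rw [Finset.sum_comm, Finset.sum_comm (f := fun D F => _ * christoffel G F D A _ * _)]
    congr 1
    · exact Finset.sum_congr rfl fun F _ => Finset.sum_congr rfl fun D _ => by
        rw [tangent]; ring
    · exact Finset.sum_congr rfl fun F _ => Finset.sum_congr rfl fun D _ => by
        rw [tangent, hG.symm.self_of_nhds B F]; ring
  have e1 : covAlong G Φ a V x = (fun A => pd a (fun y => V y A) x) + C *ᵥ V x := rfl
  have e2 : covAlong G Φ a W x = (fun A => pd a (fun y => W y A) x) + C *ᵥ W x := rfl
  have e3 : (C *ᵥ V x) ⬝ᵥ G (Φ x) *ᵥ W x = V x ⬝ᵥ (Cᵀ * G (Φ x)) *ᵥ W x := by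
    rw [← mulVec_mulVec, dotProduct_mulVec (V x) Cᵀ, vecMul_transpose]
  rw [e1, e2, add_dotProduct, mulVec_add, dotProduct_add, e3, mulVec_mulVec]
  have e4 : V x ⬝ᵥ (G (Φ x) * C) *ᵥ W x + V x ⬝ᵥ (Cᵀ * G (Φ x)) *ᵥ W x
      = V x ⬝ᵥ (Matrix.of fun A B => ∑ D, pd D (fun w => G w A B) (Φ x)
        * pd a (fun y => Φ y D) x) *ᵥ W x := by
    rw [hM, add_mulVec, dotProduct_add]
  trans ((fun A => pd a (fun y => V y A) x) ⬝ᵥ G (Φ x) *ᵥ W x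
    + V x ⬝ᵥ G (Φ x) *ᵥ (fun A => pd a (fun y => W y A) x)
    + (V x ⬝ᵥ (G (Φ x) * C) *ᵥ W x + V x ⬝ᵥ (Cᵀ * G (Φ x)) *ᵥ W x))
  · rw [e4]
    simp only [dotProduct, mulVec, of_apply, Finset.sum_add_distrib, mul_add]
    rw [add_right_comm, add_assoc]
  · ring

/-- The curvature of the pulled back connection is the pulled back curvature. In the commutator the
second derivatives of Φ and of V drop out, as do the mixed terms with a first derivative of V; what
remains is ∂Γ + ΓΓ. -/
theorem covAlong_covAlong_sub (hG : ∀ᶠ w in 𝓝 (Φ x), IsMetricNear G w)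
    (hΦ : ContDiffAt ℝ ∞ Φ x) {V : EuclideanSpace ℝ (Fin n) → Unit ⊕ Fin n → ℝ}
    (hV : ∀ A, ContDiffAt ℝ ∞ (fun y => V y A) x) (a b : Fin n) (A : Unit ⊕ Fin n) :
    covAlong G Φ a (covAlong G Φ b V) x A - covAlong G Φ b (covAlong G Φ a V) x A
      = ∑ C, (∑ D, ∑ B, riemann G A C D B (Φ x) * tangent Φ a D x * tangent Φ b B x) * V x C := by
  have hz := hG.self_of_nhds
  have hd := hΦ.differentiableAt (by simp)
  have ht : ∀ b B, ContDiffAt ℝ ∞ (tangent Φ b B) x := fun b B => (contDiffAt_apply hΦ B).pd b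
  have hconn : ∀ b A C, HasGrad (fun y => connAlong G Φ b y A C) (fun a => ∑ B,
      ((∑ D, pd D (christoffel G A B C) (Φ x) * pd a (fun y => Φ y D) x) * tangent Φ b B x
        + christoffel G A B C (Φ x) * pd a (tangent Φ b B) x)) x := fun b A C =>
    HasGrad.sum (s := Finset.univ) fun B _ =>
      (pd_comp ((hz.contDiffAt_christoffel A B C).differentiableAt (by simp)) hd).mul
        (ht b B).hasGrad
  have hcov : ∀ a b, covAlong G Φ a (covAlong G Φ b V) x A
      = pd a (pd b fun y => V y A) x
        + (∑ C, (∑ B, ((∑ D, pd D (christoffel G A B C) (Φ x) * tangent Φ a D x)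
            * tangent Φ b B x + christoffel G A B C (Φ x) * pd a (tangent Φ b B) x)) * V x C
          + ∑ C, connAlong G Φ b x A C * pd a (fun y => V y C) x)
        + (∑ F, connAlong G Φ a x A F * pd b (fun y => V y F) x
          + ∑ C, (∑ F, connAlong G Φ a x A F * connAlong G Φ b x F C) * V x C) := by
    intro a b
    have h1 : HasGrad (fun y => covAlong G Φ b V y A) _ x :=
      ((hV A).pd b).hasGrad.add (HasGrad.sum (s := Finset.univ) fun C _ =>
        (hconn b A C).mul (hV C).hasGrad)
    rw [covAlong, h1.2 a]
    dsimp only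
    rw [Finset.sum_add_distrib]
    congr 1
    have : covAlong G Φ b V x = (fun A => pd b (fun y => V y A) x) + connAlong G Φ b x *ᵥ V x := rfl
    rw [this, mulVec_add, mulVec_mulVec]
    rfl
  have hprod : ∀ a b C, ∑ F, connAlong G Φ a x A F * connAlong G Φ b x F C
      = ∑ D, ∑ B, (∑ F, christoffel G A D F (Φ x) * christoffel G F B C (Φ x))
        * tangent Φ a D x * tangent Φ b B x := by
    intro a b C
    simp only [connAlong, of_apply, Finset.mul_sum, Finset.sum_mul]
    rw [Finset.sum_comm_cycle]
    refine Finset.sum_congr rfl fun D _ => ?_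
    rw [Finset.sum_comm]
    exact Finset.sum_congr rfl fun B _ => Finset.sum_congr rfl fun F _ => by ring
  have hΓ : ∀ A B C D, pd D (christoffel G A B C) (Φ x) = pd D (christoffel G A C B) (Φ x) :=
    fun A B C D => pd_congr (hG.mono fun w hw => hw.christoffel_symm A B C) D
  have hD : ∀ a b C, ∑ B, ((∑ D, pd D (christoffel G A B C) (Φ x) * tangent Φ a D x)
            * tangent Φ b B x + christoffel G A B C (Φ x) * pd a (tangent Φ b B) x)
      = ∑ D, ∑ B, pd D (christoffel G A C B) (Φ x) * tangent Φ a D x * tangent Φ b B x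
        + ∑ B, christoffel G A B C (Φ x) * pd a (tangent Φ b B) x := by
    intro a b C
    rw [Finset.sum_add_distrib]
    congr 1
    rw [Finset.sum_comm]
    exact Finset.sum_congr rfl fun B _ => by
      rw [Finset.sum_mul]; exact Finset.sum_congr rfl fun D _ => by rw [hΓ]
  have hR : ∀ C, ∑ D, ∑ B, riemann G A C D B (Φ x) * tangent Φ a D x * tangent Φ b B x
      = ∑ D, ∑ B, pd D (christoffel G A C B) (Φ x) * tangent Φ a D x * tangent Φ b B x
        - ∑ D, ∑ B, pd D (christoffel G A C B) (Φ x) * tangent Φ b D x * tangent Φ a B x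
        + ∑ D, ∑ B, (∑ F, christoffel G A D F (Φ x) * christoffel G F B C (Φ x))
          * tangent Φ a D x * tangent Φ b B x
        - ∑ D, ∑ B, (∑ F, christoffel G A D F (Φ x) * christoffel G F B C (Φ x))
          * tangent Φ b D x * tangent Φ a B x := by
    intro C
    rw [Finset.sum_comm (f := fun D B => pd D (christoffel G A C B) (Φ x) * tangent Φ b D x
        * tangent Φ a B x),
      Finset.sum_comm (f := fun D B => (∑ F, christoffel G A D F (Φ x)
        * christoffel G F B C (Φ x)) * tangent Φ b D x * tangent Φ a B x)]
    simp only [← Finset.sum_sub_distrib, ← Finset.sum_add_distrib]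
    refine Finset.sum_congr rfl fun D _ => Finset.sum_congr rfl fun B _ => ?_
    rw [riemann, Finset.sum_sub_distrib]
    simp only [hz.christoffel_symm _ C B, hz.christoffel_symm _ C D]
    ring
  rw [hcov, hcov]
  simp only [hprod, hD, hR, add_mul, sub_mul, Finset.sum_add_distrib, Finset.sum_sub_distrib]
  have hc : ∀ B, pd a (tangent Φ b B) x = pd b (tangent Φ a B) x := fun B =>
    pd_comm (contDiffAt_apply hΦ B) a b
  simp only [hc, pd_comm (hV A) a b]
  ring

end Gauss

end SpacetimePenrose
end

noncomputable section
namespace SpacetimePenrose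

/-! ### Adapted frames and the Gauss equation -/

section Gauss

open Matrix

variable {n : ℕ} {G : EuclideanSpace ℝ (Unit ⊕ Fin n) → Matrix (Unit ⊕ Fin n) (Unit ⊕ Fin n) ℝ}
  {Φ N : EuclideanSpace ℝ (Fin n) → EuclideanSpace ℝ (Unit ⊕ Fin n)}
  {g k : EuclideanSpace ℝ (Fin n) → Matrix (Fin n) (Fin n) ℝ}
  {x : EuclideanSpace ℝ (Fin n)}

/-- At `x`, the map `Φ` induces the metric `g` and the second fundamental form `k` with respect to
the timelike unit normal `N`. -/
structure IsSpacelikeAt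
    (G : EuclideanSpace ℝ (Unit ⊕ Fin n) → Matrix (Unit ⊕ Fin n) (Unit ⊕ Fin n) ℝ)
    (Φ N : EuclideanSpace ℝ (Fin n) → EuclideanSpace ℝ (Unit ⊕ Fin n))
    (g k : EuclideanSpace ℝ (Fin n) → Matrix (Fin n) (Fin n) ℝ)
    (x : EuclideanSpace ℝ (Fin n)) : Prop where
  ambient : ∀ᶠ w in 𝓝 (Φ x), IsMetricNear G w
  metric : IsMetricNear g x
  smooth : ContDiffAt ℝ ∞ Φ x
  induced : ∀ i j, ∑ A, ∑ B, G (Φ x) A B * tangent Φ i A x * tangent Φ j B x = g x i j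
  normal : ∀ i, ∑ A, ∑ B, G (Φ x) A B * N x A * tangent Φ i B x = 0
  unit : ∑ A, ∑ B, G (Φ x) A B * N x A * N x B = -1
  second : ∀ i j, -∑ A, ∑ B, G (Φ x) A B * N x A * accel G Φ i j B x = k x i j

theorem sum_sum_eq_dotProduct {κ : Type*} [Fintype κ] (M : Matrix κ κ ℝ) (V W : κ → ℝ) :
    ∑ A, ∑ B, M A B * V A * W B = V ⬝ᵥ M *ᵥ W := by
  simp only [dotProduct, mulVec, Finset.mul_sum]
  exact Finset.sum_congr rfl fun A _ => Finset.sum_congr rfl fun B _ => by ring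

theorem sum_sum_comm {α β M : Type*} [Fintype α] [Fintype β] [AddCommMonoid M]
    (f : α → α → β → β → M) :
    ∑ a, ∑ b, ∑ i, ∑ j, f a b i j = ∑ i, ∑ j, ∑ a, ∑ b, f a b i j := by
  have h : ∀ a, ∑ b, ∑ i, ∑ j, f a b i j = ∑ i, ∑ j, ∑ b, f a b i j := fun a =>
    Finset.sum_comm_cycle.symm
  simp only [h]
  exact Finset.sum_comm_cycle.symm

theorem dotProduct_mulVec_symm {κ : Type*} [Fintype κ] {M : Matrix κ κ ℝ}
    (h : ∀ A B, M A B = M B A) (V W : κ → ℝ) : V ⬝ᵥ M *ᵥ W = W ⬝ᵥ M *ᵥ V := by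
  have hM : Mᵀ = M := by ext A B; exact h B A
  rw [dotProduct_mulVec, ← mulVec_transpose, hM, dotProduct_comm]

/-- The inverse of a Lorentzian inner product in terms of an adapted frame. -/
theorem inv_eq_of_frame {M : Matrix (Unit ⊕ Fin n) (Unit ⊕ Fin n) ℝ} {q : Matrix (Fin n) (Fin n) ℝ}
    (hM : ∀ A B, M A B = M B A) (hq : q.det ≠ 0)
    {V : Unit ⊕ Fin n → ℝ} {e : Fin n → Unit ⊕ Fin n → ℝ}
    (hV : V ⬝ᵥ M *ᵥ V = -1) (hVe : ∀ i, V ⬝ᵥ M *ᵥ e i = 0) (he : ∀ i j, e i ⬝ᵥ M *ᵥ e j = q i j)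
    (A B : Unit ⊕ Fin n) :
    M⁻¹ A B = ∑ i, ∑ j, q⁻¹ i j * e i A * e j B - V A * V B := by
  -- The columns of W are V and the eᵢ. Then Wᵀ M W is block diagonal with blocks -1 and q, so M⁻¹ =
  -- W diag(-1, q⁻¹) Wᵀ.
  set W : Matrix (Unit ⊕ Fin n) (Unit ⊕ Fin n) ℝ :=
    Matrix.of fun A X => Sum.elim (fun _ => V A) (fun i => e i A) X with hW
  have h1 : Wᵀ * (M * W) = Matrix.fromBlocks (-1) 0 0 q := by
    have hent : ∀ X Y, (Wᵀ * (M * W)) X Y = (fun A => W A X) ⬝ᵥ M *ᵥ (fun A => W A Y) := by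
      intro X Y; rfl
    ext X Y
    rw [hent]
    rcases X with _ | i <;> rcases Y with _ | j
    · simpa [hW] using hV
    · simpa [hW] using hVe j
    · simpa [hW] using (dotProduct_mulVec_symm hM (e i) V).trans (hVe i)
    · simpa [hW] using he i j
  have h2 : Matrix.fromBlocks (-1 : Matrix Unit Unit ℝ) 0 0 q⁻¹ * Matrix.fromBlocks (-1) 0 0 q = 1 := by
    rw [Matrix.fromBlocks_multiply]
    simp [Matrix.nonsing_inv_mul _ (isUnit_iff_ne_zero.2 hq)]
  have h3 : (Matrix.fromBlocks (-1 : Matrix Unit Unit ℝ) 0 0 q⁻¹ * Wᵀ * M) * W = 1 := by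
    rw [Matrix.mul_assoc, Matrix.mul_assoc, h1, h2]
  have h4 : (W * (Matrix.fromBlocks (-1 : Matrix Unit Unit ℝ) 0 0 q⁻¹ * Wᵀ)) * M = 1 := by
    rw [Matrix.mul_assoc]; exact mul_eq_one_comm.1 h3
  rw [Matrix.inv_eq_left_inv h4, ← Matrix.mul_assoc, Matrix.mul_apply]
  simp only [Matrix.mul_apply, Fintype.sum_sum_type, Finset.sum_mul]
  rw [Finset.sum_comm]
  simp only [hW, of_apply, transpose_apply, Sum.elim_inl, Sum.elim_inr, fromBlocks_apply₁₁,
    fromBlocks_apply₁₂, fromBlocks_apply₂₁, fromBlocks_apply₂₂, Matrix.zero_apply, zero_mul,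
    mul_zero, Finset.sum_const_zero, add_zero, zero_add, Finset.univ_unique, Finset.sum_singleton,
    Matrix.neg_apply, Matrix.one_apply_eq]
  have e1 : ∀ i j, e i A * q⁻¹ i j * e j B = q⁻¹ i j * e i A * e j B := fun i j => by ring
  simp only [Finset.sum_mul, e1]
  ring

namespace IsSpacelikeAt

theorem accel_symm (h : IsSpacelikeAt G Φ N g k x) (i j : Fin n) (A : Unit ⊕ Fin n) :
    accel G Φ i j A x = accel G Φ j i A x := by
  have h1 : pd i (tangent Φ j A) x = pd j (tangent Φ i A) x :=
    pd_comm (contDiffAt_apply h.smooth A) i j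
  rw [accel, accel, h1, Finset.sum_comm]
  congr 1
  refine Finset.sum_congr rfl fun B _ => Finset.sum_congr rfl fun C _ => ?_
  rw [h.ambient.self_of_nhds.christoffel_symm]; ring

theorem contDiffAt_tangent (h : IsSpacelikeAt G Φ N g k x) (i : Fin n) (A : Unit ⊕ Fin n) :
    ContDiffAt ℝ ∞ (tangent Φ i A) x := (contDiffAt_apply h.smooth A).pd i

theorem induced_eq (h : IsSpacelikeAt G Φ N g k x) (i j : Fin n) :
    (fun A => tangent Φ i A x) ⬝ᵥ G (Φ x) *ᵥ (fun A => tangent Φ j A x) = g x i j := by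
  rw [← h.induced i j, ← sum_sum_eq_dotProduct]

/-- The tangential part of the ambient derivative of a coordinate field is the Levi-Civita
connection of the induced metric. The reason is the Koszul computation: differentiate the pairings
of tangent vectors and take the cyclic combination. -/
theorem accel_dot_tangent (h : ∀ᶠ y in 𝓝 x, IsSpacelikeAt G Φ N g k y) (i j m : Fin n) :
    (fun A => accel G Φ i j A x) ⬝ᵥ G (Φ x) *ᵥ (fun A => tangent Φ m A x)
      = ∑ l, g x m l * christoffel g l i j x := by
  have hx := h.self_of_nhds
  have hsymm := hx.ambient.self_of_nhds.symm.self_of_nhds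
  have hpd : ∀ i j m, pd i (fun y => g y j m) x
      = (fun A => accel G Φ i j A x) ⬝ᵥ G (Φ x) *ᵥ (fun A => tangent Φ m A x)
        + (fun A => accel G Φ i m A x) ⬝ᵥ G (Φ x) *ᵥ (fun A => tangent Φ j A x) := by
    intro i j m
    have h1 := (hasGrad_pairing hx.ambient.self_of_nhds (hx.smooth.differentiableAt (by simp))
      (V := fun y A => tangent Φ j A y) (W := fun y A => tangent Φ m A y)
      (fun A => (hx.contDiffAt_tangent j A).differentiableAt (by simp))
      (fun A => (hx.contDiffAt_tangent m A).differentiableAt (by simp))).congr_eventuallyEq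
        (h.mono fun y hy => (hy.induced_eq j m).symm)
    rw [h1.2 i]
    dsimp only
    rw [dotProduct_mulVec_symm hsymm _ (covAlong _ _ _ _ _)]
    simp only [funext fun A => covAlong_tangent (G := G) (Φ := Φ) (x := x) i j A,
      funext fun A => covAlong_tangent (G := G) (Φ := Φ) (x := x) i m A]
  have hs : ∀ i j m, (fun A => accel G Φ i j A x) ⬝ᵥ G (Φ x) *ᵥ (fun A => tangent Φ m A x)
      = (fun A => accel G Φ j i A x) ⬝ᵥ G (Φ x) *ᵥ (fun A => tangent Φ m A x) := fun i j m => by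
    simp only [hx.accel_symm i j]
  rw [hx.metric.sum_mul_christoffel, hpd, hpd, hpd, hs j i m, hs m i j, hs m j i]
  ring

theorem normal_dot_accel (h : IsSpacelikeAt G Φ N g k x) (i j : Fin n) :
    (fun A => accel G Φ i j A x) ⬝ᵥ G (Φ x) *ᵥ (N x).ofLp = -k x i j := by
  rw [dotProduct_mulVec_symm h.ambient.self_of_nhds.symm.self_of_nhds, ← h.second i j, neg_neg,
    ← sum_sum_eq_dotProduct]

theorem inv_eq (h : IsSpacelikeAt G Φ N g k x) (A B : Unit ⊕ Fin n) :
    (G (Φ x))⁻¹ A B = ∑ i, ∑ j, (g x)⁻¹ i j * tangent Φ i A x * tangent Φ j B x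
      - N x A * N x B :=
  inv_eq_of_frame h.ambient.self_of_nhds.symm.self_of_nhds h.metric.det_ne_zero
    (e := fun i A => tangent Φ i A x)
    (by rw [← sum_sum_eq_dotProduct]; exact h.unit)
    (fun i => by rw [← sum_sum_eq_dotProduct]; exact h.normal i) h.induced_eq A B

/-- Splitting both vectors into tangential and normal parts; the minus sign reflects that the unit
normal is timelike. -/
theorem dot_eq (h : IsSpacelikeAt G Φ N g k x) (V W : Unit ⊕ Fin n → ℝ) :
    V ⬝ᵥ G (Φ x) *ᵥ W
      = ∑ i, ∑ j, (g x)⁻¹ i j * (V ⬝ᵥ G (Φ x) *ᵥ fun A => tangent Φ i A x)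
          * (W ⬝ᵥ G (Φ x) *ᵥ fun A => tangent Φ j A x)
        - (V ⬝ᵥ G (Φ x) *ᵥ (N x).ofLp) * (W ⬝ᵥ G (Φ x) *ᵥ (N x).ofLp) := by
  have hG := h.ambient.self_of_nhds
  have hs := hG.symm.self_of_nhds
  have hsw : ∀ X Y, X ⬝ᵥ G (Φ x) *ᵥ Y = (G (Φ x) *ᵥ X) ⬝ᵥ Y := fun X Y => by
    rw [dotProduct_mulVec_symm hs, dotProduct_comm]
  have h1 : V ⬝ᵥ G (Φ x) *ᵥ W = (G (Φ x) *ᵥ V) ⬝ᵥ (G (Φ x))⁻¹ *ᵥ (G (Φ x) *ᵥ W) := by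
    rw [mulVec_mulVec, hG.inv_mul, one_mulVec, hsw]
  rw [h1, ← sum_sum_eq_dotProduct]
  simp only [hsw _ (N x).ofLp, hsw _ fun A => tangent Φ _ A x, h.inv_eq]
  generalize G (Φ x) *ᵥ V = p
  generalize G (Φ x) *ᵥ W = q
  simp only [sub_mul, Finset.sum_sub_distrib, Finset.sum_mul]
  congr 1
  · rw [sum_sum_comm]
    refine Finset.sum_congr rfl fun i _ => Finset.sum_congr rfl fun j _ => ?_
    rw [mul_assoc, dotProduct, dotProduct, Finset.sum_mul_sum, Finset.mul_sum]
    refine Finset.sum_congr rfl fun A _ => ?_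
    rw [Finset.mul_sum]
    exact Finset.sum_congr rfl fun B _ => by ring
  · rw [dotProduct, dotProduct, Finset.sum_mul_sum]
    exact Finset.sum_congr rfl fun A _ => Finset.sum_congr rfl fun B _ => by ring

/-- Near x the pairing of ∇_b ∂_c with ∂_d equals the lowered intrinsic Christoffel symbol.
Differentiating this in direction a leaves the pairing of ∇_b ∂_c with ∇_a ∂_d. Its tangential part
joins the intrinsic terms, while its normal part is -k_{bc} k_{ad}. -/
theorem covAlong_covAlong_dot (h : ∀ᶠ y in 𝓝 x, IsSpacelikeAt G Φ N g k y) (a b c d : Fin n) :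
    covAlong G Φ a (covAlong G Φ b fun y A => tangent Φ c A y) x
        ⬝ᵥ G (Φ x) *ᵥ (fun A => tangent Φ d A x)
      = ∑ l, g x d l * (pd a (christoffel g l b c) x
          + ∑ m, christoffel g l a m x * christoffel g m b c x) + k x b c * k x a d := by
  have hx := h.self_of_nhds
  have hG := hx.ambient.self_of_nhds
  have hcov : ∀ A, ContDiffAt ℝ ∞ (fun y => covAlong G Φ b (fun y A => tangent Φ c A y) y A) x := by
    intro A
    refine ((hx.contDiffAt_tangent c A).pd b).add
      (f := pd b (tangent Φ c A)) (g := fun y => ∑ C, connAlong G Φ b y A C * tangent Φ c C y)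
      (ContDiffAt.sum fun C _ => ?_)
    refine ContDiffAt.mul (f := fun y => ∑ B, christoffel G A B C (Φ y) * tangent Φ b B y)
      (ContDiffAt.sum fun B _ => ?_) (hx.contDiffAt_tangent c C)
    exact ((hG.contDiffAt_christoffel A B C).comp x hx.smooth).mul (hx.contDiffAt_tangent b B)
  have h1 := hasGrad_pairing hG (hx.smooth.differentiableAt (by simp))
    (W := fun y A => tangent Φ d A y) (fun A => (hcov A).differentiableAt (by simp))
    (fun A => (hx.contDiffAt_tangent d A).differentiableAt (by simp))
  have h2 : HasGrad (fun y => ∑ l, g y d l * christoffel g l b c y) _ x :=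
    HasGrad.sum (s := Finset.univ) fun l _ =>
      (hx.metric.smooth d l).hasGrad.mul (hx.metric.contDiffAt_christoffel l b c).hasGrad
  have hcv : ∀ y b c, covAlong G Φ b (fun y A => tangent Φ c A y) y
      = fun A => accel G Φ b c A y := fun y b c => funext fun A => covAlong_tangent b c A
  have h3 := h2.congr_eventuallyEq (g := fun y => covAlong G Φ b (fun y A => tangent Φ c A y) y
      ⬝ᵥ G (Φ y) *ᵥ fun A => tangent Φ d A y) (h.eventually_nhds.mono fun y hy => by
    dsimp only
    rw [hcv]
    exact accel_dot_tangent hy b c d)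
  have h4 := (h1.2 a).symm.trans (h3.2 a)
  dsimp only at h4
  have h5 : covAlong G Φ b (fun y A => tangent Φ c A y) x
      ⬝ᵥ G (Φ x) *ᵥ covAlong G Φ a (fun y A => tangent Φ d A y) x
      = ∑ l, (∑ m, g x l m * christoffel g m a d x) * christoffel g l b c x
        - k x b c * k x a d := by
    rw [hcv, hcv, hx.dot_eq, hx.normal_dot_accel, hx.normal_dot_accel]
    simp only [accel_dot_tangent h]
    rw [Finset.sum_comm, neg_mul_neg]
    congr 1
    refine Finset.sum_congr rfl fun j _ => ?_
    rw [← Finset.sum_mul, mul_comm]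
    congr 1
    have h6 : ∀ l, ∑ i, (g x)⁻¹ i j * g x i l = (1 : Matrix (Fin n) (Fin n) ℝ) j l := fun l => by
      rw [← hx.metric.inv_mul, Matrix.mul_apply]
      exact Finset.sum_congr rfl fun i _ => by rw [hx.metric.inv_symm]
    simp only [Finset.mul_sum]
    rw [Finset.sum_comm]
    simp only [← mul_assoc, ← Finset.sum_mul, h6, sum_one_mul]
  have h7 : ∀ l, pd a (fun y => g y d l) x = ∑ m, g x d m * christoffel g m a l x
      + ∑ m, g x l m * christoffel g m a d x := fun l => hx.metric.pd_eq a d l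
  rw [h5] at h4
  simp only [h7, add_mul, mul_add, Finset.sum_add_distrib] at h4 ⊢
  have h8 : ∑ l, g x d l * ∑ m, christoffel g l a m x * christoffel g m b c x
      = ∑ l, (∑ m, g x d m * christoffel g m a l x) * christoffel g l b c x := by
    simp only [Finset.mul_sum, Finset.sum_mul]
    rw [Finset.sum_comm]
    exact Finset.sum_congr rfl fun _ _ => Finset.sum_congr rfl fun _ _ => by ring
  rw [h8]
  linear_combination h4

/-- Antisymmetrizing the preceding formula in a and b turns its left side into the ambient curvature
and the Christoffel terms on the right into the intrinsic one. The sign of the quadratic terms in k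
is the one for a timelike normal. -/
theorem gauss (h : ∀ᶠ y in 𝓝 x, IsSpacelikeAt G Φ N g k y) (a b c d : Fin n) :
    ∑ F, ∑ C, ∑ D, ∑ B, (∑ A, G (Φ x) F A * riemann G A C D B (Φ x)) * tangent Φ d F x
        * tangent Φ c C x * tangent Φ a D x * tangent Φ b B x
      = ∑ l, g x d l * riemann g l c a b x + k x b c * k x a d - k x a c * k x b d := by
  have hx := h.self_of_nhds
  have h1 := covAlong_covAlong_dot h a b c d
  have h2 := covAlong_covAlong_dot h b a c d
  have h3 : covAlong G Φ a (covAlong G Φ b fun y A => tangent Φ c A y) x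
        ⬝ᵥ G (Φ x) *ᵥ (fun A => tangent Φ d A x)
      - covAlong G Φ b (covAlong G Φ a fun y A => tangent Φ c A y) x
        ⬝ᵥ G (Φ x) *ᵥ (fun A => tangent Φ d A x)
      = ∑ F, ∑ C, ∑ D, ∑ B, (∑ A, G (Φ x) F A * riemann G A C D B (Φ x)) * tangent Φ d F x
        * tangent Φ c C x * tangent Φ a D x * tangent Φ b B x := by
    rw [← sub_dotProduct, ← sum_sum_eq_dotProduct, Finset.sum_comm]
    refine Finset.sum_congr rfl fun F _ => ?_
    have h4 : ∀ A, (covAlong G Φ a (covAlong G Φ b fun y A => tangent Φ c A y) x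
        - covAlong G Φ b (covAlong G Φ a fun y A => tangent Φ c A y) x) A = _ := fun A =>
      covAlong_covAlong_sub hx.ambient hx.smooth (hx.contDiffAt_tangent c) a b A
    simp only [h4, Finset.mul_sum, Finset.sum_mul]
    rw [Finset.sum_comm]
    refine Finset.sum_congr rfl fun C _ => ?_
    rw [Finset.sum_comm]
    refine Finset.sum_congr rfl fun D _ => ?_
    rw [Finset.sum_comm]
    refine Finset.sum_congr rfl fun B _ => Finset.sum_congr rfl fun A _ => ?_
    rw [hx.ambient.self_of_nhds.symm.self_of_nhds A F]
    ring
  rw [← h3, h1, h2]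
  have h5 : ∀ l, riemann g l c a b x = pd a (christoffel g l b c) x
      + ∑ m, christoffel g l a m x * christoffel g m b c x
      - (pd b (christoffel g l a c) x
      + ∑ m, christoffel g l b m x * christoffel g m a c x) := by
    intro l
    have hm : ∀ᶠ y in 𝓝 x, IsMetricNear g y := h.mono fun y hy => hy.metric
    rw [riemann, Finset.sum_sub_distrib, pd_congr (hm.mono fun w hw => hw.christoffel_symm l c b) a,
      pd_congr (hm.mono fun w hw => hw.christoffel_symm l c a) b]
    simp only [hx.metric.christoffel_symm _ c b, hx.metric.christoffel_symm _ c a]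
    ring
  simp only [h5, mul_sub, Finset.sum_sub_distrib]
  ring

end IsSpacelikeAt

end Gauss

end SpacetimePenrose
end

noncomputable section
namespace SpacetimePenrose

/-! ### Contraction of the Gauss equation: the Hamiltonian constraint -/

section Gauss

open Matrix

theorem sum_contract {ι κ : Type*} [Fintype ι] [Fintype κ] (R : κ → κ → κ → κ → ℝ) (e : ι → κ → ℝ)
    (q : ι → ι → ℝ) :
    ∑ a, ∑ d, ∑ b, ∑ c, q a d * q b c * ∑ F, ∑ C, ∑ D, ∑ B, R F C D B * e d F * e c C * e a D * e b B
      = ∑ F, ∑ C, ∑ D, ∑ B, R F C D B * (∑ a, ∑ d, q a d * e a D * e d F)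
          * (∑ b, ∑ c, q b c * e b B * e c C) := by
  have hcomm : ∀ f : κ → κ → κ → κ → ι → ι → ℝ,
      ∑ F, ∑ C, ∑ D, ∑ B, ∑ a, ∑ d, f F C D B a d = ∑ a, ∑ d, ∑ F, ∑ C, ∑ D, ∑ B, f F C D B a d :=
    fun f => (Finset.sum_congr rfl fun F _ => Finset.sum_congr rfl fun C _ =>
      sum_sum_comm _).trans (sum_sum_comm fun F C a d => ∑ D, ∑ B, f F C D B a d)
  have hexp : ∀ F C D B, R F C D B * (∑ a, ∑ d, q a d * e a D * e d F)
          * (∑ b, ∑ c, q b c * e b B * e c C)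
      = ∑ a, ∑ d, ∑ b, ∑ c, q a d * q b c * (R F C D B * e d F * e c C * e a D * e b B) := by
    intro F C D B
    rw [mul_assoc, Finset.sum_mul, Finset.mul_sum]
    refine Finset.sum_congr rfl fun a _ => ?_
    rw [Finset.sum_mul, Finset.mul_sum]
    refine Finset.sum_congr rfl fun d _ => ?_
    rw [Finset.mul_sum, Finset.mul_sum]
    refine Finset.sum_congr rfl fun b _ => ?_
    rw [Finset.mul_sum, Finset.mul_sum]
    exact Finset.sum_congr rfl fun c _ => by ring
  simp only [hexp]
  rw [hcomm fun F C D B a d => ∑ b, ∑ c, q a d * q b c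
    * (R F C D B * e d F * e c C * e a D * e b B)]
  refine Finset.sum_congr rfl fun a _ => Finset.sum_congr rfl fun d _ => ?_
  rw [hcomm]
  refine Finset.sum_congr rfl fun b _ => Finset.sum_congr rfl fun c _ => ?_
  simp only [Finset.mul_sum]

/-- Contracting a curvature tensor twice with q + V V gives its Ricci contractions, which vanish by
assumption, and a term of fourth order in V, which vanishes by antisymmetry. -/
theorem sum_contract_eq_zero {κ : Type*} [Fintype κ] {R : κ → κ → κ → κ → ℝ} {q : κ → κ → ℝ}
    (hanti : ∀ F C D B, R F C D B = -R F C B D) (hanti' : ∀ F C D B, R F C D B = -R C F D B)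
    (hric : ∀ C B, ∑ F, ∑ D, R F C D B * q D F = 0) (V : κ → ℝ) :
    ∑ F, ∑ C, ∑ D, ∑ B, R F C D B * (q D F + V D * V F) * (q B C + V B * V C) = 0 := by
  have h1 : ∑ F, ∑ C, ∑ D, ∑ B, R F C D B * q D F * (q B C + V B * V C) = 0 := by
    rw [Finset.sum_comm]
    refine Finset.sum_eq_zero fun C _ => ?_
    rw [Finset.sum_comm_cycle]
    refine Finset.sum_eq_zero fun B _ => ?_
    simp only [← Finset.sum_mul, hric, zero_mul]
  have h2 : ∑ F, ∑ C, ∑ D, ∑ B, R F C D B * (V D * V F) * q B C = 0 := by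
    refine Finset.sum_eq_zero fun F _ => ?_
    rw [Finset.sum_comm]
    refine Finset.sum_eq_zero fun D _ => ?_
    have h3 : ∀ C B, R F C D B * (V D * V F) * q B C = V D * V F * (R C F B D * q B C) := by
      intro C B
      rw [hanti, hanti']; ring
    simp only [h3, ← Finset.mul_sum, hric, mul_zero]
  have h3 : ∑ F, ∑ C, ∑ D, ∑ B, R F C D B * (V D * V F) * (V B * V C) = 0 := by
    refine Finset.sum_eq_zero fun F _ => Finset.sum_eq_zero fun C _ => ?_
    have h4 : ∑ D, ∑ B, R F C D B * (V D * V F) * (V B * V C)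
        = -∑ D, ∑ B, R F C D B * (V D * V F) * (V B * V C) := by
      conv_lhs => rw [Finset.sum_comm]
      simp only [← Finset.sum_neg_distrib]
      refine Finset.sum_congr rfl fun D _ => Finset.sum_congr rfl fun B _ => ?_
      rw [hanti]; ring
    linarith
  have h4 : ∀ F C D B, R F C D B * (q D F + V D * V F) * (q B C + V B * V C)
      = R F C D B * q D F * (q B C + V B * V C)
        + R F C D B * (V D * V F) * q B C + R F C D B * (V D * V F) * (V B * V C) := by
    intro F C D B; ring
  simp only [h4, Finset.sum_add_distrib, h1, h2, h3, add_zero]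

variable {n : ℕ} {G : EuclideanSpace ℝ (Unit ⊕ Fin n) → Matrix (Unit ⊕ Fin n) (Unit ⊕ Fin n) ℝ}
  {Φ N : EuclideanSpace ℝ (Fin n) → EuclideanSpace ℝ (Unit ⊕ Fin n)}
  {g k : EuclideanSpace ℝ (Fin n) → Matrix (Fin n) (Fin n) ℝ}
  {x : EuclideanSpace ℝ (Fin n)}

theorem sum_mul_ricci {κ : Type*} [Fintype κ] [DecidableEq κ]
    {g : EuclideanSpace ℝ κ → Matrix κ κ ℝ} {x : EuclideanSpace ℝ κ} (h : IsMetricNear g x)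
    (c b : κ) : ∑ a, ∑ d, (g x)⁻¹ a d * ∑ l, g x d l * riemann g l c a b x = ricci g c b x := by
  have h1 : ∀ a l, ∑ d, (g x)⁻¹ a d * g x d l = (1 : Matrix κ κ ℝ) a l := fun a l => by
    rw [← h.inv_mul, Matrix.mul_apply]
  have h2 : ∀ a, ∑ d, (g x)⁻¹ a d * ∑ l, g x d l * riemann g l c a b x = riemann g a c a b x := by
    intro a
    simp only [Finset.mul_sum]
    rw [Finset.sum_comm]
    simp only [← mul_assoc, ← Finset.sum_mul, h1, sum_one_mul]
  simp only [h2]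
  rfl

/-- The Hamiltonian constraint for a hypersurface in a Ricci-flat ambient space. -/
theorem hamiltonian_constraint (h : ∀ᶠ y in 𝓝 x, IsSpacelikeAt G Φ N g k y)
    (hric : ∀ A B, ricci G A B (Φ x) = 0) :
    scalarCurvature g x + trace g k x ^ 2 - normSq g k x = 0 := by
  have hx := h.self_of_nhds
  have hG := hx.ambient.self_of_nhds
  have hk : ∀ i j, k x i j = k x j i := fun i j => by
    rw [← hx.second i j, ← hx.second j i]
    simp only [hx.accel_symm i j]
  have h1 := sum_contract (fun F C D B => ∑ A, G (Φ x) F A * riemann G A C D B (Φ x))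
    (fun i A => tangent Φ i A x) fun i j => (g x)⁻¹ i j
  -- Pushed forward, g⁻¹ is the projection G⁻¹ + N N, with a plus sign since N is timelike. The
  -- doubly contracted ambient curvature is therefore a combination of Ricci components.
  have hH : ∀ A B, ∑ i, ∑ j, (g x)⁻¹ i j * tangent Φ i A x * tangent Φ j B x
      = (G (Φ x))⁻¹ A B + N x A * N x B := fun A B => by rw [hx.inv_eq]; ring
  simp only [hH, IsSpacelikeAt.gauss h] at h1
  have h2 := sum_contract_eq_zero
    (R := fun F C D B => ∑ A, G (Φ x) F A * riemann G A C D B (Φ x))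
    (q := fun A B => (G (Φ x))⁻¹ A B) (fun F C D B => by
      simp only [IsMetricNear.riemann_antisymm _ _ C D B, mul_neg, Finset.sum_neg_distrib])
    (fun F C D B => IsMetricNear.sum_mul_riemann_antisymm hx.ambient F C D B)
    (fun C B => by
      rw [Finset.sum_comm, ← hric C B, ← sum_mul_ricci hG]
      exact Finset.sum_congr rfl fun _ _ => Finset.sum_congr rfl fun _ _ => mul_comm _ _)
    (N x).ofLp
  rw [h2] at h1
  rw [← h1]
  have e1 : ∀ a d b c, (g x)⁻¹ a d * (g x)⁻¹ b c * (∑ l, g x d l * riemann g l c a b x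
      + k x b c * k x a d - k x a c * k x b d)
      = (g x)⁻¹ b c * ((g x)⁻¹ a d * ∑ l, g x d l * riemann g l c a b x)
        + ((g x)⁻¹ a d * k x a d) * ((g x)⁻¹ b c * k x b c)
        - (g x)⁻¹ a d * (g x)⁻¹ c b * k x a c * k x d b := by
    intro a d b c
    rw [hx.metric.inv_symm b c, hk b d]; ring
  simp only [e1, Finset.sum_sub_distrib, Finset.sum_add_distrib]
  have e2 : ∑ a, ∑ d, ∑ b, ∑ c, (g x)⁻¹ b c * ((g x)⁻¹ a d * ∑ l, g x d l * riemann g l c a b x)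
      = scalarCurvature g x := by
    rw [sum_sum_comm]
    simp only [← Finset.mul_sum, sum_mul_ricci hx.metric]
    rw [scalarCurvature, Finset.sum_comm]
    exact Finset.sum_congr rfl fun _ _ => Finset.sum_congr rfl fun _ _ => by
      rw [hx.metric.inv_symm]
  have e3 : ∑ a, ∑ d, ∑ b, ∑ c, ((g x)⁻¹ a d * k x a d) * ((g x)⁻¹ b c * k x b c)
      = trace g k x ^ 2 := by
    simp only [← Finset.mul_sum, ← Finset.sum_mul]
    rw [sq]; rfl
  have e4 : ∑ a, ∑ d, ∑ b, ∑ c, (g x)⁻¹ a d * (g x)⁻¹ c b * k x a c * k x d b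
      = normSq g k x := by
    refine Finset.sum_congr rfl fun a _ => ?_
    rw [Finset.sum_comm_cycle]
  rw [e2, e3, e4]

end Gauss

end SpacetimePenrose
end

noncomputable section
namespace SpacetimePenrose

/-! ### Static radial metrics -/

section Static

variable {n : ℕ}

theorem contDiff_spatial : ContDiff ℝ ∞ (spatial (n := n)) :=
  (contDiff_piLp 2).2 fun i =>
    (EuclideanSpace.proj (Sum.inr i) : EuclideanSpace ℝ (Unit ⊕ Fin n) →L[ℝ] ℝ).contDiff

theorem tendsto_spatial (z : EuclideanSpace ℝ (Unit ⊕ Fin n)) :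
    Tendsto spatial (𝓝 z) (𝓝 (spatial z)) := contDiff_spatial.continuous.continuousAt

theorem HasGrad.comp_spatial {h : EuclideanSpace ℝ (Fin n) → ℝ} {v : Fin n → ℝ}
    {z : EuclideanSpace ℝ (Unit ⊕ Fin n)} (hh : HasGrad h v (spatial z)) :
    HasGrad (fun w => h (spatial w)) (Sum.elim (fun _ => 0) v) z := by
  refine (pd_comp hh.1 (contDiff_spatial.differentiable (by simp) z)).congr_grad fun A => ?_
  have h1 : ∀ D : Fin n, pd A (fun w => spatial w D) z
      = (1 : Matrix (Unit ⊕ Fin n) (Unit ⊕ Fin n) ℝ) A (Sum.inr D) := fun D =>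
    (HasGrad.coord (x := z) (Sum.inr D)).2 A
  simp only [h1, hh.2]
  rcases A with _ | i
  · simp
  · simp [Matrix.one_apply]

/-- The spatial part `δ + (φ⁻¹ - 1) y yᵀ / |y|²` of a static radial metric. -/
def staticSpatial (φ : ℝ → ℝ) (y : EuclideanSpace ℝ (Fin n)) : Matrix (Fin n) (Fin n) ℝ :=
  radialTensor 1 (((φ (‖y‖ ^ 2))⁻¹ - 1) / ‖y‖ ^ 2) y

/-- The metric `-φ dt² + φ⁻¹ dr² + r² g_{S^{n-1}}`, where `φ` is a function of `r²`. -/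
def staticMetric (φ : ℝ → ℝ) (z : EuclideanSpace ℝ (Unit ⊕ Fin n)) :
    Matrix (Unit ⊕ Fin n) (Unit ⊕ Fin n) ℝ :=
  Matrix.fromBlocks (Matrix.of fun _ _ => -φ (‖spatial z‖ ^ 2)) 0 0
    (staticSpatial φ (spatial z))

/-- The Christoffel symbols of a static metric. -/
def staticChristoffel (φ φ' : ℝ → ℝ) (y : EuclideanSpace ℝ (Fin n)) :
    Unit ⊕ Fin n → Unit ⊕ Fin n → Unit ⊕ Fin n → ℝ
  | Sum.inl _, Sum.inl _, Sum.inl _ => 0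
  | Sum.inl _, Sum.inl _, Sum.inr i => φ' (‖y‖ ^ 2) / φ (‖y‖ ^ 2) * y i
  | Sum.inl _, Sum.inr i, Sum.inl _ => φ' (‖y‖ ^ 2) / φ (‖y‖ ^ 2) * y i
  | Sum.inl _, Sum.inr _, Sum.inr _ => 0
  | Sum.inr i, Sum.inl _, Sum.inl _ => φ (‖y‖ ^ 2) * φ' (‖y‖ ^ 2) * y i
  | Sum.inr _, Sum.inl _, Sum.inr _ => 0
  | Sum.inr _, Sum.inr _, Sum.inl _ => 0
  | Sum.inr c, Sum.inr a, Sum.inr b => christoffel (staticSpatial φ) c a b y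

variable {φ φ' : ℝ → ℝ} {y : EuclideanSpace ℝ (Fin n)}

theorem staticSpatial_inv (hs : ‖y‖ ≠ 0) (h0 : φ (‖y‖ ^ 2) ≠ 0) :
    (staticSpatial φ y)⁻¹ = radialTensor 1 (-(1 - φ (‖y‖ ^ 2)) / ‖y‖ ^ 2) y := by
  have h1 : 1 + ‖y‖ ^ 2 * (((φ (‖y‖ ^ 2))⁻¹ - 1) / ‖y‖ ^ 2) = (φ (‖y‖ ^ 2))⁻¹ := by
    field_simp; ring
  rw [staticSpatial, radialTensor_inv one_ne_zero (by rw [h1]; exact inv_ne_zero h0), h1]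
  congr 1
  · simp
  · field_simp

theorem det_staticSpatial_ne_zero (hs : ‖y‖ ≠ 0) (h0 : φ (‖y‖ ^ 2) ≠ 0) :
    (staticSpatial φ y).det ≠ 0 := by
  have h1 : staticSpatial φ y * radialTensor 1 (-(1 - φ (‖y‖ ^ 2)) / ‖y‖ ^ 2) y = 1 := by
    rw [staticSpatial, radialTensor_mul]
    ext i j
    rw [radialTensor_apply]
    have : 1 * (-(1 - φ (‖y‖ ^ 2)) / ‖y‖ ^ 2) + ((φ (‖y‖ ^ 2))⁻¹ - 1) / ‖y‖ ^ 2 * 1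
        + ‖y‖ ^ 2 * (((φ (‖y‖ ^ 2))⁻¹ - 1) / ‖y‖ ^ 2 * (-(1 - φ (‖y‖ ^ 2)) / ‖y‖ ^ 2)) = 0 := by
      field_simp; ring
    rw [this]; ring
  intro h2
  have := congrArg Matrix.det h1
  rw [Matrix.det_mul, h2, zero_mul, Matrix.det_one] at this
  exact zero_ne_one this

theorem staticMetric_inv {z : EuclideanSpace ℝ (Unit ⊕ Fin n)} (hs : ‖spatial z‖ ≠ 0)
    (h0 : φ (‖spatial z‖ ^ 2) ≠ 0) :
    (staticMetric φ z)⁻¹ = Matrix.fromBlocks (Matrix.of fun _ _ => -(φ (‖spatial z‖ ^ 2))⁻¹) 0 0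
      (staticSpatial φ (spatial z))⁻¹ := by
  apply Matrix.inv_eq_right_inv
  rw [staticMetric, Matrix.fromBlocks_multiply,
    Matrix.mul_nonsing_inv _ (isUnit_iff_ne_zero.2 (det_staticSpatial_ne_zero hs h0))]
  have : (Matrix.of fun _ _ => -φ (‖spatial z‖ ^ 2) : Matrix Unit Unit ℝ)
      * (Matrix.of fun _ _ => -(φ (‖spatial z‖ ^ 2))⁻¹ : Matrix Unit Unit ℝ) = 1 := by
    ext i j
    simp [Matrix.mul_apply, h0]
  rw [this]
  simp [Matrix.fromBlocks_one]

theorem isRadialNear_staticSpatial (hs : ‖y‖ ≠ 0) (h0 : φ (‖y‖ ^ 2) ≠ 0)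
    (hφ : ContDiffAt ℝ ∞ φ (‖y‖ ^ 2)) :
    IsRadialNear (staticSpatial φ) (fun _ => 1) (fun s => ((φ s)⁻¹ - 1) / s) y :=
  ⟨Eventually.of_forall fun _ => rfl, contDiffAt_const,
    ((hφ.inv h0).sub contDiffAt_const).div contDiffAt_id (pow_ne_zero 2 hs)⟩

theorem isMetricNear_staticMetric {z : EuclideanSpace ℝ (Unit ⊕ Fin n)} (hs : ‖spatial z‖ ≠ 0)
    (h0 : φ (‖spatial z‖ ^ 2) ≠ 0) (hφ : ContDiffAt ℝ ∞ φ (‖spatial z‖ ^ 2)) :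
    IsMetricNear (staticMetric φ) z := by
  have hn : ContDiffAt ℝ ∞ (fun w : EuclideanSpace ℝ (Unit ⊕ Fin n) => ‖spatial w‖ ^ 2) z :=
    (contDiff_spatial.norm_sq ℝ).contDiffAt
  have hc : ∀ i, ContDiffAt ℝ ∞ (fun w : EuclideanSpace ℝ (Unit ⊕ Fin n) => spatial w i) z :=
    fun i => contDiffAt_apply contDiff_spatial.contDiffAt i
  have hφ' : ContDiffAt ℝ ∞ (fun w : EuclideanSpace ℝ (Unit ⊕ Fin n) => φ (‖spatial w‖ ^ 2)) z :=
    hφ.comp z hn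
  refine ⟨?_, ?_, ?_⟩
  · rintro (_ | i) (_ | j)
    · exact hφ'.neg
    · exact contDiffAt_const
    · exact contDiffAt_const
    · exact (contDiffAt_const.mul contDiffAt_const).add
        ((((hφ'.inv h0).sub contDiffAt_const).div hn (pow_ne_zero 2 hs)).mul ((hc i).mul (hc j)))
  · refine Eventually.of_forall fun w => ?_
    rintro (_ | i) (_ | j)
    · rfl
    · rfl
    · rfl
    · change radialTensor _ _ _ _ _ = radialTensor _ _ _ _ _
      rw [radialTensor_apply, radialTensor_apply, one_comm_apply]; ring
  · rw [staticMetric, Matrix.det_fromBlocks_zero₂₁]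
    exact mul_ne_zero (by simpa using h0) (det_staticSpatial_ne_zero hs h0)

/-- The function φ' only has to take the value of the derivative at the radius in question. It can
thus be the right-hand side of a differential equation for φ. -/
theorem christoffel_staticMetric {z : EuclideanSpace ℝ (Unit ⊕ Fin n)} (hs : ‖spatial z‖ ≠ 0)
    (h0 : φ (‖spatial z‖ ^ 2) ≠ 0)
    (hφ' : HasDerivAt φ (φ' (‖spatial z‖ ^ 2)) (‖spatial z‖ ^ 2)) (A B C : Unit ⊕ Fin n) :
    christoffel (staticMetric φ) A B C z = staticChristoffel φ φ' (spatial z) A B C := by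
  have hne := pow_ne_zero 2 hs
  have h1 : ∀ A, pd A (fun w => staticMetric φ w (Sum.inl ()) (Sum.inl ())) z
      = Sum.elim (fun _ => 0) (fun i => -(2 * φ' (‖spatial z‖ ^ 2) * spatial z i)) A :=
    (HasGrad.comp_spatial (HasGrad.radial hφ').neg).2
  have h2 : ∀ A i, pd A (fun w => staticMetric φ w (Sum.inl ()) (Sum.inr i)) z = 0 :=
    fun A i => (HasGrad.const 0).2 A
  have h3 : ∀ A i, pd A (fun w => staticMetric φ w (Sum.inr i) (Sum.inl ())) z = 0 :=
    fun A i => (HasGrad.const 0).2 A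
  have hS : ∀ i j, DifferentiableAt ℝ (fun y => staticSpatial φ y i j) (spatial z) := by
    intro i j
    have := hasGrad_radialTensor (hasDerivAt_const (‖spatial z‖ ^ 2) (1 : ℝ))
      (((hφ'.inv h0).sub_const 1).div (hasDerivAt_id _) hne) i j
    exact this.1
  have h4 : ∀ A i j, pd A (fun w => staticMetric φ w (Sum.inr i) (Sum.inr j)) z
      = Sum.elim (fun _ => 0) (fun a => pd a (fun y => staticSpatial φ y i j) (spatial z)) A :=
    fun A i j => (HasGrad.comp_spatial (hS i j).hasGrad).2 A
  rw [christoffel, staticMetric_inv hs h0]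
  rcases A with ⟨⟩ | i <;> rcases B with ⟨⟩ | j <;> rcases C with ⟨⟩ | k <;>
    simp only [Fintype.sum_sum_type, Finset.univ_unique, Finset.sum_singleton, PUnit.default_eq_unit,
      Matrix.fromBlocks_apply₁₁, Matrix.fromBlocks_apply₁₂, Matrix.fromBlocks_apply₂₁,
      Matrix.fromBlocks_apply₂₂, Matrix.zero_apply, Matrix.of_apply, zero_mul, h1, h2, h3, h4,
      Sum.elim_inl, Sum.elim_inr, Finset.sum_const_zero, add_zero, zero_add, sub_zero, mul_zero,
      staticChristoffel, sub_neg_eq_add, zero_sub, neg_zero]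
  · field_simp
  · field_simp
  · rw [staticSpatial_inv hs h0]
    have e : ∀ a, radialTensor 1 (-(1 - φ (‖spatial z‖ ^ 2)) / ‖spatial z‖ ^ 2) (spatial z) i a
        * (- -(2 * φ' (‖spatial z‖ ^ 2) * spatial z a))
        = 2 * φ' (‖spatial z‖ ^ 2) * (radialTensor 1 (-(1 - φ (‖spatial z‖ ^ 2))
          / ‖spatial z‖ ^ 2) (spatial z) i a * spatial z a) := fun a => by ring
    simp only [neg_neg] at e ⊢
    simp only [e, ← Finset.mul_sum, sum_radialTensor_mul_self]
    field_simp
    ring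
  · rfl

end Static

end SpacetimePenrose
end

noncomputable section
namespace SpacetimePenrose

/-! ### Ricci flatness of static metrics from a first-order equation -/

section Static

open IsRadialNear

variable {n : ℕ} {φ φ' : ℝ → ℝ}

section Spatial

variable {y : EuclideanSpace ℝ (Fin n)} {p : ℝ}

theorem one_add_mul_static {s : ℝ} (hs : s ≠ 0) (h0 : φ s ≠ 0) :
    1 + s * (((φ s)⁻¹ - 1) / s) = (φ s)⁻¹ := by field_simp; ring

theorem coeffα_static {s : ℝ} (hs : s ≠ 0) (h0 : φ s ≠ 0) :
    coeffα (fun _ => 1) (fun s => ((φ s)⁻¹ - 1) / s) s = (1 - φ s) / s := by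
  rw [coeffα, one_add_mul_static hs h0, deriv_const]
  field_simp
  ring

theorem coeffη_static (s : ℝ) : coeffη (fun _ => 1) s = 0 := by
  rw [coeffη, deriv_const, zero_div]

theorem coeffζ_static {s : ℝ} (hs : s ≠ 0) (h0 : φ s ≠ 0)
    (hφ : HasDerivAt φ (p * (1 - φ s) / s) s) :
    coeffζ (fun _ => 1) (fun s => ((φ s)⁻¹ - 1) / s) s
      = -(1 - φ s) * (p * (1 - φ s) / φ s + p + 1) / s ^ 2 := by
  have h1 : HasDerivAt (fun s => ((φ s)⁻¹ - 1) / s)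
      ((-(p * (1 - φ s) / s) / φ s ^ 2 * s - ((φ s)⁻¹ - 1) * 1) / s ^ 2) s :=
    ((hφ.inv h0).sub_const 1).div (hasDerivAt_id s) hs
  rw [coeffζ, one_add_mul_static hs h0, h1.deriv, deriv_const]
  field_simp
  ring

theorem christoffel_staticSpatial (hs : ‖y‖ ≠ 0) (h0 : φ (‖y‖ ^ 2) ≠ 0)
    (hφ : ContDiffAt ℝ ∞ φ (‖y‖ ^ 2))
    (hode : HasDerivAt φ (p * (1 - φ (‖y‖ ^ 2)) / ‖y‖ ^ 2) (‖y‖ ^ 2)) (c a b : Fin n) :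
    christoffel (staticSpatial φ) c a b y
      = radialChristoffel ((1 - φ (‖y‖ ^ 2)) / ‖y‖ ^ 2) 0
        (-(1 - φ (‖y‖ ^ 2)) * (p * (1 - φ (‖y‖ ^ 2)) / φ (‖y‖ ^ 2) + p + 1) / (‖y‖ ^ 2) ^ 2)
        y c a b := by
  have hne := pow_ne_zero 2 hs
  rw [(isRadialNear_staticSpatial hs h0 hφ).christoffel_eq one_ne_zero
    (by rw [one_add_mul_static hne h0]; exact inv_ne_zero h0), coeffα_static hne h0,
    coeffη_static, coeffζ_static hne h0 hode]

theorem ricci_staticSpatial (hn : (n : ℝ) = 2 * p + 2) (hs : ‖y‖ ≠ 0) (h0 : φ (‖y‖ ^ 2) ≠ 0)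
    (hφ : ContDiffAt ℝ ∞ φ (‖y‖ ^ 2))
    (hode : HasDerivAt φ (p * (1 - φ (‖y‖ ^ 2)) / ‖y‖ ^ 2) (‖y‖ ^ 2)) {s f : ℝ} (es : ‖y‖ ^ 2 = s)
    (ef : φ s = f) (a b : Fin n) :
    ricci (staticSpatial φ) a b y
      = radialTensor (p * (1 - f) / s)
        ((1 - f) * ((p * (1 - f) / f + p) * (1 - f - (2 * p + 2))) / s ^ 2)
         y a b := by
  subst es
  have hne := pow_ne_zero 2 hs
  have hα : HasDerivAt (coeffα (fun _ => 1) fun s => ((φ s)⁻¹ - 1) / s)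
      ((-(p * (1 - φ (‖y‖ ^ 2)) / ‖y‖ ^ 2) * ‖y‖ ^ 2 - (1 - φ (‖y‖ ^ 2)) * 1) / (‖y‖ ^ 2) ^ 2)
      (‖y‖ ^ 2) := by
    have h1 : HasDerivAt (fun s => (1 - φ s) / s) _ (‖y‖ ^ 2) :=
      (hode.const_sub 1).div (hasDerivAt_id (‖y‖ ^ 2)) hne
    refine h1.congr_of_eventuallyEq ?_
    filter_upwards [continuousAt_id.eventually_ne hne, hφ.continuousAt.eventually_ne h0]
      with s h2 h3 using coeffα_static h2 h3
  have hη : HasDerivAt (coeffη fun _ => 1) 0 (‖y‖ ^ 2) := by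
    rw [show coeffη (fun _ => 1) = fun _ => 0 from funext coeffη_static]
    exact hasDerivAt_const _ _
  rw [(isRadialNear_staticSpatial hs h0 hφ).ricci_eq one_ne_zero
    (by rw [one_add_mul_static hne h0]; exact inv_ne_zero h0) rfl (coeffα_static hne h0)
    (coeffη_static _) (coeffζ_static hne h0 hode) hα hη, Fintype.card_fin, hn, ef]
  generalize ‖y‖ ^ 2 = s at *
  subst ef
  congr 1
  · field_simp
    ring
  · field_simp
    ring

end Spatial

theorem isMetricNear_radial {ι : Type*} [Fintype ι] [DecidableEq ι]
    {g : EuclideanSpace ℝ ι → Matrix ι ι ℝ} {β γ : ℝ → ℝ} {x : EuclideanSpace ℝ ι}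
    (h : IsRadialNear g β γ x) (hβ : β (‖x‖ ^ 2) ≠ 0)
    (hA : β (‖x‖ ^ 2) + ‖x‖ ^ 2 * γ (‖x‖ ^ 2) ≠ 0) : IsMetricNear g x := by
  have hn : ContDiffAt ℝ ∞ (fun w : EuclideanSpace ℝ ι => ‖w‖ ^ 2) x :=
    (contDiff_norm_sq ℝ).contDiffAt
  refine ⟨fun i j => ?_, h.eventually_eq.mono fun y hy i j => ?_, ?_⟩
  · refine ContDiffAt.congr_of_eventuallyEq (f := fun y =>
      radialTensor (β (‖y‖ ^ 2)) (γ (‖y‖ ^ 2)) y i j) ?_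
      (h.eventually_eq.mono fun y hy => by dsimp only; rw [hy])
    exact ((h.smooth_fst.comp x hn).mul contDiffAt_const).add ((h.smooth_snd.comp x hn).mul
      ((contDiffAt_apply contDiffAt_id i).mul (contDiffAt_apply contDiffAt_id j)))
  · rw [hy, radialTensor_apply, radialTensor_apply, one_comm_apply]; ring
  · rw [h.eq]
    rw [InitialDataSet.HasProfile.det_radialTensor hβ]
    exact mul_ne_zero (pow_ne_zero _ hβ) (div_ne_zero hA hβ)

variable {z : EuclideanSpace ℝ (Unit ⊕ Fin n)} {p : ℝ}

/-- The only information on φ is the equation s φ' = p (1 - φ) with p = (n - 2)/2, which says that 1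
- φ is a multiple of s^{-p} and gives both derivatives of φ. With them the time-time component
vanishes, and in the spatial components the intrinsic Ricci tensor cancels against the Hessian of
the lapse. -/
theorem ricci_staticMetric (hn : (n : ℝ) = 2 * p + 2) (hs : ‖spatial z‖ ≠ 0)
    (h0 : φ (‖spatial z‖ ^ 2) ≠ 0) (hφ : ContDiffAt ℝ ∞ φ (‖spatial z‖ ^ 2))
    (hode : ∀ᶠ s in 𝓝 (‖spatial z‖ ^ 2), HasDerivAt φ (p * (1 - φ s) / s) s)
    (A B : Unit ⊕ Fin n) : ricci (staticMetric φ) A B z = 0 := by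
  have hne := pow_ne_zero 2 hs
  set φ' : ℝ → ℝ := fun s => p * (1 - φ s) / s with hφ'
  have hev : ∀ᶠ y in 𝓝 (spatial z), ‖y‖ ≠ 0 ∧ φ (‖y‖ ^ 2) ≠ 0
      ∧ HasDerivAt φ (φ' (‖y‖ ^ 2)) (‖y‖ ^ 2) := by
    filter_upwards [continuous_norm.continuousAt.eventually_ne hs,
      eventually_normSq (hφ.continuousAt.eventually_ne h0), eventually_normSq hode]
      with y h1 h2 h3 using ⟨h1, h2, h3⟩
  have hΓ : ∀ᶠ w in 𝓝 z, ∀ A B C, christoffel (staticMetric φ) A B C w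
      = staticChristoffel φ φ' (spatial w) A B C :=
    ((tendsto_spatial z).eventually hev).mono fun w hw A B C =>
      christoffel_staticMetric hw.1 hw.2.1 hw.2.2 A B C
  have hd : HasDerivAt φ' ((-φ' (‖spatial z‖ ^ 2) * p * ‖spatial z‖ ^ 2
      - p * (1 - φ (‖spatial z‖ ^ 2)) * 1) / (‖spatial z‖ ^ 2) ^ 2) (‖spatial z‖ ^ 2) := by
    have := ((hode.self_of_nhds.const_sub 1).const_mul p).div (hasDerivAt_id (‖spatial z‖ ^ 2)) hne
    refine this.congr_deriv ?_
    simp only [id, hφ']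
    ring
  have hS : ∀ c a b, DifferentiableAt ℝ (christoffel (staticSpatial (n := n) φ) c a b) (spatial z) := by
    intro c a b
    have h1 := (isMetricNear_radial (isRadialNear_staticSpatial hs h0 hφ) one_ne_zero (by
      rw [one_add_mul_static hne h0]; exact inv_ne_zero h0))
    exact (h1.contDiffAt_christoffel c a b).differentiableAt (by simp)
  have hd1 := hd.div hode.self_of_nhds h0
  have hd2 := hode.self_of_nhds.mul hd
  set y := spatial z with hy
  have hchr := christoffel_staticSpatial hs h0 hφ hode.self_of_nhds
  have hricS := ricci_staticSpatial hn hs h0 hφ hode.self_of_nhds rfl rfl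
  have hp : ∀ A B C D, pd D (christoffel (staticMetric φ) A B C) z
      = pd D (fun w => staticChristoffel φ φ' (spatial w) A B C) z := fun A B C D =>
    pd_congr (hΓ.mono fun w hw => hw A B C) D
  obtain ⟨s, es⟩ : ∃ s, ‖y‖ ^ 2 = s := ⟨_, rfl⟩
  obtain ⟨f, ef⟩ : ∃ f, φ s = f := ⟨_, rfl⟩
  obtain ⟨c₁, e₁, hd1⟩ : ∃ c, c = _ ∧ HasDerivAt (fun s => φ' s / φ s) c (‖y‖ ^ 2) := ⟨_, rfl, hd1⟩
  obtain ⟨c₂, e₂, hd2⟩ : ∃ c, c = _ ∧ HasDerivAt (fun s => φ s * φ' s) c (‖y‖ ^ 2) := ⟨_, rfl, hd2⟩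
  have p1 : ∀ D i, pd D (fun w => φ' (‖spatial w‖ ^ 2) / φ (‖spatial w‖ ^ 2) * spatial w i) z = _ :=
    fun D i => (HasGrad.comp_spatial (z := z) ((HasGrad.radial hd1).mul (HasGrad.coord i))).2 D
  have p2 : ∀ D i, pd D (fun w => φ (‖spatial w‖ ^ 2) * φ' (‖spatial w‖ ^ 2) * spatial w i) z = _ :=
    fun D i => (HasGrad.comp_spatial (z := z) ((HasGrad.radial hd2).mul (HasGrad.coord i))).2 D
  have p3 : ∀ D c a b, pd D (fun w => christoffel (staticSpatial φ) c a b (spatial w)) z = _ :=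
    fun D c a b => (HasGrad.comp_spatial (hS c a b).hasGrad).2 D
  have p4 : ∀ D, pd D (fun _ => 0) z = 0 := fun D => (HasGrad.const 0).2 D
  have hsum : ∑ i, y i * y i = s := by rw [sum_mul_self, es]
  obtain ⟨f', ef'⟩ : ∃ f', φ' s = f' := ⟨_, rfl⟩
  have hf' : f' = p * (1 - f) / s := by rw [← ef', ← ef]
  have e₁' : c₁ = ((-f' * p * s - p * (1 - f)) / s ^ 2 * f - f' * f') / f ^ 2 := by
    rw [e₁, es, ef, ef', mul_one, hf']
  have e₂' : c₂ = f' * f' + f * ((-f' * p * s - p * (1 - f)) / s ^ 2) := by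
    rw [e₂, es, ef, ef', mul_one, hf']
  clear_value φ'
  simp only [es, ef, ef'] at hchr hricS p1 p2
  obtain ⟨α, eα⟩ : ∃ α, (1 - f) / s = α := ⟨_, rfl⟩
  obtain ⟨ζ, eζ⟩ : ∃ ζ, -(1 - f) * (p * (1 - f) / f + p + 1) / s ^ 2 = ζ := ⟨_, rfl⟩
  have hdiv : ∀ a, ∑ c, christoffel (staticSpatial φ) c c a y = (α + s * ζ) * y a := by
    intro a
    simp only [hchr, radialChristoffel_symm _ _ _ _ _ _ a, eα, eζ]
    rw [sum_radialChristoffel_contract, es]; ring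
  have hmul : ∀ a b, ∑ c, y c * christoffel (staticSpatial φ) c a b y
      = radialTensor (s * α) (s * ζ) y a b := by
    intro a b
    simp only [hchr, eα, eζ]
    rw [sum_mul_radialChristoffel, es]; congr 1; ring
  have hs0 : s ≠ 0 := es ▸ hne
  have hf0 : f ≠ 0 := by rw [← ef, ← es]; exact h0
  rw [ricci]
  simp only [hp, hΓ.self_of_nhds]
  rcases A with ⟨⟩ | i <;> rcases B with ⟨⟩ | j <;>
    simp only [Fintype.sum_sum_type, Finset.univ_unique, Finset.sum_singleton,
      PUnit.default_eq_unit, staticChristoffel, p1, p2, p3, p4, Sum.elim_inl, Sum.elim_inr,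
      zero_mul, mul_zero, Finset.sum_const_zero, add_zero, zero_add, sub_zero,
      zero_sub, neg_zero, sub_self, ← hy, es, ef]
  · have e : ∀ x, ∑ a, christoffel (staticSpatial φ) x x a y * (f * φ' s * y a)
        = ∑ a, f * f' * (christoffel (staticSpatial φ) x x a y * y a) := fun x =>
      Finset.sum_congr rfl fun a _ => by rw [ef']; ring
    have e3 : ∑ x, ∑ a, christoffel (staticSpatial φ) x x a y * y a = (α + s * ζ) * s := by
      rw [Finset.sum_comm]
      simp only [← Finset.sum_mul, hdiv, mul_assoc]
      simp only [← Finset.mul_sum, hsum]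
    have e4 : ∀ x, 2 * c₂ * y x * y x + f * f' * (1 : Matrix (Fin n) (Fin n) ℝ) x x
        + (-(f * φ' s * y x * (φ' s / f * y x))
          + ∑ a, christoffel (staticSpatial φ) x x a y * (f * φ' s * y a))
        = (2 * c₂ - f' ^ 2) * (y x * y x) + f * f' * (1 : Matrix (Fin n) (Fin n) ℝ) x x
          + f * f' * ∑ a, christoffel (staticSpatial φ) x x a y * y a := by
      intro x
      rw [e, ← Finset.mul_sum, ef']
      field_simp
      ring
    simp only [e4, Finset.sum_add_distrib, ← Finset.mul_sum, hsum, e3, sum_one_apply_self,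
      Fintype.card_fin, hn]
    rw [e₂', hf', ← eα, ← eζ]
    field_simp
    ring
  · have e : (∑ x, (pd x (christoffel (staticSpatial φ) x i j) y
        - pd j (christoffel (staticSpatial φ) x i x) y
        + ∑ a, (christoffel (staticSpatial φ) x x a y * christoffel (staticSpatial φ) a i j y
          - christoffel (staticSpatial φ) x j a y * christoffel (staticSpatial φ) a i x y)))
        = ricci (staticSpatial φ) i j y := rfl
    simp only [mul_assoc, ← Finset.mul_sum]
    simp only [← mul_assoc]
    rw [e, hmul, hricS, radialTensor_apply, radialTensor_apply, ef', e₁', hf', one_comm_apply j i,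
      ← eα, ← eζ]
    field_simp
    ring

end Static

end SpacetimePenrose
end

noncomputable section
namespace SpacetimePenrose

/-! ### The Schwarzschild metric -/

section Schwarzschild

variable {n : ℕ}

theorem hasDerivAt_sqrt_pow (k : ℕ) {s : ℝ} (hs : 0 < s) :
    HasDerivAt (fun s => Real.sqrt s ^ k) (k / 2 * Real.sqrt s ^ k / s) s := by
  refine ((Real.hasDerivAt_sqrt hs.ne').pow k).congr_deriv ?_
  rcases k with _ | k
  · simp
  · have h : Real.sqrt s ≠ 0 := (Real.sqrt_pos.2 hs).ne'
    have h2 : s = Real.sqrt s * Real.sqrt s := (Real.mul_self_sqrt hs.le).symm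
    rw [Nat.add_sub_cancel]
    conv_rhs => rw [h2]
    rw [Real.sqrt_mul_self (Real.sqrt_nonneg s)]
    field_simp
    ring

/-- 1 - F is homogeneous of degree -(n - 2)/2 in s = r², whatever the mass; this is the equation
that drives all computations with the Schwarzschild metric. -/
theorem hasDerivAt_schwarzschildFactor (hn : 2 ≤ n) (m : ℝ) {s : ℝ} (hs : 0 < s) :
    HasDerivAt (fun s => schwarzschildFactor n m (Real.sqrt s))
      (((n : ℝ) - 2) / 2 * (1 - schwarzschildFactor n m (Real.sqrt s)) / s) s := by
  have h0 : Real.sqrt s ^ (n - 2) ≠ 0 := pow_ne_zero _ (Real.sqrt_pos.2 hs).ne'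
  refine ((((hasDerivAt_sqrt_pow (n - 2) hs).inv h0).const_mul (2 * m)).const_sub 1).congr_deriv ?_
  rw [schwarzschildFactor, Nat.cast_sub hn]
  field_simp
  ring

theorem contDiffAt_schwarzschildFactor (m : ℝ) {s : ℝ} (hs : 0 < s) :
    ContDiffAt ℝ ∞ (fun s => schwarzschildFactor n m (Real.sqrt s)) s :=
  contDiffAt_const.sub (contDiffAt_const.div ((Real.contDiffAt_sqrt hs.ne').pow _)
    (pow_ne_zero _ (Real.sqrt_pos.2 hs).ne'))

theorem schwarzschildMetric_eq (n : ℕ) (m : ℝ) :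
    schwarzschildMetric n m
      = staticMetric fun s => schwarzschildFactor n m (Real.sqrt s) := by
  funext z
  rw [schwarzschildMetric, staticMetric, Real.sqrt_sq (norm_nonneg _)]
  congr 1
  ext i j
  rw [staticSpatial, radialTensor_apply, Real.sqrt_sq (norm_nonneg _), Matrix.of_apply]
  ring

theorem isOpen_schwarzschildExterior (n : ℕ) (m : ℝ) : IsOpen (schwarzschildExterior n m) := by
  have hc : ContinuousOn (fun r => schwarzschildFactor n m r) (Ioi 0) :=
    continuousOn_const.sub (continuousOn_const.div (continuousOn_id.pow _)
      fun r hr => pow_ne_zero _ (ne_of_gt hr))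
  have h := (hc.isOpen_inter_preimage isOpen_Ioi (isOpen_Ioi (a := 0))).preimage
    (contDiff_spatial (n := n)).continuous.norm
  exact h

theorem isMetricNear_schwarzschildMetric {m : ℝ} {z : EuclideanSpace ℝ (Unit ⊕ Fin n)}
    (hz : z ∈ schwarzschildExterior n m) :
    ∀ᶠ w in 𝓝 z, IsMetricNear (schwarzschildMetric n m) w := by
  filter_upwards [(isOpen_schwarzschildExterior n m).mem_nhds hz] with w hw
  rw [schwarzschildMetric_eq]
  exact isMetricNear_staticMetric hw.1.ne'
    (by rw [Real.sqrt_sq (norm_nonneg _)]; exact hw.2.ne')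
    (contDiffAt_schwarzschildFactor m (pow_pos hw.1 2))

theorem ricci_schwarzschildMetric (hn : 2 ≤ n) {m : ℝ} {z : EuclideanSpace ℝ (Unit ⊕ Fin n)}
    (hz : z ∈ schwarzschildExterior n m) (A B : Unit ⊕ Fin n) :
    ricci (schwarzschildMetric n m) A B z = 0 := by
  rw [schwarzschildMetric_eq]
  refine ricci_staticMetric (p := ((n : ℝ) - 2) / 2) (by ring) hz.1.ne'
    (by rw [Real.sqrt_sq (norm_nonneg _)]; exact hz.2.ne')
    (contDiffAt_schwarzschildFactor m (pow_pos hz.1 2)) ?_ A B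
  filter_upwards [isOpen_Ioi.mem_nhds (pow_pos hz.1 2)] with s hs
  exact hasDerivAt_schwarzschildFactor hn m hs

theorem InitialDataSet.isMetricNear {D : InitialDataSet n} {x : EuclideanSpace ℝ (Fin n)}
    (hx : D.M ∈ 𝓝 x) : IsMetricNear D.g x := by
  have hxM : x ∈ D.M := mem_of_mem_nhds hx
  refine ⟨fun i j => D.smooth_g i j x hxM, ?_, (D.posDef_g x hxM).det_pos.ne'⟩
  filter_upwards [hx] with y hy i j
  simpa using (congrFun (congrFun (D.posDef_g y hy).isHermitian.eq i) j).symm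

/-- The vacuum Hamiltonian constraint for data that embed in Schwarzschild. -/
theorem InitialDataSet.EmbedsInSchwarzschild.energyDensity_eq_zero (hn : 2 ≤ n)
    {D : InitialDataSet n} {U : Set (EuclideanSpace ℝ (Fin n))} {m : ℝ}
    (h : D.EmbedsInSchwarzschild U m) (hU : IsOpen U) (hUM : U ⊆ D.M) {x : EuclideanSpace ℝ (Fin n)}
    (hx : x ∈ U) : D.energyDensity x = 0 := by
  obtain ⟨Φ, N, -, h⟩ := h
  have h1 : ∀ᶠ y in 𝓝 x, IsSpacelikeAt (schwarzschildMetric n m) Φ N D.g D.k y := by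
    filter_upwards [hU.mem_nhds hx] with y hy
    obtain ⟨h1, h2, h3, h4, h5, h6, h7, h8⟩ := h y hy
    exact ⟨isMetricNear_schwarzschildMetric h3,
      InitialDataSet.isMetricNear (mem_of_superset (hU.mem_nhds hy) hUM), h1, h4, h5, h6, h8⟩
  rw [InitialDataSet.energyDensity, hamiltonian_constraint h1
    (ricci_schwarzschildMetric hn (h x hx).2.2.1), zero_div]

end Schwarzschild

end SpacetimePenrose
end

noncomputable section
namespace SpacetimePenrose

/-! ### Rotationally symmetric maps into a static spacetime -/

section RadialVector

variable {n : ℕ}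

/-- The point `(t(|x|²), r(|x|²) x)` of `ℝ × ℝⁿ`. -/
def radialVector (t r : ℝ → ℝ) (x : EuclideanSpace ℝ (Fin n)) : EuclideanSpace ℝ (Unit ⊕ Fin n) :=
  WithLp.toLp 2 (Sum.elim (fun _ => t (‖x‖ ^ 2)) fun i => r (‖x‖ ^ 2) * x i)

variable {t r : ℝ → ℝ} {x : EuclideanSpace ℝ (Fin n)}

theorem spatial_radialVector (t r : ℝ → ℝ) (x : EuclideanSpace ℝ (Fin n)) :
    spatial (radialVector t r x) = r (‖x‖ ^ 2) • x := rfl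

theorem norm_spatial_radialVector (t r : ℝ → ℝ) (x : EuclideanSpace ℝ (Fin n)) :
    ‖spatial (radialVector t r x)‖ ^ 2 = ‖x‖ ^ 2 * r (‖x‖ ^ 2) ^ 2 := by
  rw [spatial_radialVector, norm_smul, mul_pow, Real.norm_eq_abs, sq_abs, mul_comm]

theorem contDiffAt_radialVector (ht : ContDiffAt ℝ ∞ t (‖x‖ ^ 2)) (hr : ContDiffAt ℝ ∞ r (‖x‖ ^ 2)) :
    ContDiffAt ℝ ∞ (radialVector t r) x := by
  have hn : ContDiffAt ℝ ∞ (fun y : EuclideanSpace ℝ (Fin n) => ‖y‖ ^ 2) x :=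
    (contDiff_norm_sq ℝ).contDiffAt
  rw [contDiffAt_piLp]
  rintro (_ | i)
  · exact ht.comp x hn
  · exact (hr.comp x hn).mul (contDiffAt_apply contDiffAt_id i)

theorem tangent_radialVector_inl {t' : ℝ} (ht : HasDerivAt t t' (‖x‖ ^ 2)) (i : Fin n) :
    tangent (radialVector t r) i (Sum.inl ()) x = 2 * t' * x i :=
  (HasGrad.radial ht).2 i

theorem tangent_radialVector_inr {r' : ℝ} (hr : HasDerivAt r r' (‖x‖ ^ 2)) (i j : Fin n) :
    tangent (radialVector t r) i (Sum.inr j) x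
      = radialTensor (r (‖x‖ ^ 2)) (2 * r') x i j := by
  have h : tangent (radialVector t r) i (Sum.inr j) x = _ :=
    ((HasGrad.radial hr).mul (HasGrad.coord j)).2 i
  rw [h, radialTensor_apply]; ring

theorem pd_tangent_radialVector_inl (ht : ContDiffAt ℝ ∞ t (‖x‖ ^ 2)) (i j : Fin n) :
    pd i (tangent (radialVector t r) j (Sum.inl ())) x
      = radialTensor (2 * deriv t (‖x‖ ^ 2)) (4 * deriv (deriv t) (‖x‖ ^ 2)) x i j := by
  have h1 : HasGrad (fun y : EuclideanSpace ℝ (Fin n) => 2 * (deriv t (‖y‖ ^ 2) * y j)) _ x :=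
    HasGrad.const_mul 2 ((HasGrad.radial ht.deriv_infty.hasDerivAt_infty).mul (HasGrad.coord j))
  have h2 : tangent (radialVector t r) j (Sum.inl ())
      =ᶠ[𝓝 x] fun y => 2 * (deriv t (‖y‖ ^ 2) * y j) := by
    filter_upwards [eventually_normSq (ht.eventually_top 1)] with y hy
    rw [tangent_radialVector_inl ((hy.differentiableAt (by simp)).hasDerivAt)]; ring
  rw [(h1.congr_eventuallyEq h2).2 i, radialTensor_apply]; ring

theorem pd_tangent_radialVector_inr (hr : ContDiffAt ℝ ∞ r (‖x‖ ^ 2)) (i j k : Fin n) :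
    pd i (tangent (radialVector t r) j (Sum.inr k)) x
      = 2 * deriv r (‖x‖ ^ 2) * x i * (1 : Matrix (Fin n) (Fin n) ℝ) j k
        + 2 * deriv r (‖x‖ ^ 2) * ((1 : Matrix (Fin n) (Fin n) ℝ) i j * x k
          + (1 : Matrix (Fin n) (Fin n) ℝ) i k * x j)
        + 4 * deriv (deriv r) (‖x‖ ^ 2) * (x i * x j * x k) := by
  have h1 := hasGrad_radialTensor hr.hasDerivAt_infty
    (hr.deriv_infty.hasDerivAt_infty.const_mul 2) j k
  have h2 : tangent (radialVector t r) j (Sum.inr k)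
      =ᶠ[𝓝 x] fun y => radialTensor (r (‖y‖ ^ 2)) (2 * deriv r (‖y‖ ^ 2)) y j k := by
    filter_upwards [eventually_normSq (hr.eventually_top 1)] with y hy
    rw [tangent_radialVector_inr ((hy.differentiableAt (by simp)).hasDerivAt)]
  rw [(h1.congr_eventuallyEq h2).2 i]; ring

theorem sum_mul_pd_tangent_radialVector (hr : ContDiffAt ℝ ∞ r (‖x‖ ^ 2)) (i j : Fin n) :
    ∑ k, x k * pd i (tangent (radialVector t r) j (Sum.inr k)) x
      = radialTensor (2 * ‖x‖ ^ 2 * deriv r (‖x‖ ^ 2))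
        (4 * deriv r (‖x‖ ^ 2) + 4 * ‖x‖ ^ 2 * deriv (deriv r) (‖x‖ ^ 2)) x i j := by
  have e : ∀ k, x k * pd i (tangent (radialVector t r) j (Sum.inr k)) x
      = 2 * deriv r (‖x‖ ^ 2) * x i * ((1 : Matrix (Fin n) (Fin n) ℝ) j k * x k)
        + 2 * deriv r (‖x‖ ^ 2) * (1 : Matrix (Fin n) (Fin n) ℝ) i j * (x k * x k)
        + 2 * deriv r (‖x‖ ^ 2) * x j * ((1 : Matrix (Fin n) (Fin n) ℝ) i k * x k)
        + 4 * deriv (deriv r) (‖x‖ ^ 2) * (x i * x j) * (x k * x k) := fun k => by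
    rw [pd_tangent_radialVector_inr hr]; ring
  simp only [e, Finset.sum_add_distrib, ← Finset.mul_sum, sum_one_mul, sum_mul_self]
  rw [radialTensor_apply]; ring

variable {φ φ' : ℝ → ℝ} {z : EuclideanSpace ℝ (Unit ⊕ Fin n)}

theorem sum_staticMetric (φ : ℝ → ℝ) (z : EuclideanSpace ℝ (Unit ⊕ Fin n)) (V W : Unit ⊕ Fin n → ℝ) :
    ∑ A, ∑ B, staticMetric φ z A B * V A * W B
      = -φ (‖spatial z‖ ^ 2) * V (Sum.inl ()) * W (Sum.inl ())
        + ∑ i, V (Sum.inr i) * W (Sum.inr i)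
        + ((φ (‖spatial z‖ ^ 2))⁻¹ - 1) / ‖spatial z‖ ^ 2
          * (∑ i, spatial z i * V (Sum.inr i)) * ∑ i, spatial z i * W (Sum.inr i) := by
  have e : ∀ i j, staticSpatial φ (spatial z) i j * V (Sum.inr i) * W (Sum.inr j)
      = (1 : Matrix (Fin n) (Fin n) ℝ) i j * W (Sum.inr j) * V (Sum.inr i)
        + ((φ (‖spatial z‖ ^ 2))⁻¹ - 1) / ‖spatial z‖ ^ 2
          * (spatial z i * V (Sum.inr i)) * (spatial z j * W (Sum.inr j)) := fun i j => by
    rw [staticSpatial, radialTensor_apply]; ring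
  simp only [Fintype.sum_sum_type, Finset.univ_unique, Finset.sum_singleton,
    PUnit.default_eq_unit, staticMetric, Matrix.fromBlocks_apply₁₁, Matrix.fromBlocks_apply₁₂,
    Matrix.fromBlocks_apply₂₁, Matrix.fromBlocks_apply₂₂, Matrix.zero_apply, zero_mul,
    Finset.sum_const_zero, add_zero, zero_add, Matrix.of_apply, e, Finset.sum_add_distrib,
    ← Finset.mul_sum, ← Finset.sum_mul, sum_one_mul]
  rw [add_assoc]
  congr 2
  exact Finset.sum_congr rfl fun i _ => mul_comm _ _

theorem sum_staticChristoffel_inl (φ φ' : ℝ → ℝ) (y : EuclideanSpace ℝ (Fin n))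
    (V W : Unit ⊕ Fin n → ℝ) :
    ∑ B, ∑ C, staticChristoffel φ φ' y (Sum.inl ()) B C * V B * W C
      = φ' (‖y‖ ^ 2) / φ (‖y‖ ^ 2) * (V (Sum.inl ()) * ∑ i, y i * W (Sum.inr i)
        + W (Sum.inl ()) * ∑ i, y i * V (Sum.inr i)) := by
  simp only [Fintype.sum_sum_type, Finset.univ_unique, Finset.sum_singleton,
    PUnit.default_eq_unit, staticChristoffel, zero_mul, Finset.sum_const_zero, add_zero, zero_add,
    mul_add, Finset.mul_sum]
  congr 1 <;> exact Finset.sum_congr rfl fun i _ => by ring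

/-- The spatial part of the normal of a radial map is parallel to the position vector, so only this
radial contraction of the Christoffel symbols enters the second fundamental form. -/
theorem sum_mul_staticChristoffel_inr {p : ℝ} {y : EuclideanSpace ℝ (Fin n)} (hs : ‖y‖ ≠ 0)
    (h0 : φ (‖y‖ ^ 2) ≠ 0) (hφ : ContDiffAt ℝ ∞ φ (‖y‖ ^ 2))
    (hode : HasDerivAt φ (p * (1 - φ (‖y‖ ^ 2)) / ‖y‖ ^ 2) (‖y‖ ^ 2)) (V W : Unit ⊕ Fin n → ℝ) :
    ∑ k, y k * ∑ B, ∑ C, staticChristoffel φ φ' y (Sum.inr k) B C * V B * W C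
      = φ (‖y‖ ^ 2) * φ' (‖y‖ ^ 2) * ‖y‖ ^ 2 * (V (Sum.inl ()) * W (Sum.inl ()))
        + (1 - φ (‖y‖ ^ 2)) * ∑ i, V (Sum.inr i) * W (Sum.inr i)
        - (1 - φ (‖y‖ ^ 2)) * (p / φ (‖y‖ ^ 2) + 1) / ‖y‖ ^ 2
          * (∑ i, y i * V (Sum.inr i)) * ∑ i, y i * W (Sum.inr i) := by
  have hne := pow_ne_zero 2 hs
  simp only [Fintype.sum_sum_type, Finset.univ_unique, Finset.sum_singleton,
    PUnit.default_eq_unit, staticChristoffel, zero_mul, Finset.sum_const_zero, add_zero, zero_add,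
    mul_add, Finset.sum_add_distrib]
  have e1 : ∑ k, y k * (φ (‖y‖ ^ 2) * φ' (‖y‖ ^ 2) * y k * V (Sum.inl ()) * W (Sum.inl ()))
      = φ (‖y‖ ^ 2) * φ' (‖y‖ ^ 2) * ‖y‖ ^ 2 * (V (Sum.inl ()) * W (Sum.inl ())) := by
    rw [← sum_mul_self, Finset.mul_sum, Finset.sum_mul]
    exact Finset.sum_congr rfl fun k _ => by ring
  have e2 : ∑ k, y k * ∑ a, ∑ b, christoffel (staticSpatial φ) k a b y * V (Sum.inr a)
        * W (Sum.inr b)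
      = ∑ a, ∑ b, (∑ k, y k * christoffel (staticSpatial φ) k a b y) * V (Sum.inr a)
        * W (Sum.inr b) := by
    simp only [Finset.mul_sum, Finset.sum_mul]
    rw [← Finset.sum_comm_cycle]
    exact Finset.sum_congr rfl fun a _ => Finset.sum_congr rfl fun b _ =>
      Finset.sum_congr rfl fun k _ => by ring
  have e3 : ∀ a b, (∑ k, y k * christoffel (staticSpatial φ) k a b y) * V (Sum.inr a)
        * W (Sum.inr b)
      = (1 - φ (‖y‖ ^ 2)) * V (Sum.inr a) * ((1 : Matrix (Fin n) (Fin n) ℝ) a b * W (Sum.inr b))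
        - (1 - φ (‖y‖ ^ 2)) * (p / φ (‖y‖ ^ 2) + 1) / ‖y‖ ^ 2
          * (y a * V (Sum.inr a)) * (y b * W (Sum.inr b)) := by
    intro a b
    simp only [christoffel_staticSpatial hs h0 hφ hode]
    rw [sum_mul_radialChristoffel, radialTensor_apply]
    generalize ‖y‖ ^ 2 = s at *
    field_simp
    ring
  rw [e1, e2]
  simp only [e3, Finset.sum_sub_distrib, ← Finset.mul_sum, sum_one_mul]
  simp only [mul_assoc, ← Finset.mul_sum]
  simp only [← mul_assoc, ← Finset.sum_mul]
  ring

end RadialVector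

end SpacetimePenrose
end

noncomputable section
namespace SpacetimePenrose

/-! ### Induced metric, normal and second fundamental form of radial maps -/

section RadialEmbedding

variable {n : ℕ} {φ T a β κ : ℝ → ℝ} {x : EuclideanSpace ℝ (Fin n)}

theorem sum_mul_tangent_radialVector {t r : ℝ → ℝ} {r' : ℝ} (hr : HasDerivAt r r' (‖x‖ ^ 2))
    (i : Fin n) : ∑ k, spatial (radialVector t r x) k * tangent (radialVector t r) i (Sum.inr k) x
      = r (‖x‖ ^ 2) * (r (‖x‖ ^ 2) + 2 * ‖x‖ ^ 2 * r') * x i := by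
  have e : ∀ k, spatial (radialVector t r x) k * tangent (radialVector t r) i (Sum.inr k) x
      = r (‖x‖ ^ 2) * (radialTensor (r (‖x‖ ^ 2)) (2 * r') x i k * x k) := fun k => by
    rw [tangent_radialVector_inr hr, spatial_radialVector, PiLp.smul_apply, smul_eq_mul]; ring
  simp only [e, ← Finset.mul_sum, sum_radialTensor_mul_self]
  ring

theorem sum_spatial_mul_radialVector (T β t κ : ℝ → ℝ) (x : EuclideanSpace ℝ (Fin n)) :
    ∑ k, spatial (radialVector T β x) k * radialVector t κ x (Sum.inr k)
      = β (‖x‖ ^ 2) * κ (‖x‖ ^ 2) * ‖x‖ ^ 2 := by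
  have e : ∀ k, spatial (radialVector T β x) k * radialVector t κ x (Sum.inr k)
      = β (‖x‖ ^ 2) * κ (‖x‖ ^ 2) * (x k * x k) := fun k => by
    change β (‖x‖ ^ 2) * x k * (κ (‖x‖ ^ 2) * x k) = _
    ring
  simp only [e, ← Finset.mul_sum, sum_mul_self]

theorem sum_tangent_mul_tangent_radialVector {t r : ℝ → ℝ} {r' : ℝ}
    (hr : HasDerivAt r r' (‖x‖ ^ 2)) (i j : Fin n) :
    ∑ k, tangent (radialVector t r) i (Sum.inr k) x * tangent (radialVector t r) j (Sum.inr k) x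
      = radialTensor (r (‖x‖ ^ 2) ^ 2) (4 * r (‖x‖ ^ 2) * r' + 4 * ‖x‖ ^ 2 * r' ^ 2) x i j := by
  have e : ∀ k, tangent (radialVector t r) i (Sum.inr k) x
        * tangent (radialVector t r) j (Sum.inr k) x
      = radialTensor (r (‖x‖ ^ 2)) (2 * r') x i k * radialTensor (r (‖x‖ ^ 2)) (2 * r') x k j :=
    fun k => by
      rw [tangent_radialVector_inr hr, tangent_radialVector_inr hr, radialTensor_apply _ _ _ j k,
        radialTensor_apply _ _ _ k j, one_comm_apply j k, mul_comm (x j)]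
  simp only [e, ← Matrix.mul_apply, radialTensor_mul]
  congr 1 <;> ring

/-- In terms of the profile, A = a², b = β² and c = β κ, and `hrel` says that φ at the squared area
radius s β² equals F. The derivative of T is the one for which the radial component -φ (2T')² s + (β
+ 2 s β')²/φ equals a². -/
theorem induced_radialVector (hx : x ≠ 0) {s T' β' : ℝ} (es : ‖x‖ ^ 2 = s)
    (hT : HasDerivAt T T' s) (hβ : HasDerivAt β β' s) (hβ0 : β s ≠ 0)
    (hF : φ (s * β s ^ 2) ≠ 0) (hT' : T' = a s * κ s / (2 * φ (s * β s ^ 2)))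
    (hrel : φ (s * β s ^ 2) * a s ^ 2 = (β s + 2 * s * β') ^ 2 - s * a s ^ 2 * κ s ^ 2)
    (i j : Fin n) :
    ∑ A, ∑ B, staticMetric φ (radialVector T β x) A B * tangent (radialVector T β) i A x
      * tangent (radialVector T β) j B x
      = radialTensor (β s ^ 2) ((a s ^ 2 - β s ^ 2) / s) x i j := by
  have hs0 : s ≠ 0 := by rw [← es]; exact pow_ne_zero 2 (norm_ne_zero_iff.2 hx)
  subst es
  rw [sum_staticMetric φ (radialVector T β x) (fun A => tangent (radialVector T β) i A x)
    (fun B => tangent (radialVector T β) j B x), norm_spatial_radialVector,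
    tangent_radialVector_inl hT, tangent_radialVector_inl hT, sum_mul_tangent_radialVector hβ,
    sum_mul_tangent_radialVector hβ, sum_tangent_mul_tangent_radialVector hβ, radialTensor_apply,
    radialTensor_apply, hT']
  generalize ‖x‖ ^ 2 = s at *
  generalize φ (s * β s ^ 2) = F at *
  field_simp
  linear_combination -(x i * x j) * hrel

theorem normal_radialVector (hx : x ≠ 0) {s T' β' : ℝ} {t : ℝ → ℝ} (es : ‖x‖ ^ 2 = s)
    (hT : HasDerivAt T T' s) (hβ : HasDerivAt β β' s) (hβ0 : β s ≠ 0) (ha : a s ≠ 0)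
    (hF : φ (s * β s ^ 2) ≠ 0) (hT' : T' = a s * κ s / (2 * φ (s * β s ^ 2)))
    (ht : t s = (β s + 2 * s * β') / (a s * φ (s * β s ^ 2))) (i : Fin n) :
    ∑ A, ∑ B, staticMetric φ (radialVector T β x) A B * radialVector t κ x A
      * tangent (radialVector T β) i B x = 0 := by
  have hs0 : s ≠ 0 := by rw [← es]; exact pow_ne_zero 2 (norm_ne_zero_iff.2 hx)
  subst es
  rw [sum_staticMetric φ (radialVector T β x) (radialVector t κ x)
    (fun B => tangent (radialVector T β) i B x), norm_spatial_radialVector,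
    tangent_radialVector_inl hT, sum_mul_tangent_radialVector hβ]
  have e1 : ∑ k, radialVector t κ x (Sum.inr k) * tangent (radialVector T β) i (Sum.inr k) x
      = κ (‖x‖ ^ 2) * (β (‖x‖ ^ 2) + 2 * ‖x‖ ^ 2 * β') * x i := by
    have e : ∀ k, radialVector t κ x (Sum.inr k) * tangent (radialVector T β) i (Sum.inr k) x
        = κ (‖x‖ ^ 2) * (radialTensor (β (‖x‖ ^ 2)) (2 * β') x i k * x k) := fun k => by
      rw [tangent_radialVector_inr hβ]
      change κ (‖x‖ ^ 2) * x k * _ = _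
      ring
    simp only [e, ← Finset.mul_sum, sum_radialTensor_mul_self]
    ring
  rw [e1, sum_spatial_mul_radialVector]
  change -φ (‖x‖ ^ 2 * β (‖x‖ ^ 2) ^ 2) * t (‖x‖ ^ 2) * _ + _ + _ = 0
  rw [hT', ht]
  generalize ‖x‖ ^ 2 = s at *
  generalize φ (s * β s ^ 2) = F at *
  field_simp
  ring

theorem unit_radialVector (hx : x ≠ 0) {s v : ℝ} {t : ℝ → ℝ} (es : ‖x‖ ^ 2 = s)
    (hβ0 : β s ≠ 0) (ha : a s ≠ 0) (hF : φ (s * β s ^ 2) ≠ 0)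
    (ht : t s = v / (a s * φ (s * β s ^ 2)))
    (hrel : φ (s * β s ^ 2) * a s ^ 2 = v ^ 2 - s * a s ^ 2 * κ s ^ 2) :
    ∑ A, ∑ B, staticMetric φ (radialVector T β x) A B * radialVector t κ x A
      * radialVector t κ x B = -1 := by
  have hs0 : s ≠ 0 := by rw [← es]; exact pow_ne_zero 2 (norm_ne_zero_iff.2 hx)
  subst es
  rw [sum_staticMetric φ (radialVector T β x) (radialVector t κ x) (radialVector t κ x),
    norm_spatial_radialVector]
  have e1 : ∑ k, radialVector t κ x (Sum.inr k) * radialVector t κ x (Sum.inr k)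
      = κ (‖x‖ ^ 2) ^ 2 * ‖x‖ ^ 2 := by
    have e : ∀ k, radialVector t κ x (Sum.inr k) * radialVector t κ x (Sum.inr k)
        = κ (‖x‖ ^ 2) ^ 2 * (x k * x k) := fun k => by
      change κ (‖x‖ ^ 2) * x k * (κ (‖x‖ ^ 2) * x k) = _
      ring
    simp only [e, ← Finset.mul_sum, sum_mul_self]
  rw [e1, sum_spatial_mul_radialVector]
  change -φ (‖x‖ ^ 2 * β (‖x‖ ^ 2) ^ 2) * t (‖x‖ ^ 2) * t (‖x‖ ^ 2) + _ + _ = -1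
  rw [ht]
  generalize ‖x‖ ^ 2 = s at *
  generalize φ (s * β s ^ 2) = F at *
  field_simp
  linear_combination hrel

/-- The radial component of the second fundamental form of a radial embedding. -/
theorem second_radial_coeff {s a β κ v a' κ' β' β'' v' F F' P K : ℝ} (hs : s ≠ 0) (hβ : β ≠ 0)
    (ha : a ≠ 0) (hv : v ≠ 0) (hF : F ≠ 0) (ev : v = β + 2 * s * β') (ev' : v' = 3 * β' + 2 * s * β'')
    (hF' : F' = P * v / (s * β)) (hrel : F * a ^ 2 = v ^ 2 - s * a ^ 2 * κ ^ 2)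
    (hrel' : F' * a ^ 2 + 2 * F * a * a' = 2 * v * v' - a ^ 2 * κ ^ 2
      - s * (2 * a * a' * κ ^ 2 + 2 * a ^ 2 * κ * κ'))
    (hK : K * v = a ^ 2 * (κ + 2 * s * κ')) :
    v / a * (4 * ((a' * κ + a * κ') / (2 * F) - a * κ * F' / (2 * F ^ 2))
        + 2 * (P / (s * β ^ 2) / F) * (a * κ / F) * β * v)
      - κ / F * (4 * β' + 4 * s * β'' + β⁻¹ * (F * P * (a * κ / F) ^ 2
        + (1 - F) * (4 * β * β' + 4 * s * β' ^ 2) - (P / F + (1 - F)) / s * v ^ 2))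
      = (K - β * κ) / s := by
  -- The hypotheses are linear in β', β'', P, K and v', which are eliminated in turn. Only the
  -- algebraic relation `hrel` is left.
  obtain rfl : β' = (v - β) / (2 * s) := by rw [ev]; field_simp; ring
  obtain rfl : β'' = (v' - 3 * ((v - β) / (2 * s))) / (2 * s) := by rw [ev']; field_simp; ring
  obtain rfl : P = F' * (s * β) / v := by rw [hF']; field_simp
  obtain rfl : K = a ^ 2 * (κ + 2 * s * κ') / v := by rw [← hK]; field_simp
  obtain rfl : v' = (F' * a ^ 2 + 2 * F * a * a' + a ^ 2 * κ ^ 2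
      + s * (2 * a * a' * κ ^ 2 + 2 * a ^ 2 * κ * κ')) / (2 * v) := by
    rw [hrel']; field_simp; ring
  rw [← sub_eq_zero]
  have hr : v ^ 2 - s * a ^ 2 * κ ^ 2 - F * a ^ 2 = 0 := by rw [hrel]; ring
  clear ev ev' hF' hrel hrel' hK
  -- After the elimination, the difference of the two sides is this explicit multiple of the
  -- relation `hrel`.
  trans (κ * F' * s * a + 2 * a' * κ * F * s + 2 * κ' * F * s * a + κ * F * a) / (F ^ 2 * v * s * a)
    * (v ^ 2 - s * a ^ 2 * κ ^ 2 - F * a ^ 2)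
  · field_simp
    ring
  · rw [hr, mul_zero]

/-- The tangential coefficient β κ comes from the spatial component κ of the normal. The radial one
is `second_radial_coeff`, where `hrel'` is the derivative of `hrel` and `hK` is the vanishing of the
momentum density. -/
theorem second_radialVector (hx : x ≠ 0) {s p v v' a' κ' F' K : ℝ} {t : ℝ → ℝ} (es : ‖x‖ ^ 2 = s)
    (hT : ContDiffAt ℝ ∞ T s) (hβ : ContDiffAt ℝ ∞ β s) (hβ0 : β s ≠ 0) (ha : a s ≠ 0)
    (hF : φ (s * β s ^ 2) ≠ 0) (hφ : ContDiffAt ℝ ∞ φ (s * β s ^ 2))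
    (hode : HasDerivAt φ (p * (1 - φ (s * β s ^ 2)) / (s * β s ^ 2)) (s * β s ^ 2))
    (ev : v = β s + 2 * s * deriv β s) (ev' : v' = 3 * deriv β s + 2 * s * deriv (deriv β) s)
    (hv : v ≠ 0) (ht : t s = v / (a s * φ (s * β s ^ 2)))
    (hT' : deriv T s = a s * κ s / (2 * φ (s * β s ^ 2)))
    (hT'' : deriv (deriv T) s = (a' * κ s + a s * κ') / (2 * φ (s * β s ^ 2))
      - a s * κ s * F' / (2 * φ (s * β s ^ 2) ^ 2))
    (hF' : F' = p * (1 - φ (s * β s ^ 2)) * v / (s * β s))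
    (hrel : φ (s * β s ^ 2) * a s ^ 2 = v ^ 2 - s * a s ^ 2 * κ s ^ 2)
    (hrel' : F' * a s ^ 2 + 2 * φ (s * β s ^ 2) * a s * a' = 2 * v * v' - a s ^ 2 * κ s ^ 2
      - s * (2 * a s * a' * κ s ^ 2 + 2 * a s ^ 2 * κ s * κ'))
    (hK : K * v = a s ^ 2 * (κ s + 2 * s * κ')) (i j : Fin n) :
    -∑ A, ∑ B, staticMetric φ (radialVector T β x) A B * radialVector t κ x A
      * accel (staticMetric φ) (radialVector T β) i j B x
      = radialTensor (β s * κ s) ((K - β s * κ s) / s) x i j := by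
  have hs0 : s ≠ 0 := by rw [← es]; exact pow_ne_zero 2 (norm_ne_zero_iff.2 hx)
  subst es
  have hdT := hT.hasDerivAt_infty
  have hdβ := hβ.hasDerivAt_infty
  have hy : ‖spatial (radialVector T β x)‖ ≠ 0 := by
    rw [spatial_radialVector, norm_smul]
    exact mul_ne_zero (norm_ne_zero_iff.2 hβ0) (norm_ne_zero_iff.2 hx)
  have hnorm := norm_spatial_radialVector T β x
  rw [← hnorm] at hF hφ hode
  set ψ : ℝ → ℝ := fun u => p * (1 - φ u) / u with hψ
  have hΓ := christoffel_staticMetric (φ' := ψ) hy hF hode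
  have hin := sum_staticChristoffel_inl φ ψ (spatial (radialVector T β x))
    (fun A => tangent (radialVector T β) i A x) (fun A => tangent (radialVector T β) j A x)
  have hout := sum_mul_staticChristoffel_inr (φ' := ψ) hy hF hφ hode
    (fun A => tangent (radialVector T β) i A x) (fun A => tangent (radialVector T β) j A x)
  rw [hnorm, sum_mul_tangent_radialVector hdβ, sum_mul_tangent_radialVector hdβ,
    tangent_radialVector_inl hdT, tangent_radialVector_inl hdT] at hin hout
  rw [sum_tangent_mul_tangent_radialVector hdβ] at hout
  have hacct : accel (staticMetric φ) (radialVector T β) i j (Sum.inl ()) x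
      = radialTensor (2 * deriv T (‖x‖ ^ 2)) (4 * deriv (deriv T) (‖x‖ ^ 2)) x i j
        + ∑ B, ∑ C, staticChristoffel φ ψ (spatial (radialVector T β x)) (Sum.inl ()) B C
          * tangent (radialVector T β) i B x * tangent (radialVector T β) j C x := by
    rw [accel, pd_tangent_radialVector_inl hT]
    simp only [hΓ]
  have haccx : ∑ k, x k * accel (staticMetric φ) (radialVector T β) i j (Sum.inr k) x
      = radialTensor (2 * ‖x‖ ^ 2 * deriv β (‖x‖ ^ 2))
        (4 * deriv β (‖x‖ ^ 2) + 4 * ‖x‖ ^ 2 * deriv (deriv β) (‖x‖ ^ 2)) x i j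
        + (β (‖x‖ ^ 2))⁻¹ * ∑ k, spatial (radialVector T β x) k * ∑ B, ∑ C,
          staticChristoffel φ ψ (spatial (radialVector T β x)) (Sum.inr k) B C
          * tangent (radialVector T β) i B x * tangent (radialVector T β) j C x := by
    rw [Finset.mul_sum, ← sum_mul_pd_tangent_radialVector (t := T) hβ,
      ← Finset.sum_add_distrib]
    refine Finset.sum_congr rfl fun k _ => ?_
    rw [accel]
    simp only [hΓ]
    change _ = _ + (β (‖x‖ ^ 2))⁻¹ * (β (‖x‖ ^ 2) * x k * _)
    rw [mul_add, mul_assoc (β (‖x‖ ^ 2)), inv_mul_cancel_left₀ hβ0]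
  rw [hin] at hacct
  rw [hout] at haccx
  rw [sum_staticMetric φ (radialVector T β x) (radialVector t κ x)
    (fun B => accel (staticMetric φ) (radialVector T β) i j B x), hnorm]
  have e1 : ∑ k, radialVector t κ x (Sum.inr k)
        * accel (staticMetric φ) (radialVector T β) i j (Sum.inr k) x
      = κ (‖x‖ ^ 2) * ∑ k, x k * accel (staticMetric φ) (radialVector T β) i j (Sum.inr k) x := by
    rw [Finset.mul_sum]
    exact Finset.sum_congr rfl fun k _ => mul_assoc _ _ _
  have e2 : ∑ k, spatial (radialVector T β x) k
        * accel (staticMetric φ) (radialVector T β) i j (Sum.inr k) x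
      = β (‖x‖ ^ 2) * ∑ k, x k * accel (staticMetric φ) (radialVector T β) i j (Sum.inr k) x := by
    rw [Finset.mul_sum]
    exact Finset.sum_congr rfl fun k _ => mul_assoc _ _ _
  rw [e1, e2, sum_spatial_mul_radialVector, haccx, hacct]
  change -(-φ (‖x‖ ^ 2 * β (‖x‖ ^ 2) ^ 2) * t (‖x‖ ^ 2) * _ + _ + _) = _
  simp only [radialTensor_apply, hψ]
  rw [hnorm] at hF
  clear hφ hode hΓ hin hout hacct haccx e1 e2 hy hnorm hdT hdβ hT hβ hψ ψ
  rw [ht, hT', hT'']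
  generalize ‖x‖ ^ 2 = s at *
  generalize φ (s * β s ^ 2) = F at *
  generalize hβ₀ : deriv β = β₀ at *
  generalize β s = β at *
  rw [← second_radial_coeff hs0 hβ0 ha hv hF ev ev' hF' hrel hrel' hK]
  generalize β₀ s = β' at *
  subst ev
  field_simp
  ring

end RadialEmbedding

end SpacetimePenrose
end

noncomputable section
namespace SpacetimePenrose

/-! ### Embedding vacuum data into Schwarzschild -/

theorem exists_primitive {q : ℝ → ℝ} {l : ℝ} (hq : ∀ s, l < s → ContDiffAt ℝ ∞ q s) :
    ∃ T : ℝ → ℝ, ∀ s, l < s → HasDerivAt T (q s) s ∧ ContDiffAt ℝ ∞ T s := by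
  have hc : ContinuousOn q (Ioi l) := fun s hs => (hq s hs).continuousAt.continuousWithinAt
  set T : ℝ → ℝ := fun s => ∫ t in (l + 1)..s, q t with hT
  have hd : ∀ s, l < s → HasDerivAt T (q s) s := by
    intro s hs
    have hsub : uIcc (l + 1) s ⊆ Ioi l := by
      intro t ht
      rcases le_total (l + 1) s with h | h
      · rw [uIcc_of_le h] at ht; exact lt_of_lt_of_le (by linarith) ht.1
      · rw [uIcc_of_ge h] at ht; exact lt_of_lt_of_le hs ht.1
    exact intervalIntegral.integral_hasDerivAt_right ((hc.mono hsub).intervalIntegrable)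
      (hc.stronglyMeasurableAtFilter isOpen_Ioi s hs) (hc.continuousAt (isOpen_Ioi.mem_nhds hs))
  refine ⟨T, fun s hs => ⟨hd s hs, ?_⟩⟩
  have hT' : ContDiffOn ℝ ∞ T (Ioi l) := by
    rw [contDiffOn_infty_iff_deriv_of_isOpen isOpen_Ioi]
    refine ⟨fun t ht => (hd t ht).differentiableAt.differentiableWithinAt, ?_⟩
    have : ContDiffOn ℝ ∞ q (Ioi l) := fun t ht => (hq t ht).contDiffWithinAt
    exact this.congr fun t ht => (hd t ht).deriv
  exact hT'.contDiffAt (isOpen_Ioi.mem_nhds hs)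

/-- The spatial part alone determines x: its squared norm s β(s)² is strictly increasing in s =
|x|², and then x is the spatial part divided by β(s). A strictly monotone function has a continuous
inverse, which makes this recovery continuous. -/
theorem isEmbedding_radialVector {n : ℕ} {T β : ℝ → ℝ} {R : ℝ} (hR : 0 ≤ R)
    (hT : ∀ s, R ^ 2 < s → ContinuousAt T s) (hβ : ∀ s, R ^ 2 < s → ContinuousAt β s)
    (hβ0 : ∀ s, R ^ 2 < s → 0 < β s) (hmono : StrictMonoOn (fun s => s * β s ^ 2) (Ioi (R ^ 2))) :
    IsEmbedding ({x : EuclideanSpace ℝ (Fin n) | R < ‖x‖}.domRestrict (radialVector T β)) := by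
  have hmem : ∀ x : {x : EuclideanSpace ℝ (Fin n) | R < ‖x‖}, R ^ 2 < ‖x.1‖ ^ 2 := fun x =>
    pow_lt_pow_left₀ x.2 hR two_ne_zero
  have hrec : ∀ x : {x : EuclideanSpace ℝ (Fin n) | R < ‖x‖},
      x.1 = (β (‖x.1‖ ^ 2))⁻¹ • spatial (radialVector T β x.1) := fun x => by
    rw [spatial_radialVector, smul_smul, inv_mul_cancel₀ (hβ0 _ (hmem x)).ne', one_smul]
  have hcont : Continuous ({x : EuclideanSpace ℝ (Fin n) | R < ‖x‖}.domRestrict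
      (radialVector T β)) := by
    rw [continuous_iff_continuousAt]
    intro x
    have hx : ContinuousAt (radialVector T β) x.1 := by
      have hn : ContinuousAt (fun y : EuclideanSpace ℝ (Fin n) => ‖y‖ ^ 2) x.1 :=
        (continuous_norm.pow 2).continuousAt
      refine (PiLp.continuous_toLp 2 _).continuousAt.comp (continuousAt_pi.2 ?_)
      rintro (_ | i)
      · exact ContinuousAt.comp (f := fun y : EuclideanSpace ℝ (Fin n) => ‖y‖ ^ 2)
          (hT _ (hmem x)) hn
      · exact (ContinuousAt.comp (f := fun y : EuclideanSpace ℝ (Fin n) => ‖y‖ ^ 2)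
          (hβ _ (hmem x)) hn).mul (EuclideanSpace.proj i).continuous.continuousAt
    exact hx.comp continuous_subtype_val.continuousAt
  refine ⟨isInducing_iff_nhds.2 fun x => le_antisymm hcont.continuousAt.le_comap ?_, ?_⟩
  · set F : Filter {x : EuclideanSpace ℝ (Fin n) | R < ‖x‖} := comap
      ({x : EuclideanSpace ℝ (Fin n) | R < ‖x‖}.domRestrict (radialVector T β))
      (𝓝 ({x : EuclideanSpace ℝ (Fin n) | R < ‖x‖}.domRestrict (radialVector T β) x)) with hF
    have h1 : Tendsto (fun y : {x : EuclideanSpace ℝ (Fin n) | R < ‖x‖} =>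
        spatial (radialVector T β y.1)) F (𝓝 (spatial (radialVector T β x.1))) :=
      (tendsto_spatial _).comp tendsto_comap
    have h2 : Tendsto (fun y : {x : EuclideanSpace ℝ (Fin n) | R < ‖x‖} =>
        ‖y.1‖ ^ 2 * β (‖y.1‖ ^ 2) ^ 2) F (𝓝 (‖x.1‖ ^ 2 * β (‖x.1‖ ^ 2) ^ 2)) := by
      simp only [← norm_spatial_radialVector T β]
      exact h1.norm.pow 2
    have h3 : Tendsto (fun y : {x : EuclideanSpace ℝ (Fin n) | R < ‖x‖} => ‖y.1‖ ^ 2) F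
        (𝓝 (‖x.1‖ ^ 2)) := by
      have hx := hmem x
      refine tendsto_order.2 ⟨fun l hl => ?_, fun l hl => ?_⟩
      -- The midpoint keeps the comparison value above R², where monotonicity is available.
      · have hl' : max l ((R ^ 2 + ‖x.1‖ ^ 2) / 2) < ‖x.1‖ ^ 2 := max_lt hl (by linarith)
        have hl2 : R ^ 2 < max l ((R ^ 2 + ‖x.1‖ ^ 2) / 2) := lt_max_of_lt_right (by linarith)
        filter_upwards [h2.eventually_const_lt (hmono hl2 hx hl')] with y hy
        exact (le_max_left _ _).trans_lt ((hmono.lt_iff_lt hl2 (hmem y)).1 hy)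
      · filter_upwards [h2.eventually_lt_const (hmono hx (hx.trans hl) hl)] with y hy
        exact (hmono.lt_iff_lt (hmem y) (hx.trans hl)).1 hy
    have h4 : Tendsto (fun y : {x : EuclideanSpace ℝ (Fin n) | R < ‖x‖} => y.1) F (𝓝 x.1) := by
      rw [hrec x]
      exact ((((hβ _ (hmem x)).tendsto.comp h3).inv₀ (hβ0 _ (hmem x)).ne').smul h1).congr
        fun y => (hrec y).symm
    rw [nhds_subtype_eq_comap]
    exact tendsto_iff_comap.1 h4
  · intro x y hxy
    have h1 : spatial (radialVector T β x.1) = spatial (radialVector T β y.1) :=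
      congrArg spatial hxy
    have h2 : ‖x.1‖ ^ 2 = ‖y.1‖ ^ 2 := by
      refine hmono.injOn (hmem x) (hmem y) ?_
      simp only [← norm_spatial_radialVector T β, h1]
    exact Subtype.ext (by rw [hrec x, hrec y, h1, h2])

end SpacetimePenrose
end

noncomputable section
namespace SpacetimePenrose
namespace InitialDataSet

variable {n : ℕ}

namespace HasProfile

variable {D : InitialDataSet n} {A b K c : ℝ → ℝ}

/-- Constancy of the Hawking mass supplies the induced metric, vanishing of the momentum density the
radial part of k, and positivity of the null expansions gives F > 0 and strict growth of the area
radius. -/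
theorem embedsInSchwarzschild (h : D.HasProfile A b K c) (hn : 3 ≤ n) {R m : ℝ} (hR : 0 < R)
    (hR' : D.r₀ ≤ R)
    (hθ : ∀ s, R ^ 2 < s → 0 < profileThetaPlus A b c s ∧ 0 < profileThetaMinus A b c s)
    (hm : ∀ s, R ^ 2 < s → hawking n A b c s = 2 * m ∧ profileMomentum n A b K c s = 0) :
    D.EmbedsInSchwarzschild {x | R < ‖x‖} m := by
  have hpos : ∀ s, R ^ 2 < s → 0 < s := fun s hs => (sq_nonneg R).trans_lt hs
  have hr₀ : ∀ s, R ^ 2 < s → D.r₀ ^ 2 ≤ s := fun s hs =>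
    (pow_le_pow_left₀ D.r₀_nonneg hR' 2).trans hs.le
  have hn1 : (n : ℝ) - 1 ≠ 0 := by
    have : (3 : ℝ) ≤ n := by exact_mod_cast hn
    intro h0; linarith
  have hA := fun s hs => h.pos_A s (hpos s hs) (hr₀ s hs)
  have hb := fun s hs => h.pos_b s (hpos s hs) (hr₀ s hs)
  set a : ℝ → ℝ := fun s => Real.sqrt (A s) with ha
  set β : ℝ → ℝ := fun s => Real.sqrt (b s) with hβ
  set κ : ℝ → ℝ := fun s => c s / β s with hκ
  set φ : ℝ → ℝ := fun u => schwarzschildFactor n m (Real.sqrt u) with hφ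
  set v : ℝ → ℝ := fun s => β s + 2 * s * deriv β s with hv
  have ha0 : ∀ s, R ^ 2 < s → 0 < a s := fun s hs => Real.sqrt_pos.2 (hA s hs)
  have hβ0 : ∀ s, R ^ 2 < s → 0 < β s := fun s hs => Real.sqrt_pos.2 (hb s hs)
  have sa : ∀ s, R ^ 2 < s → ContDiffAt ℝ ∞ a s := fun s hs =>
    (h.smooth_A s (hpos s hs) (hr₀ s hs)).sqrt (hA s hs).ne'
  have sβ : ∀ s, R ^ 2 < s → ContDiffAt ℝ ∞ β s := fun s hs =>
    (h.smooth_b s (hpos s hs) (hr₀ s hs)).sqrt (hb s hs).ne'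
  have sκ : ∀ s, R ^ 2 < s → ContDiffAt ℝ ∞ κ s := fun s hs =>
    (h.smooth_c s (hpos s hs) (hr₀ s hs)).div (sβ s hs) (hβ0 s hs).ne'
  have sv : ∀ s, R ^ 2 < s → ContDiffAt ℝ ∞ v s := fun s hs =>
    (sβ s hs).add ((contDiffAt_const.mul contDiffAt_id).mul (sβ s hs).deriv_infty)
  have eA : ∀ s, R ^ 2 < s → A s = a s ^ 2 := fun s hs => (Real.sq_sqrt (hA s hs).le).symm
  have eb : ∀ s, R ^ 2 < s → b s = β s ^ 2 := fun s hs => (Real.sq_sqrt (hb s hs).le).symm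
  have ec : ∀ s, R ^ 2 < s → c s = β s * κ s := fun s hs =>
    (mul_div_cancel₀ (c s) (hβ0 s hs).ne').symm
  have hI : ∀ s, R ^ 2 < s → ∀ᶠ t in 𝓝 s, R ^ 2 < t := fun s hs => isOpen_Ioi.mem_nhds hs
  have eb' : ∀ s, R ^ 2 < s → deriv b s = 2 * β s * deriv β s := fun s hs => by
    rw [Filter.EventuallyEq.deriv_eq ((hI s hs).mono eb)]
    have h1 : HasDerivAt (fun s => β s ^ 2) _ s := (sβ s hs).hasDerivAt_infty.pow 2
    rw [h1.deriv]
    simp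
  have ec' : ∀ s, R ^ 2 < s → deriv c s = deriv β s * κ s + β s * deriv κ s := fun s hs => by
    rw [Filter.EventuallyEq.deriv_eq ((hI s hs).mono ec)]
    exact ((sβ s hs).hasDerivAt_infty.mul (sκ s hs).hasDerivAt_infty).deriv
  have ew : ∀ s, R ^ 2 < s → b s + s * deriv b s = β s * v s := fun s hs => by
    rw [eb' s hs, eb s hs, hv]; ring
  have hv0 : ∀ s, R ^ 2 < s → 0 < v s := fun s hs => by
    have h1 := (hθ s hs).1
    have h2 := (hθ s hs).2
    rw [profileThetaPlus] at h1
    rw [profileThetaMinus] at h2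
    have h3 : 0 < β s * v s := by rw [← ew s hs]; linarith
    exact pos_of_mul_pos_right h3 (hβ0 s hs).le
  -- Solving `hawking` = 2m for F gives 1 - 2m/ρ^{n-2}, so F is the Schwarzschild factor at the area
  -- radius.
  have eF : ∀ s, R ^ 2 < s → φ (s * β s ^ 2) = profileF A b c s := fun s hs => by
    have h1 := (hm s hs).1
    rw [hawking, eb s hs] at h1
    have h2 : Real.sqrt (s * β s ^ 2) ^ (n - 2) ≠ 0 :=
      pow_ne_zero _ (Real.sqrt_pos.2 (mul_pos (hpos s hs) (pow_pos (hβ0 s hs) 2))).ne'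
    rw [hφ]
    dsimp only
    rw [schwarzschildFactor, ← h1]
    field_simp
    ring
  have hF0 : ∀ s, R ^ 2 < s → 0 < φ (s * β s ^ 2) := fun s hs => by
    rw [eF s hs]
    exact profileF_pos h (hpos s hs) (hr₀ s hs) (hθ s hs).1 (hθ s hs).2
  have hrel : ∀ s, R ^ 2 < s →
      φ (s * β s ^ 2) * a s ^ 2 = v s ^ 2 - s * a s ^ 2 * κ s ^ 2 := fun s hs => by
    have h1 := (hβ0 s hs).ne'
    have h2 := (ha0 s hs).ne'
    rw [eF s hs, profileF, ew s hs, eA s hs, ec s hs, eb s hs]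
    field_simp
  have hu : ∀ s, R ^ 2 < s → 0 < s * β s ^ 2 := fun s hs =>
    mul_pos (hpos s hs) (pow_pos (hβ0 s hs) 2)
  have hode : ∀ s, R ^ 2 < s → HasDerivAt φ
      (((n : ℝ) - 2) / 2 * (1 - φ (s * β s ^ 2)) / (s * β s ^ 2)) (s * β s ^ 2) := fun s hs =>
    hasDerivAt_schwarzschildFactor (by omega) m (hu s hs)
  have sφ : ∀ s, R ^ 2 < s → ContDiffAt ℝ ∞ φ (s * β s ^ 2) := fun s hs =>
    contDiffAt_schwarzschildFactor m (hu s hs)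
  clear_value φ
  have sφu : ∀ s, R ^ 2 < s → ContDiffAt ℝ ∞ (fun s => φ (s * β s ^ 2)) s := fun s hs =>
    (sφ s hs).comp s (contDiffAt_id.mul ((sβ s hs).pow 2))
  have du : ∀ s, R ^ 2 < s → HasDerivAt (fun s => s * β s ^ 2) (β s * v s) s := fun s hs => by
    refine ((hasDerivAt_id s).mul ((sβ s hs).hasDerivAt_infty.pow 2)).congr_deriv ?_
    simp [hv]
    ring
  have dφ : ∀ s, R ^ 2 < s → HasDerivAt (fun s => φ (s * β s ^ 2))
      (((n : ℝ) - 2) / 2 * (1 - φ (s * β s ^ 2)) * v s / (s * β s)) s := fun s hs => by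
    refine ((hode s hs).comp s (du s hs)).congr_deriv ?_
    have := (hβ0 s hs).ne'
    have := (hpos s hs).ne'
    field_simp
  have sq : ∀ s, R ^ 2 < s → ContDiffAt ℝ ∞ (fun s => a s * κ s / (2 * φ (s * β s ^ 2))) s :=
    fun s hs => ((sa s hs).mul (sκ s hs)).div (contDiffAt_const.mul (sφu s hs))
      (mul_ne_zero two_ne_zero (hF0 s hs).ne')
  -- The time function is determined up to a constant, that is, up to a time translation of
  -- Schwarzschild.
  obtain ⟨T, hT⟩ := exists_primitive sq
  set t : ℝ → ℝ := fun s => v s / (a s * φ (s * β s ^ 2)) with ht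
  refine ⟨radialVector T β, radialVector t κ, ?_, fun x hx => ?_⟩
  · refine isEmbedding_radialVector hR.le (fun s hs => (hT s hs).1.continuousAt)
      (fun s hs => (sβ s hs).continuousAt) hβ0 ?_
    refine strictMonoOn_of_deriv_pos (convex_Ioi _)
      (fun s hs => (du s hs).continuousAt.continuousWithinAt) fun s hs => ?_
    rw [interior_Ioi] at hs
    rw [(du s hs).deriv]
    exact mul_pos (hβ0 s hs) (hv0 s hs)
  obtain ⟨s, es⟩ : ∃ s, ‖x‖ ^ 2 = s := ⟨_, rfl⟩
  have hs : R ^ 2 < s := by rw [← es]; exact pow_lt_pow_left₀ hx hR.le two_ne_zero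
  have hx0 : x ≠ 0 := by
    rintro rfl
    rw [mem_ofPred_eq, norm_zero] at hx
    exact absurd hx hR.le.not_gt
  have hxM : x ∈ D.M := hR'.trans (le_of_lt hx)
  have dT : HasDerivAt T _ s := (hT s hs).1
  have dβ := (sβ s hs).hasDerivAt_infty
  have b0 := (hβ0 s hs).ne'
  have a0 := (ha0 s hs).ne'
  have F0 := (hF0 s hs).ne'
  have s0 := (hpos s hs).ne'
  have v0 := (hv0 s hs).ne'
  rw [schwarzschildMetric_eq, ← hφ]
  refine ⟨contDiffAt_radialVector (es ▸ (hT s hs).2) (es ▸ sβ s hs), contDiffAt_radialVector ?_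
    (es ▸ sκ s hs), ⟨?_, ?_⟩, fun i j => ?_, fun i => ?_, ?_, ?_, fun i j => ?_⟩
  · rw [es]
    exact (sv s hs).div ((sa s hs).mul (sφu s hs)) (mul_ne_zero a0 F0)
  · rw [spatial_radialVector, norm_smul, es]
    exact mul_pos (norm_pos_iff.2 b0) (norm_pos_iff.2 hx0)
  · have := hF0 s hs
    rw [← es, ← norm_spatial_radialVector T β x, hφ] at this
    simpa only [Real.sqrt_sq (norm_nonneg _)] using this
  · rw [induced_radialVector (a := a) (κ := κ) hx0 es dT dβ b0 F0 rfl (hrel s hs),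
      h.g_eq x hxM hx0, es, eA s hs, eb s hs]
  · exact normal_radialVector (a := a) (t := t) hx0 es dT dβ b0 a0 F0 rfl rfl i
  · exact unit_radialVector (a := a) (t := t) hx0 es b0 a0 F0 rfl (hrel s hs)
  · change 0 < t (‖x‖ ^ 2)
    rw [es]
    exact div_pos (hv0 s hs) (mul_pos (ha0 s hs) (hF0 s hs))
  · have dT' : deriv T =ᶠ[𝓝 s] fun s => a s * κ s / (2 * φ (s * β s ^ 2)) :=
      (hI s hs).mono fun s hs => (hT s hs).1.deriv
    have dv : HasDerivAt v (3 * deriv β s + 2 * s * deriv (deriv β) s) s := by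
      refine (dβ.add (((hasDerivAt_id s).const_mul 2).mul
        (sβ s hs).deriv_infty.hasDerivAt_infty)).congr_deriv ?_
      simp only [id]
      ring
    have da := (sa s hs).hasDerivAt_infty
    have dκ := (sκ s hs).hasDerivAt_infty
    have da2 : HasDerivAt (fun s => a s ^ 2) (2 * a s * deriv a s) s :=
      (da.pow 2).congr_deriv (by simp)
    have dκ2 : HasDerivAt (fun s => κ s ^ 2) (2 * κ s * deriv κ s) s :=
      (dκ.pow 2).congr_deriv (by simp)
    have dv2 : HasDerivAt (fun s => v s ^ 2) _ s :=
      (dv.pow 2).congr_deriv (g' := 2 * v s * (3 * deriv β s + 2 * s * deriv (deriv β) s)) (by simp)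
    have dq : HasDerivAt (fun s => a s * κ s / (2 * φ (s * β s ^ 2))) _ s :=
      (da.mul dκ).div ((dφ s hs).const_mul 2) (mul_ne_zero two_ne_zero F0)
    -- `hrel` holds on a neighbourhood of s, so its two sides have the same derivative.
    have hrel' := (((dφ s hs).mul da2).congr_of_eventuallyEq
      (f₁ := fun s => v s ^ 2 - s * a s ^ 2 * κ s ^ 2) ((hI s hs).mono fun t ht =>
        (hrel t ht).symm)).unique (dv2.sub (((hasDerivAt_id s).mul da2).mul dκ2))
    have hJ := (hm s hs).2
    rw [second_radialVector (a := a) (t := t) (p := ((n : ℝ) - 2) / 2) (v := v s) (K := K s)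
      (a' := deriv a s) (κ' := deriv κ s)
      (F' := ((n : ℝ) - 2) / 2 * (1 - φ (s * β s ^ 2)) * v s / (s * β s))
      (v' := 3 * deriv β s + 2 * s * deriv (deriv β) s) hx0 es (hT s hs).2 (sβ s hs) b0 a0 F0
      (sφ s hs) (hode s hs) rfl rfl v0 rfl dT.deriv ?_ rfl (hrel s hs) ?_ ?_ i j,
      h.k_eq x hxM hx0, es, ec s hs]
    · rw [dT'.deriv_eq, dq.deriv]
      simp only [Pi.mul_apply]
      field_simp
    · simp only [id, Pi.mul_apply, one_mul] at hrel'
      linear_combination hrel'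
    -- Multiplied out, j = 0 is the relation K v = a² (κ + 2 s κ') that fixes the radial component
    -- of k.
    · rw [profileMomentum, ew s hs, eA s hs, eb s hs, ec s hs, ec' s hs, eb' s hs] at hJ
      have hJ' := (mul_eq_zero.1 hJ).resolve_left hn1
      have ev : v s = β s + 2 * s * deriv β s := rfl
      field_simp at hJ'
      rw [ev] at hJ' ⊢
      refine mul_left_cancel₀ b0 ?_
      linear_combination hJ'

end HasProfile
end InitialDataSet
end SpacetimePenrose
end

noncomputable section
namespace SpacetimePenrose
-- The Penrose inequality for the ADM mass
namespace InitialDataSet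

variable {n : ℕ} {D : InitialDataSet n}

theorem HasADMMass.unique {m m' : ℝ} (h : D.HasADMMass m) (h' : D.HasADMMass m') : m = m' := by
  obtain ⟨E, P, hE, hP, rfl⟩ := h
  obtain ⟨E', P', hE', hP', rfl⟩ := h'
  rw [tendsto_nhds_unique hE hE', funext fun i => tendsto_nhds_unique (hP i) (hP' i)]

theorem area_nonneg (D : InitialDataSet n) (S : ClosedHypersurface n) : 0 ≤ D.area S :=
  integral_nonneg fun _ => Real.sqrt_nonneg _

/-- The Penrose inequality with its equality case. -/
theorem penrose_inequality (hn : 3 ≤ n) {S : ClosedHypersurface n}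
    (haf : D.IsAsymptoticallyFlat) (hss : D.IsSphericallySymmetric)
    (hdec : D.DominantEnergyCondition) (hS : D.IsOutermostApparentHorizon S) :
    ∃ m : ℝ, D.HasADMMass m ∧ 0 < m ∧
      (D.area S / sphereVolume n) ^ (((n : ℝ) - 2) / ((n : ℝ) - 1)) ≤ 2 * m ∧
      (2 * m = (D.area S / sphereVolume n) ^ (((n : ℝ) - 2) / ((n : ℝ) - 1)) →
        D.EmbedsInSchwarzschild (S.outside ∩ D.M) m) ∧
      ((∃ m', D.EmbedsInSchwarzschild (S.outside ∩ D.M) m') →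
        2 * m = (D.area S / sphereVolume n) ^ (((n : ℝ) - 2) / ((n : ℝ) - 1))) := by
  obtain ⟨A, b, K, c, h⟩ := exists_profile (by omega) hss
  obtain ⟨R, hR, hR', hcar, hout, h0, hθ⟩ := h.outermost hn haf hS
  obtain ⟨m, hm, hm0, hle, heq, hvac⟩ := h.mass_inequality hn haf hdec hR hR' h0 hθ
  have hU : S.outside ∩ D.M = {x | R < ‖x‖} := by
    rw [hout]
    exact inter_eq_left.2 fun x (hx : R < ‖x‖) => hR'.trans hx.le
  -- The area is ρ^{n-1} times the volume of the unit sphere, so the exponent (n - 2)/(n - 1) turns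
  -- it into the initial value ρ^{n-2} of `hawking`.
  have hpow : (D.area S / sphereVolume n) ^ (((n : ℝ) - 2) / ((n : ℝ) - 1))
      = Real.sqrt (R ^ 2 * b (R ^ 2)) ^ (n - 2) := by
    have hn1 : ((n - 1 : ℕ) : ℝ) = (n : ℝ) - 1 := by rw [Nat.cast_sub (by omega), Nat.cast_one]
    have hn2 : ((n - 2 : ℕ) : ℝ) = (n : ℝ) - 2 := by rw [Nat.cast_sub (by omega), Nat.cast_ofNat]
    have hne : (n : ℝ) - 1 ≠ 0 := by
      rw [← hn1]; exact Nat.cast_ne_zero.2 (by omega)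
    rw [h.area_eq (by omega) hR hR' hcar hout,
      mul_div_cancel_right₀ _ (sphereVolume_pos (by omega)).ne', ← Real.rpow_natCast, hn1,
      ← Real.rpow_mul (Real.sqrt_nonneg _), mul_div_cancel₀ _ hne, ← hn2, Real.rpow_natCast]
  rw [hpow, hU]
  refine ⟨m, hm, hm0, hle, fun he => h.embedsInSchwarzschild hn hR hR' hθ (heq he),
    fun ⟨m', he⟩ => hvac fun s hs => ?_⟩
  have hs0 : 0 < s := (sq_nonneg R).trans_lt hs
  set x : EuclideanSpace ℝ (Fin n) := Real.sqrt s • EuclideanSpace.single ⟨0, by omega⟩ 1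
  have hx : ‖x‖ = Real.sqrt s := by
    simp [x, norm_smul, abs_of_nonneg (Real.sqrt_nonneg s)]
  have hxR : R < ‖x‖ := by rw [hx]; exact Real.lt_sqrt_of_sq_lt hs
  have h1 := he.energyDensity_eq_zero (by omega) (isOpen_lt continuous_const continuous_norm)
    (fun y (hy : R < ‖y‖) => hR'.trans hy.le) hxR
  rw [h.energyDensity_eq (hR'.trans_lt hxR), hx, Real.sq_sqrt hs0.le] at h1
  exact (div_eq_zero_iff.1 h1).resolve_right (by positivity)

end InitialDataSet
end SpacetimePenrose
end

theorem mainTheorem2 (n : ℕ) (hn : 3 ≤ n) :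
    (∀ (D : SpacetimePenrose.InitialDataSet n) (S : SpacetimePenrose.ClosedHypersurface n),
      D.IsAsymptoticallyFlat → D.IsSphericallySymmetric → D.DominantEnergyCondition →
      D.IsOutermostApparentHorizon S →
      ∃ m : ℝ, D.HasADMMass m ∧
        (1 / 2) * (D.area S / SpacetimePenrose.sphereVolume n) ^ (((n : ℝ) - 2) / ((n : ℝ) - 1))
          ≤ m ∧
        (m = (1 / 2) * (D.area S / SpacetimePenrose.sphereVolume n) ^
            (((n : ℝ) - 2) / ((n : ℝ) - 1)) ↔
          ∃ m' : ℝ, 0 < m' ∧ D.EmbedsInSchwarzschild (S.outside ∩ D.M) m') ∧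
        (m = (1 / 2) * (D.area S / SpacetimePenrose.sphereVolume n) ^
            (((n : ℝ) - 2) / ((n : ℝ) - 1)) →
          D.EmbedsInSchwarzschild (S.outside ∩ D.M) m)) ∧
    (∀ (D : ℕ → SpacetimePenrose.InitialDataSet n) (S : ℕ → SpacetimePenrose.ClosedHypersurface n)
      (m : ℕ → ℝ),
      (∀ j, (D j).IsAsymptoticallyFlat ∧ (D j).IsSphericallySymmetric ∧
        (D j).DominantEnergyCondition ∧ (D j).IsOutermostApparentHorizon (S j) ∧
        (D j).HasADMMass (m j)) →
      Filter.Tendsto m Filter.atTop (nhds 0) →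
      Filter.Tendsto (fun j => (D j).area (S j)) Filter.atTop (nhds 0)) := by
  have hn3 : (3 : ℝ) ≤ n := by exact_mod_cast hn
  refine ⟨fun D S haf hss hdec hS => ?_, fun D S m h hm => ?_⟩
  · obtain ⟨m, hm, hm0, hle, h1, h2⟩ :=
      SpacetimePenrose.InitialDataSet.penrose_inequality hn haf hss hdec hS
    have hemb := fun he : m = 1 / 2 * (D.area S / SpacetimePenrose.sphereVolume n) ^
      (((n : ℝ) - 2) / ((n : ℝ) - 1)) => h1 (by rw [he]; ring)
    refine ⟨m, hm, by linarith, ⟨fun he => ⟨m, hm0, hemb he⟩, fun ⟨m', _, he⟩ => ?_⟩, hemb⟩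
    rw [← h2 ⟨m', he⟩]
    ring
  · have hω := SpacetimePenrose.sphereVolume_pos (n := n) (by omega)
    have hp : 0 < ((n : ℝ) - 2) / ((n : ℝ) - 1) := div_pos (by linarith) (by linarith)
    have hy : ∀ j, 0 ≤ (D j).area (S j) / SpacetimePenrose.sphereVolume n := fun j =>
      div_nonneg ((D j).area_nonneg (S j)) hω.le
    have h1 : Tendsto (fun j => ((D j).area (S j) / SpacetimePenrose.sphereVolume n) ^
        (((n : ℝ) - 2) / ((n : ℝ) - 1))) atTop (𝓝 0) := by
      refine squeeze_zero (fun j => Real.rpow_nonneg (hy j) _) (fun j => ?_)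
        (by simpa using hm.const_mul 2)
      obtain ⟨haf, hss, hdec, hS, hmass⟩ := h j
      obtain ⟨m', hm', -, hle, -⟩ :=
        SpacetimePenrose.InitialDataSet.penrose_inequality hn haf hss hdec hS
      -- The prescribed mass is the one in the inequality because the ADM limits are unique.
      rwa [hmass.unique hm']
    -- Raising to the reciprocal power, which is positive and hence continuous at 0, passes from the
    -- power of the area ratio back to the area.
    have h2 := (h1.rpow_const (p := (((n : ℝ) - 2) / ((n : ℝ) - 1))⁻¹)
      (Or.inr (inv_nonneg.2 hp.le))).mul_const (SpacetimePenrose.sphereVolume n)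
    rw [Real.zero_rpow (inv_ne_zero hp.ne'), zero_mul] at h2
    refine h2.congr fun j => ?_
    rw [← Real.rpow_mul (hy j), mul_inv_cancel₀ hp.ne', Real.rpow_one, div_mul_cancel₀ _ hω.ne']
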